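/- **Theorem (commutation relations of the twisted Lie derivatives).** *Geometry.* Let $(M,g)$ be a smooth $n$-dimensional Riemannian manifold, $x'\in M$, and let $\mathcal U$ be a patch around $x'$ with normal coordinates $y=(y^a)$ centred at $x'$ (orthonormal at $x'$, rays from the origin are geodesics) whose coordinate range is open and star-shaped about $0$. Let $e_a$ be the orthonormal frame on $\mathcal U$ that equals $\partial/\partial y^a$ at $x'$ and is parallel along the geodesics from $x'$; let $\omega_\mu{}^a{}_b$ be its Levi-Civita (spin) connection and $R^a{}_{bcd}$ the frame components of its curvature, $[\nabla_c,\nabla_d]v^a=R^a{}_{bcd}v^b$. Assume $\nabla R=0$ on $\mathcal U$ (local symmetry). Indices $a,b,\dots$ are raised and lowered with $\delta_{ab}$, and repeated indices are summed. *Curvature algebra.* Write $R_{abcd}=\beta_{ik}E^i{}_{ab}E^k{}_{cd}$ at $x'$ with linearly independent antisymmetric matrices $E^i$ ($i=1,\dots,p$) and a symmetric nondegenerate matrix $\beta$. Put $D^a{}_{ib}=-\beta_{ik}E^k{}_{ab}$. For $A=(a,i)$ put $(\gamma_{AB})=\operatorname{diag}(\delta_{ab},\beta_{ik})$ with inverse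 $\gamma^{AB}$, let $K^a{}_b=R^a{}_{cbd}y^cy^d$ and let $\xi_A=(P_a,L_i)$ be the vector fields $$P_a=\bigl(\sqrt K\cot\sqrt K\bigr)^b{}_a\frac{\partial}{\partial y^b},\qquad L_i=-D^b{}_{ia}y^a\frac{\partial}{\partial y^b}.$$ *Bundle.* Let $\Sigma_{ab}$ and $X_{ab}$ be generators of finite-dimensional real or complex representations of $\mathfrak{so}(n)$ on $\Lambda$ and $W$, normalized by $[\Sigma_{ab},\Sigma_{cd}]=\delta_{bc}\Sigma_{ad}-\delta_{bd}\Sigma_{ac}-\delta_{ac}\Sigma_{bd}+\delta_{ad}\Sigma_{bc}$ (and likewise for $X$), and put $G_{ab}=\Sigma_{ab}\otimes 1+1\otimes X_{ab}$. Let $\mathcal V$ be a twisted spin-tensor bundle with fibre $\Lambda\otimes W$, whose connection in a local frame over $\mathcal U$ is $\nabla_\mu=\partial_\mu+\tfrac12\omega_\mu{}^{ab}\Sigma_{ab}\otimes 1+1\otimes\mathcal A_\mu$, where the Yang–Mills connection $\mathcal A$ has parallel curvature $\mathcal F$, $\nabla\mathcal F=0$. Let $q$ be the orthogonal projection onto the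 flat directions $\{v: R_{abcd}v^a=0\}$ and $h=1-q$; put $\mathcal B_{ab}=\mathcal F_{cd}q^c{}_aq^d{}_b$, and suppose that $X$ is the representation through which the rest of the curvature acts, $\mathcal F_{cd}h^c{}_ah^d{}_b=\tfrac12R^{cd}{}_{ab}X_{cd}$ on $\mathcal U$. Define $$S_A=\tfrac12\,\xi_A{}^a{}_{;b}\,G^b{}_a,\quad \mathcal L_A=\nabla_{\xi_A}+S_A,\quad \mathcal L^2=\gamma^{AB}\mathcal L_A\mathcal L_B,\quad \mathcal B_{AB}=\xi_A{}^a\xi_B{}^b\,(1\otimes\mathcal B_{ab}).$$ *Claim.* The $D_i$ span a Lie algebra, $[D_i,D_k]=F^j{}_{ik}D_j$ with unique constants $F^j{}_{ik}$. Let $C^i{}_{ab}=E^i{}_{ab}$, $C^a{}_{ib}=-C^a{}_{bi}=D^a{}_{ib}$, $C^i{}_{kl}=F^i{}_{kl}$, all other components being zero. Then on smooth sections of $\mathcal V$ over $\mathcal U$ $$[\mathcal L_A,\mathcal L_B]=C^C{}_{AB}\mathcal L_C+\mathcal B_{AB},\qquad [\mathcal L_A,\mathcal L^2]=2\gamma^{BC}\mathcal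 B_{AB}\mathcal L_C .$$ (These are the relations of the gauged curvature algebra.) -/

import Mathlib

open scoped Manifold ContDiff Bundle Kronecker

noncomputable section

namespace SymmetricBundle

/-! ### Local Riemannian geometry in coordinates -/

/-- The model space `ℝⁿ`, in which normal coordinates take their values. -/
abbrev Coord (n : ℕ) : Type := EuclideanSpace ℝ (Fin n)

/-- The partial derivative `∂f/∂y^μ`. -/
def pd {n : ℕ} {V : Type*} [NormedAddCommGroup V] [NormedSpace ℝ V]
    (μ : Fin n) (f : Coord n → V) (y : Coord n) : V :=
  fderiv ℝ f y (EuclideanSpace.single μ 1)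

/-- The entrywise partial derivative of a matrix-valued function. -/
def pdMat {n : ℕ} {ι 𝕜 : Type*} [RCLike 𝕜]
    (μ : Fin n) (f : Coord n → Matrix ι ι 𝕜) (y : Coord n) : Matrix ι ι 𝕜 :=
  Matrix.of fun i j => pd μ (fun z => f z i j) y

/-- The Christoffel symbol `Γ^ν_{μρ}` of the metric `g`. -/
def christoffel {n : ℕ} (g : Coord n → Matrix (Fin n) (Fin n) ℝ) (y : Coord n)
    (ν μ ρ : Fin n) : ℝ :=
  (1 / 2) * ∑ τ, (g y)⁻¹ ν τ *
    (pd μ (fun z => g z τ ρ) y + pd ρ (fun z => g z τ μ) y - pd τ (fun z => g z μ ρ) y)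

/-- The covariant derivative `(∇_μ e_b)^ν = ∂_μ e_b^ν + Γ^ν_{μρ} e_b^ρ` of the frame vectors;
the matrix `e y` has the entries `e y ν b = e_b^ν(y)`. -/
def frameDeriv {n : ℕ} (g e : Coord n → Matrix (Fin n) (Fin n) ℝ) (y : Coord n)
    (μ ν b : Fin n) : ℝ :=
  pd μ (fun z => e z ν b) y + ∑ ρ, christoffel g y ν μ ρ * e y ρ b

/-- The spin connection `ω_μ^a_b = e^a_ν (∇_μ e_b)^ν` of the frame `e`. -/
def spinConn {n : ℕ} (g e : Coord n → Matrix (Fin n) (Fin n) ℝ) (y : Coord n)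
    (μ : Fin n) : Matrix (Fin n) (Fin n) ℝ :=
  Matrix.of fun a b => ∑ ν, (e y)⁻¹ a ν * frameDeriv g e y μ ν b

/-- The curvature two-form `R^a_{b μν}` of the spin connection. -/
def curvForm {n : ℕ} (g e : Coord n → Matrix (Fin n) (Fin n) ℝ) (y : Coord n)
    (μ ν : Fin n) : Matrix (Fin n) (Fin n) ℝ :=
  pdMat μ (fun z => spinConn g e z ν) y - pdMat ν (fun z => spinConn g e z μ) y
    + (spinConn g e y μ * spinConn g e y ν - spinConn g e y ν * spinConn g e y μ)

/-- The frame components `R_{abcd} = R^a_{bcd}` of the Riemann tensor of `g`. -/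
def riemann {n : ℕ} (g e : Coord n → Matrix (Fin n) (Fin n) ℝ) (y : Coord n)
    (a b c d : Fin n) : ℝ :=
  ∑ μ, ∑ ν, e y μ c * e y ν d * curvForm g e y μ ν a b

/-- The covariant derivative `∇_μ R_{abcd}`. -/
def covRiemann {n : ℕ} (g e : Coord n → Matrix (Fin n) (Fin n) ℝ) (y : Coord n)
    (μ a b c d : Fin n) : ℝ :=
  pd μ (fun z => riemann g e z a b c d) y
    - ∑ f, (spinConn g e y μ f a * riemann g e y f b c d
          + spinConn g e y μ f b * riemann g e y a f c d
          + spinConn g e y μ f c * riemann g e y a b f d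
          + spinConn g e y μ f d * riemann g e y a b c f)

/-! ### The Yang-Mills connection -/

/-- The curvature `𝓕_{μν}` of the Yang-Mills connection `∂_μ + 𝒜_μ`. -/
def gaugeCurvForm {n : ℕ} {κ 𝕜 : Type*} [Fintype κ] [RCLike 𝕜]
    (𝒜 : Coord n → Fin n → Matrix κ κ 𝕜) (y : Coord n) (μ ν : Fin n) : Matrix κ κ 𝕜 :=
  pdMat μ (fun z => 𝒜 z ν) y - pdMat ν (fun z => 𝒜 z μ) y
    + (𝒜 y μ * 𝒜 y ν - 𝒜 y ν * 𝒜 y μ)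

/-- The frame components `𝓕_{ab}` of the Yang-Mills curvature. -/
def gaugeCurv {n : ℕ} {κ 𝕜 : Type*} [Fintype κ] [RCLike 𝕜]
    (e : Coord n → Matrix (Fin n) (Fin n) ℝ) (𝒜 : Coord n → Fin n → Matrix κ κ 𝕜)
    (y : Coord n) (a b : Fin n) : Matrix κ κ 𝕜 :=
  ∑ μ, ∑ ν, (e y μ a * e y ν b) • gaugeCurvForm 𝒜 y μ ν

/-- The covariant derivative `∇_μ 𝓕_{ab}`. -/
def covGaugeCurv {n : ℕ} {κ 𝕜 : Type*} [Fintype κ] [RCLike 𝕜]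
    (g e : Coord n → Matrix (Fin n) (Fin n) ℝ) (𝒜 : Coord n → Fin n → Matrix κ κ 𝕜)
    (y : Coord n) (μ a b : Fin n) : Matrix κ κ 𝕜 :=
  pdMat μ (fun z => gaugeCurv e 𝒜 z a b) y
    + (𝒜 y μ * gaugeCurv e 𝒜 y a b - gaugeCurv e 𝒜 y a b * 𝒜 y μ)
    - ∑ f, (spinConn g e y μ f a • gaugeCurv e 𝒜 y f b
          + spinConn g e y μ f b • gaugeCurv e 𝒜 y a f)

/-- The flat directions of a curvature tensor: the vectors `v` with `R_{abcd} v^a = 0`. -/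
def flatSpace {n : ℕ} (R : Fin n → Fin n → Fin n → Fin n → ℝ) : Submodule ℝ (Coord n) where
  carrier := {v | ∀ b c d, ∑ a, R a b c d * v a = 0}
  zero_mem' := by intro b c d; simp
  add_mem' := by
    intro v w hv hw b c d
    simp only [PiLp.add_apply, mul_add, Finset.sum_add_distrib, hv b c d, hw b c d, add_zero]
  smul_mem' := by
    intro t v hv b c d
    have h : ∀ a, R a b c d * (t • v) a = t * (R a b c d * v a) := by
      intro a
      simp only [PiLp.smul_apply, smul_eq_mul]
      ring
    simp only [h, ← Finset.mul_sum, hv b c d, mul_zero]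

/-- The orthogonal projection `q^a_b` onto the flat directions. -/
def flatProj {n : ℕ} (R : Fin n → Fin n → Fin n → Fin n → ℝ) : Matrix (Fin n) (Fin n) ℝ :=
  Matrix.of fun a b => (flatSpace R).starProjection (EuclideanSpace.single b 1) a

/-- The complementary projection `h = 1 - q` onto the semisimple directions. -/
def semisimpleProj {n : ℕ} (R : Fin n → Fin n → Fin n → Fin n → ℝ) :
    Matrix (Fin n) (Fin n) ℝ :=
  1 - flatProj R

/-- The flat part `𝓑_{ab} = 𝓕_{cd} q^c_a q^d_b` of the Yang-Mills curvature. -/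
def flatCurv {n : ℕ} {κ 𝕜 : Type*} [Fintype κ] [RCLike 𝕜]
    (g e : Coord n → Matrix (Fin n) (Fin n) ℝ) (𝒜 : Coord n → Fin n → Matrix κ κ 𝕜)
    (y : Coord n) (a b : Fin n) : Matrix κ κ 𝕜 :=
  ∑ c, ∑ d, (flatProj (riemann g e y) c a * flatProj (riemann g e y) d b)
    • gaugeCurv e 𝒜 y c d

/-- The semisimple part `𝓔_{ab} = 𝓕_{cd} h^c_a h^d_b` of the Yang-Mills curvature. -/
def semisimpleCurv {n : ℕ} {κ 𝕜 : Type*} [Fintype κ] [RCLike 𝕜]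
    (g e : Coord n → Matrix (Fin n) (Fin n) ℝ) (𝒜 : Coord n → Fin n → Matrix κ κ 𝕜)
    (y : Coord n) (a b : Fin n) : Matrix κ κ 𝕜 :=
  ∑ c, ∑ d, (semisimpleProj (riemann g e y) c a * semisimpleProj (riemann g e y) d b)
    • gaugeCurv e 𝒜 y c d

/-! ### The curvature algebra -/

/-- The matrices `D_i`, `D^a_{ib} = -β_{ik} E^k_{ab}`. -/
def holonomyGen {n p : ℕ} (E : Fin p → Matrix (Fin n) (Fin n) ℝ)
    (β : Matrix (Fin p) (Fin p) ℝ) (i : Fin p) : Matrix (Fin n) (Fin n) ℝ :=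
  -∑ k, β i k • E k

/-- The constants `C^A_{BC}`, with `C^i_{ab} = E^i_{ab}`, `C^a_{ib} = -C^a_{bi} = D^a_{ib}`,
`C^i_{kl} = F^i_{kl}` and all other components zero; the call is `structConst E β F A B C`. -/
def structConst {n p : ℕ} (E : Fin p → Matrix (Fin n) (Fin n) ℝ)
    (β : Matrix (Fin p) (Fin p) ℝ) (F : Fin p → Fin p → Fin p → ℝ) :
    Fin n ⊕ Fin p → Fin n ⊕ Fin p → Fin n ⊕ Fin p → ℝ
  | .inr i, .inl a, .inl b => E i a b
  | .inl a, .inr i, .inl b => holonomyGen E β i a b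
  | .inl a, .inl b, .inr i => -holonomyGen E β i a b
  | .inr i, .inr k, .inr l => F i k l
  | _, _, _ => 0

/-- The matrix `γ_{AB}`, with the blocks `δ_{ab}` and `β_{ik}`. -/
def gammaMat {p : ℕ} (n : ℕ) (β : Matrix (Fin p) (Fin p) ℝ) :
    Matrix (Fin n ⊕ Fin p) (Fin n ⊕ Fin p) ℝ :=
  Matrix.fromBlocks 1 0 0 β

/-! ### The Killing fields -/

/-- `K^a_b = R^a_{cbd} y^c y^d`. -/
def jacobiMat {n : ℕ} (R : Fin n → Fin n → Fin n → Fin n → ℝ) (y : Coord n) :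
    Matrix (Fin n) (Fin n) ℝ :=
  Matrix.of fun a b => ∑ c, ∑ d, R a c b d * y c * y d

/-- `cos √K` as an entire power series in `K`. -/
def cosSqrt {n : ℕ} (K : Matrix (Fin n) (Fin n) ℝ) : Matrix (Fin n) (Fin n) ℝ :=
  ∑' m : ℕ, ((-1 : ℝ) ^ m / (2 * m).factorial) • K ^ m

/-- `sin √K / √K` as an entire power series in `K`. -/
def sincSqrt {n : ℕ} (K : Matrix (Fin n) (Fin n) ℝ) : Matrix (Fin n) (Fin n) ℝ :=
  ∑' m : ℕ, ((-1 : ℝ) ^ m / (2 * m + 1).factorial) • K ^ m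

/-- `√K cot √K = cos √K (sin √K / √K)⁻¹`. -/
def sqrtCotSqrt {n : ℕ} (K : Matrix (Fin n) (Fin n) ℝ) : Matrix (Fin n) (Fin n) ℝ :=
  cosSqrt K * (sincSqrt K)⁻¹

/-- The component `ξ_A^μ(y)` along `∂/∂y^μ` of the Killing fields `ξ_A = (P_a, L_i)`:
`P_a^μ = (√K cot √K)^μ_a` and `L_i^μ = -D^μ_{ib} y^b`. -/
def killing {n p : ℕ} (g e : Coord n → Matrix (Fin n) (Fin n) ℝ)
    (E : Fin p → Matrix (Fin n) (Fin n) ℝ) (β : Matrix (Fin p) (Fin p) ℝ) :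
    Fin n ⊕ Fin p → Coord n → Fin n → ℝ
  | .inl a, y, μ => sqrtCotSqrt (jacobiMat (riemann g e 0) y) μ a
  | .inr i, y, μ => -∑ b, holonomyGen E β i μ b * y b

/-- The frame components `ξ_A^a = e^a_μ ξ_A^μ`. -/
def killingFrame {n p : ℕ} (g e : Coord n → Matrix (Fin n) (Fin n) ℝ)
    (E : Fin p → Matrix (Fin n) (Fin n) ℝ) (β : Matrix (Fin p) (Fin p) ℝ)
    (A : Fin n ⊕ Fin p) (y : Coord n) (a : Fin n) : ℝ :=
  ∑ μ, (e y)⁻¹ a μ * killing g e E β A y μ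

/-- The covariant derivative `ξ_A^a_{;b} = e_b^μ (∂_μ ξ_A^a + ω_μ^a_c ξ_A^c)`. -/
def killingDeriv {n p : ℕ} (g e : Coord n → Matrix (Fin n) (Fin n) ℝ)
    (E : Fin p → Matrix (Fin n) (Fin n) ℝ) (β : Matrix (Fin p) (Fin p) ℝ)
    (A : Fin n ⊕ Fin p) (y : Coord n) (a b : Fin n) : ℝ :=
  ∑ μ, e y μ b * (pd μ (fun z => killingFrame g e E β A z a) y
    + ∑ c, spinConn g e y μ a c * killingFrame g e E β A y c)

/-! ### Representations -/

/-- Generators `Z_{ab}` of a representation of the Lie algebra `so(n)`. -/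
structure IsSOGenerators {n : ℕ} {ι 𝕜 : Type*} [Fintype ι] [RCLike 𝕜]
    (Z : Fin n → Fin n → Matrix ι ι 𝕜) : Prop where
  antisymm : ∀ a b, Z b a = -Z a b
  commutator : ∀ a b c d, Z a b * Z c d - Z c d * Z a b =
    (if b = c then Z a d else 0) - (if b = d then Z a c else 0)
      - (if a = c then Z b d else 0) + (if a = d then Z b c else 0)

/-- `G_{ab} = Σ_{ab} ⊗ 1 + 1 ⊗ X_{ab}`. -/
def prodGen {n : ℕ} {ι κ 𝕜 : Type*} [DecidableEq ι] [DecidableEq κ] [RCLike 𝕜]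
    (S : Fin n → Fin n → Matrix ι ι 𝕜) (X : Fin n → Fin n → Matrix κ κ 𝕜) (a b : Fin n) :
    Matrix (ι × κ) (ι × κ) 𝕜 :=
  S a b ⊗ₖ (1 : Matrix κ κ 𝕜) + (1 : Matrix ι ι 𝕜) ⊗ₖ X a b

/-- The connection form `½ ω_μ^{ab} Σ_{ab} ⊗ 1 + 1 ⊗ 𝒜_μ` of the twisted spin-tensor bundle. -/
def totalConn {n : ℕ} {ι κ 𝕜 : Type*} [DecidableEq ι] [DecidableEq κ] [RCLike 𝕜]
    (g e : Coord n → Matrix (Fin n) (Fin n) ℝ) (S : Fin n → Fin n → Matrix ι ι 𝕜)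
    (𝒜 : Coord n → Fin n → Matrix κ κ 𝕜) (y : Coord n) (μ : Fin n) :
    Matrix (ι × κ) (ι × κ) 𝕜 :=
  ((1 / 2 : ℝ) • ∑ a, ∑ b, spinConn g e y μ a b • S a b) ⊗ₖ (1 : Matrix κ κ 𝕜)
    + (1 : Matrix ι ι 𝕜) ⊗ₖ 𝒜 y μ

/-- `S_A = ½ ξ_A^a_{;b} G^b_a`. -/
def lieEndo {n p : ℕ} {ι κ 𝕜 : Type*} [DecidableEq ι] [DecidableEq κ] [RCLike 𝕜]
    (g e : Coord n → Matrix (Fin n) (Fin n) ℝ)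
    (E : Fin p → Matrix (Fin n) (Fin n) ℝ) (β : Matrix (Fin p) (Fin p) ℝ)
    (S : Fin n → Fin n → Matrix ι ι 𝕜) (X : Fin n → Fin n → Matrix κ κ 𝕜)
    (A : Fin n ⊕ Fin p) (y : Coord n) : Matrix (ι × κ) (ι × κ) 𝕜 :=
  (1 / 2 : ℝ) • ∑ a, ∑ b, killingDeriv g e E β A y a b • prodGen S X b a

/-- `𝓑_{AB} = ξ_A^a ξ_B^b 𝓑_{ab}`, acting on the second tensor factor. -/
def killingFlatCurv {n p : ℕ} {κ 𝕜 : Type*} [Fintype κ] [RCLike 𝕜]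
    (ι : Type*) [DecidableEq ι]
    (g e : Coord n → Matrix (Fin n) (Fin n) ℝ)
    (E : Fin p → Matrix (Fin n) (Fin n) ℝ) (β : Matrix (Fin p) (Fin p) ℝ)
    (𝒜 : Coord n → Fin n → Matrix κ κ 𝕜)
    (A B : Fin n ⊕ Fin p) (y : Coord n) : Matrix (ι × κ) (ι × κ) 𝕜 :=
  (1 : Matrix ι ι 𝕜) ⊗ₖ
    ∑ a, ∑ b, (killingFrame g e E β A y a * killingFrame g e E β B y b) • flatCurv g e 𝒜 y a b

/-! ### Normal coordinates, frames, and curvature decomposition -/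

section Manifold

variable {n : ℕ} {M : Type*} [TopologicalSpace M] [ChartedSpace (Coord n) M]

/-- The vector field on the patch with the components `v^μ(y)` along `∂/∂y^μ`. -/
def vectorInChart (φ : OpenPartialHomeomorph M (Coord n)) (v : Coord n → Fin n → ℝ) (x : M) :
    TangentSpace (𝓡 n) x :=
  VectorField.mpullback (𝓡 n) (𝓡 n) φ
    (fun y : Coord n => (WithLp.toLp 2 (v y) : TangentSpace (𝓡 n) y)) x

/-- The coordinate vector field `∂/∂y^μ` on the patch. -/
def coordVec (φ : OpenPartialHomeomorph M (Coord n)) (μ : Fin n) (x : M) :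
    TangentSpace (𝓡 n) x :=
  vectorInChart φ (fun _ => Pi.single μ 1) x

/-- The components `g_{μν}(y)` of the Riemannian metric of `M` in the coordinates `φ`. -/
def metricInChart [Bundle.RiemannianBundle (fun x : M => TangentSpace (𝓡 n) x)]
    (φ : OpenPartialHomeomorph M (Coord n)) (y : Coord n) : Matrix (Fin n) (Fin n) ℝ :=
  Matrix.of fun μ ν => inner ℝ (coordVec φ μ (φ.symm y)) (coordVec φ ν (φ.symm y))

/-- `φ` is a system of normal coordinates centred at `x'` on a patch which is star-shaped about
`x'`: the coordinates are orthonormal at `x'`, and the rays `t ↦ t y` are geodesics. -/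
structure IsNormalChart [IsManifold (𝓡 n) ∞ M]
    [Bundle.RiemannianBundle (fun x : M => TangentSpace (𝓡 n) x)]
    (φ : OpenPartialHomeomorph M (Coord n)) (x' : M) : Prop where
  mem_atlas : φ ∈ IsManifold.maximalAtlas (𝓡 n) ∞ M
  mem_source : x' ∈ φ.source
  map_center : φ x' = 0
  starConvex : StarConvex ℝ 0 φ.target
  orthonormal : metricInChart φ 0 = 1
  geodesic : ∀ y ∈ φ.target, ∀ ν, ∑ μ, ∑ ρ, christoffel (metricInChart φ) y ν μ ρ * y μ * y ρ = 0

end Manifold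

/-- `e` is the smooth orthonormal frame on `U` obtained from the coordinate frame at the origin
by parallel transport along the rays from the origin. -/
structure IsRadialFrame {n : ℕ} (g e : Coord n → Matrix (Fin n) (Fin n) ℝ)
    (U : Set (Coord n)) : Prop where
  smooth : ∀ μ a, ContDiffOn ℝ ∞ (fun y => e y μ a) U
  orthonormal : ∀ y ∈ U, (e y).transpose * g y * e y = 1
  center : e 0 = 1
  parallel : ∀ y ∈ U, ∀ ν b, ∑ μ, y μ * frameDeriv g e y μ ν b = 0

/-- A decomposition `R_{abcd} = β_{ik} E^i_{ab} E^k_{cd}` of a curvature tensor, where the `E^i`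
are linearly independent antisymmetric matrices and `β` is symmetric and nondegenerate. -/
structure IsCurvDecomp {n p : ℕ} (R : Fin n → Fin n → Fin n → Fin n → ℝ)
    (E : Fin p → Matrix (Fin n) (Fin n) ℝ) (β : Matrix (Fin p) (Fin p) ℝ) : Prop where
  antisymm : ∀ i, (E i).transpose = -E i
  linearIndependent : LinearIndependent ℝ E
  symm : β.IsSymm
  nondegenerate : IsUnit β.det
  decomp : ∀ a b c d, R a b c d = ∑ i, ∑ k, β i k * E i a b * E k c d

/-! ### Twisted spin-tensor bundles and twisted Lie derivatives -/

section Bundle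

variable {n p : ℕ} {M : Type*} [TopologicalSpace M] [ChartedSpace (Coord n) M]
  {ι κ 𝕜 : Type*} [Fintype ι] [DecidableEq ι] [Fintype κ] [DecidableEq κ] [RCLike 𝕜]
  {𝒱 : M → Type*} [TopologicalSpace (Bundle.TotalSpace (ι × κ → 𝕜) 𝒱)]
  [∀ x, AddCommGroup (𝒱 x)] [∀ x, Module ℝ (𝒱 x)] [∀ x, TopologicalSpace (𝒱 x)]
  [FiberBundle (ι × κ → 𝕜) 𝒱] [VectorBundle ℝ (ι × κ → 𝕜) 𝒱]

/-- `τ` is a smooth, fibrewise linear local frame of the bundle over the patch `U`. -/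
structure IsSmoothLocalFrame
    (τ : Bundle.Trivialization (ι × κ → 𝕜) (Bundle.TotalSpace.proj (F := ι × κ → 𝕜) (E := 𝒱)))
    (U : Set M) : Prop where
  subset : U ⊆ τ.baseSet
  isLinear : τ.IsLinear ℝ
  smooth : ContMDiffOn ((𝓡 n).prod 𝓘(ℝ, ι × κ → 𝕜)) ((𝓡 n).prod 𝓘(ℝ, ι × κ → 𝕜)) ∞
    τ τ.source
  smooth_symm : ContMDiffOn ((𝓡 n).prod 𝓘(ℝ, ι × κ → 𝕜)) ((𝓡 n).prod 𝓘(ℝ, ι × κ → 𝕜)) ∞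
    τ.toOpenPartialHomeomorph.symm τ.target

/-- The section `σ` in the coordinates `φ` and the local frame `τ` of the bundle. -/
def localRep (φ : OpenPartialHomeomorph M (Coord n))
    (τ : Bundle.Trivialization (ι × κ → 𝕜) (Bundle.TotalSpace.proj (F := ι × κ → 𝕜) (E := 𝒱)))
    (σ : ∀ x, 𝒱 x) (y : Coord n) : ι × κ → 𝕜 :=
  (τ ⟨φ.symm y, σ (φ.symm y)⟩).2

/-- In the coordinates `φ` and the local frame `τ`, the connection `cov` is the one induced by the
spin connection, in the representation with generators `S`, and the Yang-Mills connection `𝒜`: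
`∇_μ σ = ∂_μ σ + (½ ω_μ^{ab} Σ_{ab} ⊗ 1 + 1 ⊗ 𝒜_μ) σ`. -/
def IsTwistedSpinConnection [∀ x, IsTopologicalAddGroup (𝒱 x)] [∀ x, ContinuousSMul ℝ (𝒱 x)]
    (φ : OpenPartialHomeomorph M (Coord n))
    (τ : Bundle.Trivialization (ι × κ → 𝕜) (Bundle.TotalSpace.proj (F := ι × κ → 𝕜) (E := 𝒱)))
    (g e : Coord n → Matrix (Fin n) (Fin n) ℝ) (S : Fin n → Fin n → Matrix ι ι 𝕜)
    (𝒜 : Coord n → Fin n → Matrix κ κ 𝕜)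
    (cov : CovariantDerivative (𝓡 n) (ι × κ → 𝕜) 𝒱) : Prop :=
  ∀ y ∈ φ.target, ∀ σ : (∀ x, 𝒱 x),
    MDifferentiableAt (𝓡 n) ((𝓡 n).prod 𝓘(ℝ, ι × κ → 𝕜))
      (fun x => Bundle.TotalSpace.mk' (ι × κ → 𝕜) x (σ x)) (φ.symm y) →
    ∀ μ, (τ ⟨φ.symm y, cov σ (φ.symm y) (coordVec φ μ (φ.symm y))⟩).2 =
      pd μ (localRep φ τ σ) y + (totalConn g e S 𝒜 y μ).mulVec (localRep φ τ σ y)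

/-- The action on sections of a matrix-valued function, in the local frame `τ`. -/
def endoAct (φ : OpenPartialHomeomorph M (Coord n))
    (τ : Bundle.Trivialization (ι × κ → 𝕜) (Bundle.TotalSpace.proj (F := ι × κ → 𝕜) (E := 𝒱)))
    (T : Coord n → Matrix (ι × κ) (ι × κ) 𝕜) (σ : ∀ x, 𝒱 x) (x : M) : 𝒱 x :=
  τ.symm x ((T (φ x)).mulVec (τ ⟨x, σ x⟩).2)

/-- The twisted Lie derivative `𝓛_A σ = ∇_{ξ_A} σ + S_A σ` on the patch. -/
def twistedLie [∀ x, IsTopologicalAddGroup (𝒱 x)] [∀ x, ContinuousSMul ℝ (𝒱 x)]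
    (φ : OpenPartialHomeomorph M (Coord n))
    (τ : Bundle.Trivialization (ι × κ → 𝕜) (Bundle.TotalSpace.proj (F := ι × κ → 𝕜) (E := 𝒱)))
    (cov : CovariantDerivative (𝓡 n) (ι × κ → 𝕜) 𝒱)
    (g e : Coord n → Matrix (Fin n) (Fin n) ℝ)
    (E : Fin p → Matrix (Fin n) (Fin n) ℝ) (β : Matrix (Fin p) (Fin p) ℝ)
    (S : Fin n → Fin n → Matrix ι ι 𝕜) (X : Fin n → Fin n → Matrix κ κ 𝕜)
    (A : Fin n ⊕ Fin p) (σ : ∀ x, 𝒱 x) (x : M) : 𝒱 x :=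
  cov σ x (vectorInChart φ (killing g e E β A) x)
    + endoAct φ τ (lieEndo g e E β S X A) σ x

/-- `𝓛² = γ^{AB} 𝓛_A 𝓛_B`. -/
def twistedLieSq [∀ x, IsTopologicalAddGroup (𝒱 x)] [∀ x, ContinuousSMul ℝ (𝒱 x)]
    (φ : OpenPartialHomeomorph M (Coord n))
    (τ : Bundle.Trivialization (ι × κ → 𝕜) (Bundle.TotalSpace.proj (F := ι × κ → 𝕜) (E := 𝒱)))
    (cov : CovariantDerivative (𝓡 n) (ι × κ → 𝕜) 𝒱)
    (g e : Coord n → Matrix (Fin n) (Fin n) ℝ)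
    (E : Fin p → Matrix (Fin n) (Fin n) ℝ) (β : Matrix (Fin p) (Fin p) ℝ)
    (S : Fin n → Fin n → Matrix ι ι 𝕜) (X : Fin n → Fin n → Matrix κ κ 𝕜)
    (σ : ∀ x, 𝒱 x) (x : M) : 𝒱 x :=
  ∑ A, ∑ B, (gammaMat n β)⁻¹ A B •
    twistedLie φ τ cov g e E β S X A (twistedLie φ τ cov g e E β S X B σ) x

end Bundle

end SymmetricBundle

end

open SymmetricBundle

noncomputable section

namespace SymmetricBundle

open scoped Matrix.Norms.Operator Topology Matrix

/-! ### Partial derivatives -/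

section Calculus

variable {n : ℕ} {U : Set (Coord n)} {y : Coord n}
  {V W Z : Type*} [NormedAddCommGroup V] [NormedSpace ℝ V] [NormedAddCommGroup W]
  [NormedSpace ℝ W] [NormedAddCommGroup Z] [NormedSpace ℝ Z]

/-- The Euler operator `y^μ ∂_μ`. -/
def euler (f : Coord n → V) (y : Coord n) : V :=
  fderiv ℝ f y y

theorem differentiableAt_of_smooth {f : Coord n → V} (hf : ContDiffOn ℝ ∞ f U) (hU : IsOpen U)
    (hy : y ∈ U) : DifferentiableAt ℝ f y :=
  (hf.contDiffAt (hU.mem_nhds hy)).differentiableAt (by simp)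

theorem pd_const (μ : Fin n) (v : V) : pd μ (fun _ => v) y = 0 := by
  simp [pd]

theorem pd_add (μ : Fin n) {f h : Coord n → V} (hf : DifferentiableAt ℝ f y)
    (hh : DifferentiableAt ℝ h y) : pd μ (fun z => f z + h z) y = pd μ f y + pd μ h y := by
  simp [pd, fderiv_fun_add hf hh]

theorem pd_sub (μ : Fin n) {f h : Coord n → V} (hf : DifferentiableAt ℝ f y)
    (hh : DifferentiableAt ℝ h y) : pd μ (fun z => f z - h z) y = pd μ f y - pd μ h y := by
  simp [pd, fderiv_fun_sub hf hh]

theorem pd_neg (μ : Fin n) {f : Coord n → V} : pd μ (fun z => -f z) y = -pd μ f y := by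
  simp [pd, fderiv_fun_neg]

theorem pd_sum {ι : Type*} (s : Finset ι) (μ : Fin n) {f : ι → Coord n → V}
    (hf : ∀ i ∈ s, DifferentiableAt ℝ (f i) y) :
    pd μ (fun z => ∑ i ∈ s, f i z) y = ∑ i ∈ s, pd μ (f i) y := by
  simp [pd, fderiv_fun_sum hf]

theorem pd_congr {f h : Coord n → V} (hU : IsOpen U) (hy : y ∈ U) (hfh : ∀ z ∈ U, f z = h z)
    (μ : Fin n) : pd μ f y = pd μ h y := by
  have : f =ᶠ[𝓝 y] h := by
    filter_upwards [hU.mem_nhds hy] with z hz using hfh z hz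
  simp [pd, this.fderiv_eq]

theorem pd_linear [FiniteDimensional ℝ V] (L : V →ₗ[ℝ] W) (μ : Fin n) {f : Coord n → V}
    (hf : DifferentiableAt ℝ f y) : pd μ (fun z => L (f z)) y = L (pd μ f y) := by
  have h := (L.toContinuousLinearMap.hasFDerivAt (x := f y)).comp y hf.hasFDerivAt
  have h' : HasFDerivAt (fun z => L (f z)) (L.toContinuousLinearMap.comp (fderiv ℝ f y)) y := h
  simp [pd, h'.fderiv]

theorem contDiffOn_linear [FiniteDimensional ℝ V] (L : V →ₗ[ℝ] W) {f : Coord n → V}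
    (hf : ContDiffOn ℝ ∞ f U) : ContDiffOn ℝ ∞ (fun z => L (f z)) U :=
  L.toContinuousLinearMap.contDiff.comp_contDiffOn hf

theorem fderiv_bilinear_apply [FiniteDimensional ℝ V] [FiniteDimensional ℝ W]
    (B : V →ₗ[ℝ] W →ₗ[ℝ] Z) (v : Coord n) {f : Coord n → V} {h : Coord n → W}
    (hf : DifferentiableAt ℝ f y) (hh : DifferentiableAt ℝ h y) :
    fderiv ℝ (fun z => B (f z) (h z)) y v
      = B (fderiv ℝ f y v) (h y) + B (f y) (fderiv ℝ h y v) := by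
  have h' := B.toContinuousBilinearMap.hasFDerivAt_of_bilinear hf.hasFDerivAt hh.hasFDerivAt
  have h'' : fderiv ℝ (fun z => B (f z) (h z)) y = _ := h'.fderiv
  simp [h'', add_comm]

theorem euler_bilinear [FiniteDimensional ℝ V] [FiniteDimensional ℝ W]
    (B : V →ₗ[ℝ] W →ₗ[ℝ] Z) {f : Coord n → V} {h : Coord n → W}
    (hf : DifferentiableAt ℝ f y) (hh : DifferentiableAt ℝ h y) :
    euler (fun z => B (f z) (h z)) y = B (euler f y) (h y) + B (f y) (euler h y) :=
  fderiv_bilinear_apply B _ hf hh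

theorem euler_add {f h : Coord n → V} (hf : DifferentiableAt ℝ f y)
    (hh : DifferentiableAt ℝ h y) : euler (fun z => f z + h z) y = euler f y + euler h y := by
  simp [euler, fderiv_fun_add hf hh]

theorem euler_sub {f h : Coord n → V} (hf : DifferentiableAt ℝ f y)
    (hh : DifferentiableAt ℝ h y) : euler (fun z => f z - h z) y = euler f y - euler h y := by
  simp [euler, fderiv_fun_sub hf hh]

theorem euler_neg {f : Coord n → V} : euler (fun z => -f z) y = -euler f y := by
  simp [euler, fderiv_fun_neg]

theorem euler_const (v : V) : euler (fun _ => v) y = 0 := by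
  simp [euler]

theorem euler_sum {ι : Type*} (s : Finset ι) {f : ι → Coord n → V}
    (hf : ∀ i ∈ s, DifferentiableAt ℝ (f i) y) :
    euler (fun z => ∑ i ∈ s, f i z) y = ∑ i ∈ s, euler (f i) y := by
  simp [euler, fderiv_fun_sum hf]

theorem euler_prodMk {f : Coord n → V} {h : Coord n → W} (hf : DifferentiableAt ℝ f y)
    (hh : DifferentiableAt ℝ h y) : euler (fun z => (f z, h z)) y = (euler f y, euler h y) := by
  simp [euler, (hf.hasFDerivAt.prodMk hh.hasFDerivAt).fderiv]

theorem euler_linear [FiniteDimensional ℝ V] (L : V →ₗ[ℝ] W) {f : Coord n → V}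
    (hf : DifferentiableAt ℝ f y) : euler (fun z => L (f z)) y = L (euler f y) := by
  have h := (L.toContinuousLinearMap.hasFDerivAt (x := f y)).comp y hf.hasFDerivAt
  have h' : HasFDerivAt (fun z => L (f z)) (L.toContinuousLinearMap.comp (fderiv ℝ f y)) y := h
  simp [euler, h'.fderiv]

theorem pd_bilinear [FiniteDimensional ℝ V] [FiniteDimensional ℝ W] (B : V →ₗ[ℝ] W →ₗ[ℝ] Z)
    (μ : Fin n) {f : Coord n → V} {h : Coord n → W} (hf : DifferentiableAt ℝ f y)
    (hh : DifferentiableAt ℝ h y) :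
    pd μ (fun z => B (f z) (h z)) y = B (pd μ f y) (h y) + B (f y) (pd μ h y) :=
  fderiv_bilinear_apply B _ hf hh

theorem contDiffOn_bilinear [FiniteDimensional ℝ V] [FiniteDimensional ℝ W]
    (B : V →ₗ[ℝ] W →ₗ[ℝ] Z) {f : Coord n → V} {h : Coord n → W} (hf : ContDiffOn ℝ ∞ f U)
    (hh : ContDiffOn ℝ ∞ h U) : ContDiffOn ℝ ∞ (fun z => B (f z) (h z)) U :=
  B.toContinuousBilinearMap.isBoundedBilinearMap.contDiff.comp_contDiffOn (hf.prodMk hh)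

theorem contDiffOn_pd {f : Coord n → V} (hf : ContDiffOn ℝ ∞ f U) (hU : IsOpen U) (μ : Fin n) :
    ContDiffOn ℝ ∞ (pd μ f) U :=
  (hf.fderiv_of_isOpen hU (by simp)).clm_apply contDiffOn_const

theorem pd_comm {f : Coord n → V} (hf : ContDiffOn ℝ ∞ f U) (hU : IsOpen U) (hy : y ∈ U)
    (μ ν : Fin n) : pd μ (pd ν f) y = pd ν (pd μ f) y := by
  have hs : IsSymmSndFDerivAt ℝ f y :=
    (hf.contDiffAt (hU.mem_nhds hy)).isSymmSndFDerivAt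
      (by simpa using (WithTop.coe_le_coe.2 (le_top : (2 : ℕ∞) ≤ ⊤)))
  have hd : DifferentiableAt ℝ (fderiv ℝ f) y :=
    ((hf.fderiv_of_isOpen (m := ∞) hU (by simp)).contDiffAt (hU.mem_nhds hy)).differentiableAt
      (by simp)
  have key : ∀ α β : Fin n, pd α (pd β f) y =
      fderiv ℝ (fderiv ℝ f) y (EuclideanSpace.single α 1) (EuclideanSpace.single β 1) := by
    intro α β
    change fderiv ℝ (fun z => (fderiv ℝ f z) ((fun _ => EuclideanSpace.single β (1 : ℝ)) z)) y _ = _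
    rw [fderiv_clm_apply hd (differentiableAt_const _)]
    simp
  rw [key, key]
  exact hs _ _

theorem coord_eq_sum (v : Coord n) : v = ∑ μ, v μ • EuclideanSpace.single μ (1 : ℝ) := by
  ext a
  simp [Finset.sum_apply, Pi.single_apply]

theorem fderiv_eq_sum_pd (f : Coord n → V) (y v : Coord n) :
    fderiv ℝ f y v = ∑ μ, v μ • pd μ f y := by
  conv_lhs => rw [coord_eq_sum v]
  simp [pd]

theorem euler_eq_sum_pd (f : Coord n → V) (y : Coord n) : euler f y = ∑ μ, y μ • pd μ f y :=
  fderiv_eq_sum_pd f y y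

theorem pd_coord (μ : Fin n) : pd μ (fun z : Coord n => z.ofLp) y = Pi.single μ 1 := by
  have h : HasFDerivAt (fun z : Coord n => z.ofLp)
      (EuclideanSpace.equiv (Fin n) ℝ).toContinuousLinearMap y :=
    (EuclideanSpace.equiv (Fin n) ℝ).toContinuousLinearMap.hasFDerivAt
  rw [pd, h.fderiv]
  ext a
  simp [Pi.single_apply]

theorem contDiffOn_coord : ContDiffOn ℝ ∞ (fun z : Coord n => z.ofLp) U :=
  (EuclideanSpace.equiv (Fin n) ℝ).toContinuousLinearMap.contDiff.contDiffOn

theorem pd_coord_apply (μ ν : Fin n) :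
    pd ν (fun z : Coord n => z μ) y = if μ = ν then 1 else 0 := by
  have h := pd_linear (LinearMap.proj (R := ℝ) (φ := fun _ : Fin n => ℝ) μ) ν
    (f := fun z : Coord n => z.ofLp) (y := y)
    (differentiableAt_of_smooth contDiffOn_coord isOpen_univ (Set.mem_univ y))
  rw [pd_coord] at h
  simpa [Pi.single_apply] using h

theorem contDiffOn_coord_apply (μ : Fin n) : ContDiffOn ℝ ∞ (fun z : Coord n => z μ) U :=
  contDiffOn_linear (LinearMap.proj (R := ℝ) (φ := fun _ : Fin n => ℝ) μ) contDiffOn_coord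

theorem differentiableAt_coord : DifferentiableAt ℝ (fun z : Coord n => z.ofLp) y :=
  differentiableAt_of_smooth contDiffOn_coord isOpen_univ (Set.mem_univ y)

theorem differentiableAt_coord_apply (μ : Fin n) :
    DifferentiableAt ℝ (fun z : Coord n => z μ) y :=
  differentiableAt_of_smooth (contDiffOn_coord_apply μ) isOpen_univ (Set.mem_univ y)

theorem euler_coord : euler (fun z : Coord n => z.ofLp) y = y.ofLp := by
  rw [euler_eq_sum_pd]
  ext a
  simp [pd_coord, Pi.single_apply]

theorem pd_sum_coord_smul [FiniteDimensional ℝ V] (ν : Fin n) {f : Fin n → Coord n → V}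
    (hf : ∀ μ, DifferentiableAt ℝ (f μ) y) :
    pd ν (fun z => ∑ μ, z μ • f μ z) y = f ν y + ∑ μ, y μ • pd ν (f μ) y := by
  rw [pd_sum (f := fun μ z => z μ • f μ z) _ _ fun μ _ =>
    (differentiableAt_coord_apply μ).smul (hf μ)]
  have h : ∀ μ, pd ν (fun z => z μ • f μ z) y
      = (if μ = ν then (1 : ℝ) else 0) • f μ y + y μ • pd ν (f μ) y := by
    intro μ
    rw [← pd_coord_apply μ ν (y := y)]
    exact pd_bilinear (LinearMap.lsmul ℝ V) ν (differentiableAt_coord_apply μ) (hf μ)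
  simp [h, Finset.sum_add_distrib]

/-- The commutator of a partial derivative with the Euler operator `y^μ ∂_μ`. -/
theorem euler_pd_add_pd [FiniteDimensional ℝ V] {f : Coord n → V} (hf : ContDiffOn ℝ ∞ f U)
    (hU : IsOpen U) (hy : y ∈ U) (μ : Fin n) :
    euler (pd μ f) y + pd μ f y = pd μ (euler f) y := by
  rw [euler_eq_sum_pd, funext (euler_eq_sum_pd f), pd_sum_coord_smul μ fun ν =>
    differentiableAt_of_smooth (contDiffOn_pd hf hU ν) hU hy, add_comm]
  simp only [pd_comm hf hU hy μ]

/-- A functional which vanishes on the values of a function vanishes on its derivatives. -/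
theorem pd_mem_submodule [FiniteDimensional ℝ V] (S : Submodule ℝ V) {f : Coord n → V}
    (hU : IsOpen U) (hy : y ∈ U) (hf : DifferentiableAt ℝ f y) (h : ∀ z ∈ U, f z ∈ S)
    (μ : Fin n) : pd μ f y ∈ S := by
  by_contra hn
  obtain ⟨l, hl, hS⟩ := Submodule.exists_le_ker_of_notMem hn
  apply hl
  rw [← pd_linear l μ hf, pd_congr hU hy (h := fun _ => (0 : ℝ)), pd_const]
  intro z hz
  exact hS (h z hz)

/-! ### Matrix-valued functions -/

section MatrixValued

variable {ι κ : Type*} [Fintype ι] [Fintype κ] {𝕜 : Type*} [RCLike 𝕜]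

theorem pd_matrix_apply (μ : Fin n) {f : Coord n → Matrix ι κ 𝕜} (hf : DifferentiableAt ℝ f y)
    (i : ι) (j : κ) : pd μ f y i j = pd μ (fun z => f z i j) y :=
  (pd_linear (Matrix.entryLinearMap ℝ 𝕜 i j) μ hf).symm

theorem pd_pi_apply (μ : Fin n) {f : Coord n → ι → V} (hf : DifferentiableAt ℝ f y)
    (i : ι) : pd μ f y i = pd μ (fun z => f z i) y := by
  have h := hasFDerivAt_pi.1 (show HasFDerivAt (fun z i => f z i)
    (ContinuousLinearMap.pi fun i => (ContinuousLinearMap.proj i).comp (fderiv ℝ f y)) y from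
    hf.hasFDerivAt)
  rw [pd, pd, (h i).fderiv]
  rfl

theorem pdMat_eq_pd (μ : Fin n) {f : Coord n → Matrix ι ι 𝕜} (hf : DifferentiableAt ℝ f y) :
    pdMat μ f y = pd μ f y := by
  ext i j
  exact (pd_matrix_apply μ hf i j).symm

theorem contDiffOn_matrix {f : Coord n → Matrix ι κ 𝕜}
    (hf : ∀ i j, ContDiffOn ℝ ∞ (fun z => f z i j) U) : ContDiffOn ℝ ∞ f U := by
  classical
  have h : f = fun z => ∑ i, ∑ j, (Matrix.singleLinearMap ℝ i j) (f z i j) := by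
    ext z i j
    conv_lhs => rw [Matrix.matrix_eq_sum_single (f z)]
    rfl
  rw [h]
  exact ContDiffOn.sum fun i _ => ContDiffOn.sum fun j _ =>
    contDiffOn_linear (Matrix.singleLinearMap ℝ i j) (hf i j)

theorem contDiffOn_entry {f : Coord n → Matrix ι κ 𝕜} (hf : ContDiffOn ℝ ∞ f U) (i : ι) (j : κ) :
    ContDiffOn ℝ ∞ (fun z => f z i j) U :=
  contDiffOn_linear (Matrix.entryLinearMap ℝ 𝕜 i j) hf

/-- Matrix multiplication as a real bilinear map. -/
def mulBilin (ι 𝕜 : Type*) [Fintype ι] [RCLike 𝕜] :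
    Matrix ι ι 𝕜 →ₗ[ℝ] Matrix ι ι 𝕜 →ₗ[ℝ] Matrix ι ι 𝕜 :=
  LinearMap.mk₂ ℝ (fun A B => A * B) (by intros; rw [add_mul]) (by intros; rw [smul_mul_assoc])
    (by intros; rw [mul_add]) (by intros; rw [mul_smul_comm])

/-- The action of matrices on vectors as a real bilinear map. -/
def mulVecBilin (ι 𝕜 : Type*) [Fintype ι] [RCLike 𝕜] :
    Matrix ι ι 𝕜 →ₗ[ℝ] (ι → 𝕜) →ₗ[ℝ] (ι → 𝕜) :=
  LinearMap.mk₂ ℝ (fun A v => A.mulVec v) (by intros; rw [Matrix.add_mulVec])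
    (by intros; rw [Matrix.smul_mulVec]) (by intros; rw [Matrix.mulVec_add])
    (by intros; rw [Matrix.mulVec_smul])

/-- Real scalar multiplication as a bilinear map. -/
def smulBilin (V : Type*) [AddCommGroup V] [Module ℝ V] : ℝ →ₗ[ℝ] V →ₗ[ℝ] V :=
  LinearMap.lsmul ℝ V

theorem pd_mul (μ : Fin n) {f h : Coord n → Matrix ι ι 𝕜} (hf : DifferentiableAt ℝ f y)
    (hh : DifferentiableAt ℝ h y) :
    pd μ (fun z => f z * h z) y = pd μ f y * h y + f y * pd μ h y :=
  pd_bilinear (mulBilin ι 𝕜) μ hf hh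

theorem pd_mulVec (μ : Fin n) {f : Coord n → Matrix ι ι 𝕜} {v : Coord n → ι → 𝕜}
    (hf : DifferentiableAt ℝ f y) (hv : DifferentiableAt ℝ v y) :
    pd μ (fun z => (f z).mulVec (v z)) y
      = (pd μ f y).mulVec (v y) + (f y).mulVec (pd μ v y) :=
  pd_bilinear (mulVecBilin ι 𝕜) μ hf hv

theorem contDiffOn_mul {f h : Coord n → Matrix ι ι 𝕜} (hf : ContDiffOn ℝ ∞ f U)
    (hh : ContDiffOn ℝ ∞ h U) : ContDiffOn ℝ ∞ (fun z => f z * h z) U :=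
  contDiffOn_bilinear (mulBilin ι 𝕜) hf hh

theorem contDiffOn_mulVec {f : Coord n → Matrix ι ι 𝕜} {v : Coord n → ι → 𝕜}
    (hf : ContDiffOn ℝ ∞ f U) (hv : ContDiffOn ℝ ∞ v U) :
    ContDiffOn ℝ ∞ (fun z => (f z).mulVec (v z)) U :=
  contDiffOn_bilinear (mulVecBilin ι 𝕜) hf hv

end MatrixValued

end Calculus

/-! ### Linear differential equations along rays -/

section Radial

theorem eq_of_hasDerivAt_zero {V : Type*} [NormedAddCommGroup V] [NormedSpace ℝ V] {x : ℝ → V}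
    (hc : ContinuousOn x (Set.Icc 0 1)) (hd : ∀ t ∈ Set.Ioo (0 : ℝ) 1, HasDerivAt x 0 t) :
    x 1 = x 0 := by
  have hconst : ∀ t ∈ Set.Ioo (0 : ℝ) 1, x t = x (1 / 2) := by
    intro t ht
    refine isOpen_Ioo.is_const_of_deriv_eq_zero isPreconnected_Ioo
      (fun s hs => (hd s hs).differentiableAt.differentiableWithinAt)
      (fun s hs => (hd s hs).deriv) ht (by norm_num)
  have hcl : ∀ t ∈ Set.Icc (0 : ℝ) 1, x t = x (1 / 2) := by
    have h := Set.EqOn.of_subset_closure (s := Set.Ioo (0 : ℝ) 1) (t := Set.Icc (0 : ℝ) 1)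
      (f := x) (g := fun _ => x (1 / 2)) hconst hc continuousOn_const Set.Ioo_subset_Icc_self
      (by rw [closure_Ioo (by norm_num)])
    exact h
  rw [hcl 1 (by simp), hcl 0 (by simp)]

/-- The solution of a linear differential equation with constant coefficients. -/
theorem eq_exp_of_hasDerivAt {V : Type*} [NormedAddCommGroup V] [NormedSpace ℝ V]
    [CompleteSpace V] {x : ℝ → V} (T : V →L[ℝ] V) (hc : ContinuousOn x (Set.Icc 0 1))
    (hd : ∀ t ∈ Set.Ioo (0 : ℝ) 1, HasDerivAt x (T (x t)) t) :
    x 1 = NormedSpace.exp T (x 0) := by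
  let _ := NormedAlgebra.restrictScalars ℚ ℝ (V →L[ℝ] V)
  have hexp : ∀ t : ℝ, HasDerivAt (fun t : ℝ => NormedSpace.exp (t • -T))
      (NormedSpace.exp (t • -T) * -T) t := fun t => hasDerivAt_exp_smul_const (-T) t
  have h := eq_of_hasDerivAt_zero (x := fun t => NormedSpace.exp (t • -T) (x t)) ?_ ?_
  · simp only [one_smul, zero_smul, NormedSpace.exp_zero, one_apply_eq_self] at h
    rw [← h, ← mul_apply_eq_comp, ← NormedSpace.exp_add_of_commute
      (Commute.neg_right (Commute.refl T))]
    simp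
  · exact ContinuousOn.clm_apply (fun t _ => (hexp t).continuousAt.continuousWithinAt) hc
  · intro t ht
    have := (hexp t).clm_apply (hd t ht)
    simpa using this

variable {n : ℕ} {U : Set (Coord n)} {V : Type*} [NormedAddCommGroup V] [NormedSpace ℝ V]

theorem smul_mem_of_starConvex (hU : StarConvex ℝ 0 U) {y : Coord n} (hy : y ∈ U) {t : ℝ}
    (ht : t ∈ Set.Icc (0 : ℝ) 1) : t • y ∈ U :=
  hU.smul_mem hy ht.1 ht.2

theorem hasDerivAt_ray {f : Coord n → V} {y : Coord n} {t : ℝ}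
    (hf : DifferentiableAt ℝ f (t • y)) :
    HasDerivAt (fun s : ℝ => f (s • y)) (fderiv ℝ f (t • y) y) t := by
  have h1 : HasDerivAt (fun s : ℝ => s • y) ((1 : ℝ) • y) t := (hasDerivAt_id t).smul_const y
  rw [one_smul] at h1
  exact hf.hasFDerivAt.comp_hasDerivAt t h1

/-- A solution of `y^μ ∂_μ Z = T(y) Z` with `T` linear in `y` is determined along rays by its value
at the origin. -/
theorem radial_eq_zero [FiniteDimensional ℝ V] (hU : StarConvex ℝ 0 U) {Z : Coord n → V}
    (hZ : ∀ y ∈ U, DifferentiableAt ℝ Z y) (T : Coord n →ₗ[ℝ] V →ₗ[ℝ] V)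
    (h : ∀ y ∈ U, euler Z y = T y (Z y)) (h0 : Z 0 = 0) : ∀ y ∈ U, Z y = 0 := by
  intro y hy
  have := FiniteDimensional.complete ℝ V
  have hray : ∀ t ∈ Set.Icc (0 : ℝ) 1, HasDerivAt (fun s : ℝ => Z (s • y))
      (fderiv ℝ Z (t • y) y) t :=
    fun t ht => hasDerivAt_ray (hZ _ (smul_mem_of_starConvex hU hy ht))
  have := eq_exp_of_hasDerivAt (x := fun s : ℝ => Z (s • y)) (T y).toContinuousLinearMap
    (fun t ht => (hray t ht).continuousAt.continuousWithinAt) ?_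
  · simpa [h0] using this
  · intro t ht
    have h1 := hray t (Set.Ioo_subset_Icc_self ht)
    have h2 := h _ (smul_mem_of_starConvex hU hy (Set.Ioo_subset_Icc_self ht))
    rw [euler, map_smul, map_smul, LinearMap.smul_apply] at h2
    have h3 := smul_right_injective V ht.1.ne' h2
    rw [h3] at h1
    exact h1

/-- The only regular solution of `y^μ ∂_μ Z + Z = T(y) Z` with `T` linear in `y` is zero. -/
theorem radial_add_eq_zero [FiniteDimensional ℝ V] (hU : StarConvex ℝ 0 U) {Z : Coord n → V}
    (hZ : ∀ y ∈ U, DifferentiableAt ℝ Z y) (T : Coord n →ₗ[ℝ] V →ₗ[ℝ] V)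
    (h : ∀ y ∈ U, euler Z y + Z y = T y (Z y)) : ∀ y ∈ U, Z y = 0 := by
  intro y hy
  have := FiniteDimensional.complete ℝ V
  have hray : ∀ t ∈ Set.Icc (0 : ℝ) 1, HasDerivAt (fun s : ℝ => s • Z (s • y))
      (T y (t • Z (t • y))) t := by
    intro t ht
    have hm := smul_mem_of_starConvex hU hy ht
    have h1 := (hasDerivAt_id t).smul (hasDerivAt_ray (hZ _ hm))
    have h2 := h _ hm
    simp only [euler, id, one_smul, map_smul, LinearMap.smul_apply] at h1 h2 ⊢
    rw [h2] at h1
    exact h1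
  have := eq_exp_of_hasDerivAt (x := fun s : ℝ => s • Z (s • y)) (T y).toContinuousLinearMap
    (fun t ht => (hray t ht).continuousAt.continuousWithinAt)
    (fun t ht => hray t (Set.Ioo_subset_Icc_self ht))
  simpa using this

end Radial

/-! ### Algebra of the curvature operator -/

section CurvatureAlgebra

variable {n p : ℕ}

theorem vec_induction {P : (Fin n → ℝ) → Prop} (h0 : P 0) (hadd : ∀ u v, P u → P v → P (u + v))
    (hsmul : ∀ (c : ℝ) u, P u → P (c • u)) (hsingle : ∀ a, P (Pi.single a 1)) (u : Fin n → ℝ) :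
    P u := by
  rw [pi_eq_sum_univ' u]
  refine Finset.sum_induction _ P hadd h0 fun a _ => hsmul _ _ ?_
  convert hsingle a using 1

/-- The curvature operator `R(u, v)^a_b = R^a_{bcd} u^c v^d`. -/
def curvOp (R : Fin n → Fin n → Fin n → Fin n → ℝ) :
    (Fin n → ℝ) →ₗ[ℝ] (Fin n → ℝ) →ₗ[ℝ] Matrix (Fin n) (Fin n) ℝ :=
  LinearMap.mk₂ ℝ (fun u v => Matrix.of fun a b => ∑ c, ∑ d, u c * v d * R a b c d)
    (by intros; ext; simp [add_mul, Finset.sum_add_distrib])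
    (by intros; ext; simp [mul_assoc, Finset.mul_sum])
    (by intros; ext; simp [mul_add, add_mul, Finset.sum_add_distrib])
    (by intros; ext; simp [mul_assoc, mul_left_comm, Finset.mul_sum])

theorem curvOp_apply (R : Fin n → Fin n → Fin n → Fin n → ℝ) (u v : Fin n → ℝ) (a b : Fin n) :
    curvOp R u v a b = ∑ c, ∑ d, u c * v d * R a b c d := rfl

theorem curvOp_single (R : Fin n → Fin n → Fin n → Fin n → ℝ) (a b c d : Fin n) :
    curvOp R (Pi.single c 1) (Pi.single d 1) a b = R a b c d := by
  simp [curvOp_apply, Pi.single_apply]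

variable {R : Fin n → Fin n → Fin n → Fin n → ℝ} {E : Fin p → Matrix (Fin n) (Fin n) ℝ}
  {β : Matrix (Fin p) (Fin p) ℝ}

theorem curvOp_eq_sum (hE : IsCurvDecomp R E β) (u v : Fin n → ℝ) :
    curvOp R u v = ∑ i, ∑ k, (β i k * (u ⬝ᵥ E k *ᵥ v)) • E i := by
  ext a b
  simp only [curvOp_apply, hE.decomp, Matrix.sum_apply, Matrix.smul_apply, smul_eq_mul,
    dotProduct, Matrix.mulVec, Finset.mul_sum, Finset.sum_mul]
  rw [Finset.sum_congr rfl fun c _ => Finset.sum_comm, Finset.sum_comm]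
  refine Finset.sum_congr rfl fun i _ => ?_
  rw [Finset.sum_congr rfl fun c _ => Finset.sum_comm, Finset.sum_comm]
  refine Finset.sum_congr rfl fun k _ => Finset.sum_congr rfl fun c _ =>
    Finset.sum_congr rfl fun d _ => by ring

theorem curvOp_eq_neg_sum (hE : IsCurvDecomp R E β) (u v : Fin n → ℝ) :
    curvOp R u v = -∑ k, (u ⬝ᵥ E k *ᵥ v) • holonomyGen E β k := by
  rw [curvOp_eq_sum hE, Finset.sum_comm]
  simp only [holonomyGen, smul_neg, Finset.sum_neg_distrib, neg_neg, Finset.smul_sum, smul_smul]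
  refine Finset.sum_congr rfl fun k _ => Finset.sum_congr rfl fun i _ => ?_
  rw [hE.symm.apply, mul_comm]

theorem dotProduct_mulVec_antisymm {A : Matrix (Fin n) (Fin n) ℝ} (hA : Aᵀ = -A)
    (u v : Fin n → ℝ) : v ⬝ᵥ A *ᵥ u = -(u ⬝ᵥ A *ᵥ v) := by
  rw [Matrix.dotProduct_mulVec, ← Matrix.mulVec_transpose, hA, Matrix.neg_mulVec,
    neg_dotProduct, dotProduct_comm]

theorem curvOp_antisymm (hE : IsCurvDecomp R E β) (u v : Fin n → ℝ) :
    curvOp R v u = -curvOp R u v := by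
  simp only [curvOp_eq_sum hE, dotProduct_mulVec_antisymm (hE.antisymm _) u v, mul_neg, neg_smul,
    Finset.sum_neg_distrib]

/-- The holonomy algebra, spanned by the matrices `E^i`. -/
def holonomy (E : Fin p → Matrix (Fin n) (Fin n) ℝ) : Submodule ℝ (Matrix (Fin n) (Fin n) ℝ) :=
  Submodule.span ℝ (Set.range E)

theorem mem_holonomy (E : Fin p → Matrix (Fin n) (Fin n) ℝ) (i : Fin p) : E i ∈ holonomy E :=
  Submodule.subset_span ⟨i, rfl⟩

theorem curvOp_mem_holonomy (hE : IsCurvDecomp R E β) (u v : Fin n → ℝ) :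
    curvOp R u v ∈ holonomy E := by
  rw [curvOp_eq_sum hE]
  exact Submodule.sum_mem _ fun i _ => Submodule.sum_mem _ fun k _ =>
    Submodule.smul_mem _ _ (mem_holonomy E i)

theorem holonomyGen_mem_holonomy (i : Fin p) : holonomyGen E β i ∈ holonomy E :=
  Submodule.neg_mem _ (Submodule.sum_mem _ fun k _ => Submodule.smul_mem _ _ (mem_holonomy E k))

theorem transpose_of_mem_holonomy (hE : IsCurvDecomp R E β) {Q : Matrix (Fin n) (Fin n) ℝ}
    (hQ : Q ∈ holonomy E) : Qᵀ = -Q := by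
  induction hQ using Submodule.span_induction with
  | mem x hx => obtain ⟨i, rfl⟩ := hx; exact hE.antisymm i
  | zero => simp
  | add x y _ _ hx hy => rw [Matrix.transpose_add, hx, hy, neg_add]
  | smul c x _ hx => rw [Matrix.transpose_smul, hx, smul_neg]

theorem eq_zero_of_dotProduct {A : Matrix (Fin n) (Fin n) ℝ} (h : ∀ u v, u ⬝ᵥ A *ᵥ v = 0) :
    A = 0 := by
  ext a b
  simpa using h (Pi.single a 1) (Pi.single b 1)

/-- The holonomy algebra is spanned by the curvature operators. -/
theorem holonomy_le (hE : IsCurvDecomp R E β) {S : Submodule ℝ (Matrix (Fin n) (Fin n) ℝ)}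
    (hS : ∀ u v, curvOp R u v ∈ S) : holonomy E ≤ S := by
  rw [holonomy, Submodule.span_le]
  rintro _ ⟨i, rfl⟩
  by_contra hn
  obtain ⟨l, hl, hker⟩ := Submodule.exists_le_ker_of_notMem hn
  apply hl
  have h1 : ∑ k, (∑ i, l (E i) * β i k) • E k = 0 := by
    apply eq_zero_of_dotProduct
    intro u v
    have h2 : l (curvOp R u v) = 0 := hker (hS u v)
    rw [curvOp_eq_sum hE, Finset.sum_comm] at h2
    simp only [map_sum, map_smul, smul_eq_mul] at h2
    simp only [Matrix.sum_mulVec, Matrix.smul_mulVec, dotProduct_sum, dotProduct_smul, smul_eq_mul]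
    rw [← h2]
    refine Finset.sum_congr rfl fun k _ => ?_
    rw [Finset.sum_mul]
    exact Finset.sum_congr rfl fun j _ => by ring
  have h3 := Fintype.linearIndependent_iff.1 hE.linearIndependent _ h1
  have h4 : (fun i => l (E i)) ᵥ* β = 0 := by
    ext k
    exact h3 k
  have h5 := congrArg (fun w => w ᵥ* β⁻¹) h4
  simp only [Matrix.vecMul_vecMul, Matrix.mul_nonsing_inv β hE.nondegenerate, Matrix.vecMul_one,
    Matrix.zero_vecMul] at h5
  exact congrFun h5 i

/-- The Lie algebra of the matrices whose action preserves the curvature tensor. -/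
def curvStabilizer (R : Fin n → Fin n → Fin n → Fin n → ℝ) :
    Submodule ℝ (Matrix (Fin n) (Fin n) ℝ) where
  carrier := {Q | ∀ u v, Q * curvOp R u v - curvOp R u v * Q
    = curvOp R (Q *ᵥ u) v + curvOp R u (Q *ᵥ v)}
  zero_mem' := by intro u v; simp
  add_mem' := by
    intro A B hA hB u v
    have h := congrArg₂ (· + ·) (hA u v) (hB u v)
    simp only [Matrix.add_mulVec, map_add, LinearMap.add_apply, add_mul, mul_add] at h ⊢
    linear_combination (norm := abel) h
  smul_mem' := by
    intro c A hA u v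
    simp only [Matrix.smul_mulVec, map_smul, LinearMap.smul_apply, smul_mul_assoc,
      mul_smul_comm, ← smul_sub, ← smul_add, hA u v]

theorem mem_curvStabilizer {Q : Matrix (Fin n) (Fin n) ℝ} :
    Q ∈ curvStabilizer R ↔ ∀ u v, Q * curvOp R u v - curvOp R u v * Q
      = curvOp R (Q *ᵥ u) v + curvOp R u (Q *ᵥ v) := Iff.rfl

theorem curvStabilizer_commutator {A B : Matrix (Fin n) (Fin n) ℝ} (hA : A ∈ curvStabilizer R)
    (hB : B ∈ curvStabilizer R) : A * B - B * A ∈ curvStabilizer R := by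
  rw [mem_curvStabilizer] at *
  intro u v
  have h1 : A * curvOp R u v = curvOp R u v * A + curvOp R (A *ᵥ u) v + curvOp R u (A *ᵥ v) := by
    rw [add_assoc, ← hA]; abel
  have h2 : B * curvOp R u v = curvOp R u v * B + curvOp R (B *ᵥ u) v + curvOp R u (B *ᵥ v) := by
    rw [add_assoc, ← hB]; abel
  have e1 : A * B * curvOp R u v - curvOp R u v * (A * B)
      = (A * (B * curvOp R u v) - A * curvOp R u v * B)
        + (A * curvOp R u v - curvOp R u v * A) * B := by noncomm_ring
  have e2 : B * A * curvOp R u v - curvOp R u v * (B * A)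
      = (B * (A * curvOp R u v) - B * curvOp R u v * A)
        + (B * curvOp R u v - curvOp R u v * B) * A := by noncomm_ring
  have e3 : (A * B - B * A) * curvOp R u v - curvOp R u v * (A * B - B * A)
      = (A * B * curvOp R u v - curvOp R u v * (A * B))
        - (B * A * curvOp R u v - curvOp R u v * (B * A)) := by noncomm_ring
  have a1 := hA (B *ᵥ u) v
  have a2 := hA u (B *ᵥ v)
  have b1 := hB (A *ᵥ u) v
  have b2 := hB u (A *ᵥ v)
  rw [e3, e1, e2, h1, h2, Matrix.sub_mulVec, Matrix.sub_mulVec]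
  simp only [map_sub, LinearMap.sub_apply, ← Matrix.mulVec_mulVec, mul_add, add_mul,
    ← mul_assoc] at *
  linear_combination (norm := skip) a1 + a2 - b1 - b2
  rw [h1, h2]
  noncomm_ring

end CurvatureAlgebra

/-! ### Radially parallel frames of locally symmetric spaces -/

/-- A coframe `θ` and a torsion-free connection `Ω` in the radial gauge, whose curvature has
constant and parallel frame components `R`; the vector `θ y μ` has the components `θ^a_μ(y)`. -/
structure SymmetricFrame {n : ℕ} (U : Set (Coord n)) (θ : Coord n → Fin n → Fin n → ℝ)
    (Ω : Coord n → Fin n → Matrix (Fin n) (Fin n) ℝ)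
    (R : Fin n → Fin n → Fin n → Fin n → ℝ) : Prop where
  isOpen : IsOpen U
  starConvex : StarConvex ℝ 0 U
  zero_mem : (0 : Coord n) ∈ U
  smooth_coframe : ∀ μ, ContDiffOn ℝ ∞ (fun y => θ y μ) U
  smooth_conn : ∀ μ, ContDiffOn ℝ ∞ (fun y => Ω y μ) U
  center : ∀ μ, θ 0 μ = Pi.single μ 1
  radial_coframe : ∀ y ∈ U, ∑ μ, y μ • θ y μ = y.ofLp
  radial_conn : ∀ y ∈ U, ∑ μ, y μ • Ω y μ = 0
  torsion : ∀ y ∈ U, ∀ μ ν, pd μ (fun z => θ z ν) y + Ω y μ *ᵥ θ y ν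
    = pd ν (fun z => θ z μ) y + Ω y ν *ᵥ θ y μ
  curv : ∀ y ∈ U, ∀ μ ν, pd μ (fun z => Ω z ν) y - pd ν (fun z => Ω z μ) y
    + (Ω y μ * Ω y ν - Ω y ν * Ω y μ) = curvOp R (θ y μ) (θ y ν)
  parallel : ∀ y ∈ U, ∀ μ, Ω y μ ∈ curvStabilizer R

namespace SymmetricFrame

variable {n p : ℕ} {U : Set (Coord n)} {θ : Coord n → Fin n → Fin n → ℝ}
  {Ω : Coord n → Fin n → Matrix (Fin n) (Fin n) ℝ} {R : Fin n → Fin n → Fin n → Fin n → ℝ}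
  {E : Fin p → Matrix (Fin n) (Fin n) ℝ} {β : Matrix (Fin p) (Fin p) ℝ} {y : Coord n}

theorem diff_coframe (h : SymmetricFrame U θ Ω R) (hy : y ∈ U) (μ : Fin n) :
    DifferentiableAt ℝ (fun z => θ z μ) y :=
  differentiableAt_of_smooth (h.smooth_coframe μ) h.isOpen hy

theorem diff_conn (h : SymmetricFrame U θ Ω R) (hy : y ∈ U) (μ : Fin n) :
    DifferentiableAt ℝ (fun z => Ω z μ) y :=
  differentiableAt_of_smooth (h.smooth_conn μ) h.isOpen hy

/-- The algebraic Bianchi identity. -/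
theorem bianchi (h : SymmetricFrame U θ Ω R) (u v w : Fin n → ℝ) :
    curvOp R u v *ᵥ w + curvOp R v w *ᵥ u + curvOp R w u *ᵥ v = 0 := by
  have key : ∀ a b c : Fin n, curvOp R (Pi.single a 1) (Pi.single b 1) *ᵥ Pi.single c 1
      + curvOp R (Pi.single b 1) (Pi.single c 1) *ᵥ Pi.single a 1
      + curvOp R (Pi.single c 1) (Pi.single a 1) *ᵥ Pi.single b 1 = 0 := by
    intro a b c
    have hθ := fun μ => h.smooth_coframe μ
    have h0 := h.zero_mem
    have hd2 : ∀ l m, DifferentiableAt ℝ (pd l (fun z => θ z m)) 0 := fun l m =>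
      differentiableAt_of_smooth (contDiffOn_pd (hθ m) h.isOpen l) h.isOpen h0
    have hd3 : ∀ l m, DifferentiableAt ℝ (fun z => Ω z l *ᵥ θ z m) 0 := fun l m =>
      differentiableAt_of_smooth (contDiffOn_mulVec (h.smooth_conn l) (hθ m)) h.isOpen h0
    have hT : ∀ l m k, pd l (pd m (fun z => θ z k)) 0 + (pd l (fun z => Ω z m) 0 *ᵥ θ 0 k
          + Ω 0 m *ᵥ pd l (fun z => θ z k) 0)
        = pd l (pd k (fun z => θ z m)) 0 + (pd l (fun z => Ω z k) 0 *ᵥ θ 0 m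
          + Ω 0 k *ᵥ pd l (fun z => θ z m) 0) := by
      intro l m k
      rw [← pd_mulVec l (h.diff_conn h0 m) (h.diff_coframe h0 k),
        ← pd_mulVec l (h.diff_conn h0 k) (h.diff_coframe h0 m),
        ← pd_add l (hd2 m k) (hd3 m k), ← pd_add l (hd2 k m) (hd3 k m)]
      exact pd_congr h.isOpen h0 (fun z hz => h.torsion z hz m k) l
    have t : ∀ l m k, Ω 0 l *ᵥ (pd m (fun z => θ z k) 0 + Ω 0 m *ᵥ θ 0 k)
        = Ω 0 l *ᵥ (pd k (fun z => θ z m) 0 + Ω 0 k *ᵥ θ 0 m) := fun l m k => by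
      rw [h.torsion 0 h0]
    have c1 := h.curv 0 h0 a b
    have c2 := h.curv 0 h0 b c
    have c3 := h.curv 0 h0 c a
    have s := fun l m k => pd_comm (hθ k) h.isOpen h0 l m
    rw [h.center, h.center] at c1 c2 c3
    rw [← c1, ← c2, ← c3, ← h.center a, ← h.center b, ← h.center c]
    simp only [Matrix.add_mulVec, Matrix.sub_mulVec, ← Matrix.mulVec_mulVec, Matrix.mulVec_add]
      at t ⊢
    linear_combination (norm := skip) hT a b c + hT b c a + hT c a b - s a b c - s b c a - s c a b
      - t b a c - t c b a - t a c b
    abel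
  refine vec_induction (P := fun u => curvOp R u v *ᵥ w + curvOp R v w *ᵥ u
    + curvOp R w u *ᵥ v = 0)
    (by simp only [map_zero, LinearMap.zero_apply, Matrix.zero_mulVec, Matrix.mulVec_zero,
      add_zero]) ?_ ?_ ?_ u
  · intro x y hx hy
    simp only [map_add, LinearMap.add_apply, Matrix.add_mulVec, Matrix.mulVec_add]
    linear_combination (norm := abel) hx + hy
  · intro t x hx
    simp only [map_smul, LinearMap.smul_apply, Matrix.smul_mulVec, Matrix.mulVec_smul,
      ← smul_add, hx, smul_zero]
  intro a
  refine vec_induction (P := fun v => curvOp R (Pi.single a 1) v *ᵥ w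
    + curvOp R v w *ᵥ (Pi.single a 1) + curvOp R w (Pi.single a 1) *ᵥ v = 0)
    (by simp only [map_zero, LinearMap.zero_apply, Matrix.zero_mulVec, Matrix.mulVec_zero,
      add_zero]) ?_ ?_ ?_ v
  · intro x y hx hy
    simp only [map_add, LinearMap.add_apply, Matrix.add_mulVec, Matrix.mulVec_add]
    linear_combination (norm := abel) hx + hy
  · intro t x hx
    simp only [map_smul, LinearMap.smul_apply, Matrix.smul_mulVec, Matrix.mulVec_smul,
      ← smul_add, hx, smul_zero]
  intro b
  refine vec_induction (P := fun w => curvOp R (Pi.single a 1) (Pi.single b 1) *ᵥ w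
    + curvOp R (Pi.single b 1) w *ᵥ (Pi.single a 1)
    + curvOp R w (Pi.single a 1) *ᵥ (Pi.single b 1) = 0)
    (by simp only [map_zero, LinearMap.zero_apply, Matrix.zero_mulVec, Matrix.mulVec_zero,
      add_zero]) ?_ ?_ (key a b) w
  · intro x y hx hy
    simp only [map_add, LinearMap.add_apply, Matrix.add_mulVec, Matrix.mulVec_add]
    linear_combination (norm := abel) hx + hy
  · intro t x hx
    simp only [map_smul, LinearMap.smul_apply, Matrix.smul_mulVec, Matrix.mulVec_smul,
      ← smul_add, hx, smul_zero]

theorem curvOp_mem_curvStabilizer (h : SymmetricFrame U θ Ω R) (u v : Fin n → ℝ) :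
    curvOp R u v ∈ curvStabilizer R := by
  have h0 := h.zero_mem
  have key : ∀ a b : Fin n, curvOp R (Pi.single a 1) (Pi.single b 1) ∈ curvStabilizer R := by
    intro a b
    rw [← h.center a, ← h.center b, ← h.curv 0 h0 a b]
    have hp : ∀ μ ν, pd μ (fun z => Ω z ν) 0 ∈ curvStabilizer R := fun μ ν =>
      pd_mem_submodule _ h.isOpen h0 (h.diff_conn h0 ν) (fun z hz => h.parallel z hz ν) μ
    exact Submodule.add_mem _ (Submodule.sub_mem _ (hp a b) (hp b a))
      (curvStabilizer_commutator (h.parallel 0 h0 a) (h.parallel 0 h0 b))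
  refine vec_induction (P := fun u => curvOp R u v ∈ curvStabilizer R) (by simp)
    (fun x y hx hy => by simpa using Submodule.add_mem _ hx hy)
    (fun c x hx => by simpa using Submodule.smul_mem _ c hx) (fun a => ?_) u
  exact vec_induction (P := fun v => curvOp R (Pi.single a 1) v ∈ curvStabilizer R) (by simp)
    (fun x y hx hy => by simpa using Submodule.add_mem _ hx hy)
    (fun c x hx => by simpa using Submodule.smul_mem _ c hx) (key a) v

theorem holonomy_le_curvStabilizer (h : SymmetricFrame U θ Ω R) (hE : IsCurvDecomp R E β) :
    holonomy E ≤ curvStabilizer R :=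
  holonomy_le hE h.curvOp_mem_curvStabilizer

theorem holonomy_commutator (h : SymmetricFrame U θ Ω R) (hE : IsCurvDecomp R E β)
    {A B : Matrix (Fin n) (Fin n) ℝ} (hA : A ∈ holonomy E) (hB : B ∈ holonomy E) :
    A * B - B * A ∈ holonomy E := by
  have hle : holonomy E ≤ (holonomy E).comap
      (LinearMap.mulLeft ℝ A - LinearMap.mulRight ℝ A) := by
    refine holonomy_le hE fun u v => ?_
    rw [Submodule.mem_comap]
    simp only [LinearMap.sub_apply, LinearMap.mulLeft_apply, LinearMap.mulRight_apply]
    rw [h.holonomy_le_curvStabilizer hE hA u v]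
    exact Submodule.add_mem _ (curvOp_mem_holonomy hE _ _) (curvOp_mem_holonomy hE _ _)
  exact hle hB

/-- The coframe along the rays. -/
theorem euler_coframe (h : SymmetricFrame U θ Ω R) (hy : y ∈ U) (ν : Fin n) :
    euler (fun z => θ z ν) y + θ y ν = Pi.single ν 1 + Ω y ν *ᵥ y.ofLp := by
  have h1 := pd_congr h.isOpen hy h.radial_coframe ν
  rw [pd_coord, pd_sum_coord_smul ν (f := fun μ z => θ z μ) (fun μ => h.diff_coframe hy μ)] at h1
  have h2 : ∑ μ, y μ • (pd μ (fun z => θ z ν) y + Ω y μ *ᵥ θ y ν)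
      = ∑ μ, y μ • (pd ν (fun z => θ z μ) y + Ω y ν *ᵥ θ y μ) :=
    Finset.sum_congr rfl fun μ _ => by rw [h.torsion y hy μ ν]
  have h3 : ∑ μ, y μ • (Ω y μ *ᵥ θ y ν) = 0 := by
    simp only [← Matrix.smul_mulVec, ← Matrix.sum_mulVec, h.radial_conn y hy, Matrix.zero_mulVec]
  have h4 : ∑ μ, y μ • (Ω y ν *ᵥ θ y μ) = Ω y ν *ᵥ y.ofLp := by
    simp only [← Matrix.mulVec_smul, ← Matrix.mulVec_sum, h.radial_coframe y hy]
  simp only [smul_add, Finset.sum_add_distrib, h3, h4, add_zero] at h2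
  rw [euler_eq_sum_pd, h2, ← h1]
  abel

/-- The connection along the rays. -/
theorem euler_conn (h : SymmetricFrame U θ Ω R) (hy : y ∈ U) (ν : Fin n) :
    euler (fun z => Ω z ν) y + Ω y ν = curvOp R y.ofLp (θ y ν) := by
  have h1 := pd_congr h.isOpen hy h.radial_conn ν
  rw [pd_const, pd_sum_coord_smul ν (f := fun μ z => Ω z μ) (fun μ => h.diff_conn hy μ)] at h1
  have h2 : ∑ μ, y μ • (pd μ (fun z => Ω z ν) y - pd ν (fun z => Ω z μ) y
      + (Ω y μ * Ω y ν - Ω y ν * Ω y μ)) = ∑ μ, y μ • curvOp R (θ y μ) (θ y ν) :=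
    Finset.sum_congr rfl fun μ _ => by rw [h.curv y hy μ ν]
  have h3 : ∑ μ, y μ • curvOp R (θ y μ) (θ y ν) = curvOp R y.ofLp (θ y ν) := by
    conv_rhs => rw [← h.radial_coframe y hy]
    simp only [map_sum, LinearMap.sum_apply, map_smul, LinearMap.smul_apply]
  have h4 : ∑ μ, y μ • (Ω y μ * Ω y ν) = 0 := by
    simp only [← smul_mul_assoc, ← Finset.sum_mul, h.radial_conn y hy, zero_mul]
  have h5 : ∑ μ, y μ • (Ω y ν * Ω y μ) = 0 := by
    simp only [← mul_smul_comm, ← Finset.mul_sum, h.radial_conn y hy, mul_zero]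
  rw [h3] at h2
  rw [← h2, euler_eq_sum_pd]
  simp only [smul_add, smul_sub, Finset.sum_add_distrib, Finset.sum_sub_distrib, h4, h5]
  linear_combination (norm := abel) h1

theorem conn_mem_holonomy (h : SymmetricFrame U θ Ω R) (hE : IsCurvDecomp R E β) (hy : y ∈ U)
    (μ : Fin n) : Ω y μ ∈ holonomy E := by
  by_contra hn
  obtain ⟨l, hl, hker⟩ := Submodule.exists_le_ker_of_notMem hn
  apply hl
  refine radial_add_eq_zero h.starConvex (Z := fun z => l (Ω z μ))
    (fun z hz => differentiableAt_of_smooth (contDiffOn_linear l (h.smooth_conn μ)) h.isOpen hz)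
    0 (fun z hz => ?_) y hy
  have h2 : l (curvOp R z.ofLp (θ z μ)) = 0 := hker (curvOp_mem_holonomy hE _ _)
  rw [euler_linear l (h.diff_conn hz μ), ← map_add, h.euler_conn hz μ, h2]
  simp

end SymmetricFrame

/-! ### Killing fields as parallel pairs -/

/-- A pair of a vector field `u` and a holonomy-valued matrix field `Q` (the covariant derivative
of `u`) such that `∇u = Q` and `∇_v Q = R(v, u)`. -/
structure IsKillingPair {n p : ℕ} (U : Set (Coord n)) (θ : Coord n → Fin n → Fin n → ℝ)
    (Ω : Coord n → Fin n → Matrix (Fin n) (Fin n) ℝ)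
    (R : Fin n → Fin n → Fin n → Fin n → ℝ) (E : Fin p → Matrix (Fin n) (Fin n) ℝ)
    (u : Coord n → Fin n → ℝ) (Q : Coord n → Matrix (Fin n) (Fin n) ℝ) : Prop where
  smooth_vec : ContDiffOn ℝ ∞ u U
  smooth_mat : ContDiffOn ℝ ∞ Q U
  mem_holonomy : ∀ y ∈ U, Q y ∈ holonomy E
  pd_vec : ∀ y ∈ U, ∀ μ, pd μ u y + Ω y μ *ᵥ u y = Q y *ᵥ θ y μ
  pd_mat : ∀ y ∈ U, ∀ μ, pd μ Q y + (Ω y μ * Q y - Q y * Ω y μ) = curvOp R (θ y μ) (u y)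

section KillingPair

variable {n p : ℕ} {U : Set (Coord n)} {θ : Coord n → Fin n → Fin n → ℝ}
  {Ω : Coord n → Fin n → Matrix (Fin n) (Fin n) ℝ} {R : Fin n → Fin n → Fin n → Fin n → ℝ}
  {E : Fin p → Matrix (Fin n) (Fin n) ℝ} {β : Matrix (Fin p) (Fin p) ℝ} {y : Coord n}
  {u u' : Coord n → Fin n → ℝ} {Q Q' : Coord n → Matrix (Fin n) (Fin n) ℝ}

/-- The coefficient `(a, b) ↦ (b y, R(y, a))` of the radial equations of a Killing pair. -/
def radialCoeff (R : Fin n → Fin n → Fin n → Fin n → ℝ) :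
    Coord n →ₗ[ℝ] ((Fin n → ℝ) × Matrix (Fin n) (Fin n) ℝ) →ₗ[ℝ]
      ((Fin n → ℝ) × Matrix (Fin n) (Fin n) ℝ) :=
  LinearMap.mk₂ ℝ (fun y x => (x.2 *ᵥ y.ofLp, curvOp R y.ofLp x.1))
    (by intros; simp [Matrix.mulVec_add])
    (by intros; simp [Matrix.mulVec_smul])
    (by intros; simp [Matrix.add_mulVec])
    (by intros; simp [Matrix.smul_mulVec])

theorem radialCoeff_apply (y : Coord n) (a : Fin n → ℝ) (b : Matrix (Fin n) (Fin n) ℝ) :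
    radialCoeff R y (a, b) = (b *ᵥ y.ofLp, curvOp R y.ofLp a) := rfl

/-- A pair which satisfies the equations of a Killing pair along the rays is a Killing pair. -/
theorem IsKillingPair.of_radial (h : SymmetricFrame U θ Ω R) (hE : IsCurvDecomp R E β)
    (hu : ContDiffOn ℝ ∞ u U) (hQ : ContDiffOn ℝ ∞ Q U) (hm : ∀ y ∈ U, Q y ∈ holonomy E)
    (hru : ∀ y ∈ U, euler u y = Q y *ᵥ y.ofLp)
    (hrQ : ∀ y ∈ U, euler Q y = curvOp R y.ofLp (u y)) : IsKillingPair U θ Ω R E u Q := by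
  have hU := h.isOpen
  have key : ∀ μ, ∀ y ∈ U, (pd μ u y + Ω y μ *ᵥ u y - Q y *ᵥ θ y μ,
      pd μ Q y + (Ω y μ * Q y - Q y * Ω y μ) - curvOp R (θ y μ) (u y)) = 0 := by
    intro μ
    have s1 := contDiffOn_pd hu hU μ
    have s2 := contDiffOn_mulVec (h.smooth_conn μ) hu
    have s3 := contDiffOn_mulVec hQ (h.smooth_coframe μ)
    have s4 := contDiffOn_pd hQ hU μ
    have s5 := contDiffOn_mul (h.smooth_conn μ) hQ
    have s6 := contDiffOn_mul hQ (h.smooth_conn μ)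
    have s7 := contDiffOn_bilinear (curvOp R) (h.smooth_coframe μ) hu
    have sa := (s1.add s2).sub s3
    have sb := (s4.add (s5.sub s6)).sub s7
    refine radial_add_eq_zero h.starConvex
      (fun y hy => differentiableAt_of_smooth (sa.prodMk sb) hU hy) (radialCoeff R) ?_
    intro y hy
    have d {V : Type} [NormedAddCommGroup V] [NormedSpace ℝ V] {f : Coord n → V}
      (hf : ContDiffOn ℝ ∞ f U) : DifferentiableAt ℝ f y := differentiableAt_of_smooth hf hU hy
    have du := d hu
    have dQ := d hQ
    have dΩ := h.diff_conn hy μ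
    have dθ := h.diff_coframe hy μ
    have e1 := euler_pd_add_pd hu hU hy μ
    rw [pd_congr hU hy hru, pd_mulVec μ dQ differentiableAt_coord, pd_coord] at e1
    have e4 := euler_pd_add_pd hQ hU hy μ
    rw [pd_congr hU hy hrQ, pd_bilinear (curvOp R) μ differentiableAt_coord du, pd_coord] at e4
    have e2 : euler (fun z => Ω z μ *ᵥ u z) y = _ :=
      euler_bilinear (mulVecBilin (Fin n) ℝ) dΩ du
    have e3 : euler (fun z => Q z *ᵥ θ z μ) y = _ :=
      euler_bilinear (mulVecBilin (Fin n) ℝ) dQ dθ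
    have e5 : euler (fun z => Ω z μ * Q z) y = _ := euler_bilinear (mulBilin (Fin n) ℝ) dΩ dQ
    have e6 : euler (fun z => Q z * Ω z μ) y = _ := euler_bilinear (mulBilin (Fin n) ℝ) dQ dΩ
    have e7 : euler (fun z => curvOp R (θ z μ) (u z)) y = _ := euler_bilinear (curvOp R) dθ du
    simp only [mulBilin, mulVecBilin, LinearMap.mk₂_apply] at e2 e3 e5 e6
    have eΩ := h.euler_conn hy μ
    have eθ := h.euler_coframe hy μ
    rw [← eq_sub_iff_add_eq] at e1 e4 eΩ eθ
    rw [hru y hy, eΩ] at e2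
    rw [hrQ y hy, eθ] at e3
    rw [hrQ y hy, eΩ] at e5 e6
    rw [hru y hy, eθ] at e7
    have b1 := h.bianchi y.ofLp (θ y μ) (u y)
    have a1 := curvOp_antisymm hE (u y) y.ofLp
    have st1 := h.parallel y hy μ y.ofLp (u y)
    have st2 := h.holonomy_le_curvStabilizer hE (hm y hy) y.ofLp (θ y μ)
    have a2 := curvOp_antisymm hE (Q y *ᵥ y.ofLp) (θ y μ)
    rw [euler_prodMk (d sa) (d sb), radialCoeff_apply,
      euler_sub (d (s1.add s2)) (d s3), euler_add (d s1) (d s2),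
      euler_sub (d (s4.add (s5.sub s6))) (d s7), euler_add (d s4) (d (s5.sub s6)),
      euler_sub (d s5) (d s6), e1, e2, e3, e4, e5, e6, e7, Prod.mk_add_mk, Prod.mk.injEq]
    constructor
    · simp only [Matrix.add_mulVec, Matrix.sub_mulVec, Matrix.mulVec_add, Matrix.mulVec_sub,
        ← Matrix.mulVec_mulVec]
      rw [a1, Matrix.neg_mulVec]
      rw [show curvOp R (θ y μ) (u y) *ᵥ y.ofLp = -(curvOp R y.ofLp (θ y μ) *ᵥ u y)
        - curvOp R (u y) y.ofLp *ᵥ θ y μ by linear_combination (norm := abel) b1]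
      abel
    · simp only [map_add, map_sub, LinearMap.add_apply, LinearMap.sub_apply] at *
      rw [a2]
      simp only [mul_sub, sub_mul]
      linear_combination (norm := abel) st1 - st2
  refine ⟨hu, hQ, hm, fun y hy μ => ?_, fun y hy μ => ?_⟩
  · exact sub_eq_zero.1 (Prod.mk.inj (key μ y hy)).1
  · exact sub_eq_zero.1 (Prod.mk.inj (key μ y hy)).2

namespace IsKillingPair

theorem euler_vec (h : SymmetricFrame U θ Ω R) (k : IsKillingPair U θ Ω R E u Q) (hy : y ∈ U) :
    euler u y = Q y *ᵥ y.ofLp := by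
  have h1 : ∑ μ, y μ • (pd μ u y + Ω y μ *ᵥ u y) = ∑ μ, y μ • (Q y *ᵥ θ y μ) :=
    Finset.sum_congr rfl fun μ _ => by rw [k.pd_vec y hy μ]
  have h2 : ∑ μ, y μ • (Ω y μ *ᵥ u y) = 0 := by
    simp only [← Matrix.smul_mulVec, ← Matrix.sum_mulVec, h.radial_conn y hy, Matrix.zero_mulVec]
  have h3 : ∑ μ, y μ • (Q y *ᵥ θ y μ) = Q y *ᵥ y.ofLp := by
    simp only [← Matrix.mulVec_smul, ← Matrix.mulVec_sum, h.radial_coframe y hy]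
  simp only [smul_add, Finset.sum_add_distrib, h2, h3, add_zero] at h1
  rw [euler_eq_sum_pd, h1]

theorem euler_mat (h : SymmetricFrame U θ Ω R) (k : IsKillingPair U θ Ω R E u Q) (hy : y ∈ U) :
    euler Q y = curvOp R y.ofLp (u y) := by
  have h1 : ∑ μ, y μ • (pd μ Q y + (Ω y μ * Q y - Q y * Ω y μ))
      = ∑ μ, y μ • curvOp R (θ y μ) (u y) :=
    Finset.sum_congr rfl fun μ _ => by rw [k.pd_mat y hy μ]
  have h3 : ∑ μ, y μ • curvOp R (θ y μ) (u y) = curvOp R y.ofLp (u y) := by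
    conv_rhs => rw [← h.radial_coframe y hy]
    simp only [map_sum, LinearMap.sum_apply, map_smul, LinearMap.smul_apply]
  have h4 : ∑ μ, y μ • (Ω y μ * Q y) = 0 := by
    simp only [← smul_mul_assoc, ← Finset.sum_mul, h.radial_conn y hy, zero_mul]
  have h5 : ∑ μ, y μ • (Q y * Ω y μ) = 0 := by
    simp only [← mul_smul_comm, ← Finset.mul_sum, h.radial_conn y hy, mul_zero]
  simp only [smul_add, smul_sub, Finset.sum_add_distrib, Finset.sum_sub_distrib, h3, h4, h5,
    sub_zero, add_zero] at h1
  rw [euler_eq_sum_pd, h1]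

/-- A Killing pair is determined by its value at the centre. -/
theorem ext_center (h : SymmetricFrame U θ Ω R) (k : IsKillingPair U θ Ω R E u Q)
    (k' : IsKillingPair U θ Ω R E u' Q') (hu : u 0 = u' 0) (hQ : Q 0 = Q' 0) (hy : y ∈ U) :
    u y = u' y ∧ Q y = Q' y := by
  have hU := h.isOpen
  have su := k.smooth_vec.sub k'.smooth_vec
  have sQ := k.smooth_mat.sub k'.smooth_mat
  have key := radial_eq_zero h.starConvex (Z := fun z => (u z - u' z, Q z - Q' z))
    (fun z hz => differentiableAt_of_smooth (su.prodMk sQ) hU hz) (radialCoeff R) ?_ ?_ y hy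
  · exact ⟨sub_eq_zero.1 (Prod.mk.inj key).1, sub_eq_zero.1 (Prod.mk.inj key).2⟩
  · intro z hz
    rw [euler_prodMk (differentiableAt_of_smooth su hU hz) (differentiableAt_of_smooth sQ hU hz),
      euler_sub (differentiableAt_of_smooth k.smooth_vec hU hz)
        (differentiableAt_of_smooth k'.smooth_vec hU hz),
      euler_sub (differentiableAt_of_smooth k.smooth_mat hU hz)
        (differentiableAt_of_smooth k'.smooth_mat hU hz), k.euler_vec h hz, k'.euler_vec h hz,
      k.euler_mat h hz, k'.euler_mat h hz, radialCoeff_apply, Matrix.sub_mulVec, map_sub]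
  · simp [hu, hQ]

theorem sum {α : Type*} [Fintype α] (hU : IsOpen U) {u : α → Coord n → Fin n → ℝ}
    {Q : α → Coord n → Matrix (Fin n) (Fin n) ℝ}
    (k : ∀ A, IsKillingPair U θ Ω R E (u A) (Q A)) (c : α → ℝ) :
    IsKillingPair U θ Ω R E (fun y => ∑ A, c A • u A y) (fun y => ∑ A, c A • Q A y) where
  smooth_vec := ContDiffOn.sum fun A _ => (k A).smooth_vec.const_smul _
  smooth_mat := ContDiffOn.sum fun A _ => (k A).smooth_mat.const_smul _
  mem_holonomy y hy := Submodule.sum_mem _ fun A _ =>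
    Submodule.smul_mem _ _ ((k A).mem_holonomy y hy)
  pd_vec y hy μ := by
    rw [pd_sum (f := fun A z => c A • u A z) _ _ fun A _ =>
      differentiableAt_of_smooth ((k A).smooth_vec.const_smul _) hU hy]
    have h1 : ∀ A, pd μ (fun z => c A • u A z) y = c A • pd μ (u A) y := fun A =>
      pd_linear (LinearMap.lsmul ℝ _ (c A)) μ
        (differentiableAt_of_smooth (k A).smooth_vec hU hy)
    simp only [h1, Matrix.mulVec_sum, Matrix.sum_mulVec, Matrix.mulVec_smul, Matrix.smul_mulVec,
      ← Finset.sum_add_distrib, ← smul_add, (k _).pd_vec y hy μ]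
  pd_mat y hy μ := by
    rw [pd_sum (f := fun A z => c A • Q A z) _ _ fun A _ =>
      differentiableAt_of_smooth ((k A).smooth_mat.const_smul _) hU hy]
    have h1 : ∀ A, pd μ (fun z => c A • Q A z) y = c A • pd μ (Q A) y := fun A =>
      pd_linear (LinearMap.lsmul ℝ _ (c A)) μ
        (differentiableAt_of_smooth (k A).smooth_mat hU hy)
    simp only [h1, Finset.mul_sum, Finset.sum_mul, mul_smul_comm, smul_mul_assoc,
      ← Finset.sum_sub_distrib, ← Finset.sum_add_distrib, ← smul_add, ← smul_sub,
      (k _).pd_mat y hy μ, map_sum, map_smul]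

/-- The Lie bracket of two Killing pairs. -/
theorem bracket (h : SymmetricFrame U θ Ω R) (hE : IsCurvDecomp R E β)
    (k : IsKillingPair U θ Ω R E u Q) (k' : IsKillingPair U θ Ω R E u' Q') :
    IsKillingPair U θ Ω R E (fun y => Q' y *ᵥ u y - Q y *ᵥ u' y)
      (fun y => curvOp R (u y) (u' y) - (Q y * Q' y - Q' y * Q y)) := by
  have hU := h.isOpen
  have s1 := contDiffOn_mulVec k'.smooth_mat k.smooth_vec
  have s2 := contDiffOn_mulVec k.smooth_mat k'.smooth_vec
  have s3 := contDiffOn_bilinear (curvOp R) k.smooth_vec k'.smooth_vec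
  have s4 := contDiffOn_mul k.smooth_mat k'.smooth_mat
  have s5 := contDiffOn_mul k'.smooth_mat k.smooth_mat
  refine of_radial h hE (s1.sub s2) (s3.sub (s4.sub s5)) ?_ ?_ ?_
  · intro y hy
    exact Submodule.sub_mem _ (curvOp_mem_holonomy hE _ _)
      (h.holonomy_commutator hE (k.mem_holonomy y hy) (k'.mem_holonomy y hy))
  all_goals
    intro y hy
    have d {V : Type} [NormedAddCommGroup V] [NormedSpace ℝ V] {f : Coord n → V}
      (hf : ContDiffOn ℝ ∞ f U) : DifferentiableAt ℝ f y := differentiableAt_of_smooth hf hU hy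
    have du := d k.smooth_vec
    have dQ := d k.smooth_mat
    have du' := d k'.smooth_vec
    have dQ' := d k'.smooth_mat
    have st := h.holonomy_le_curvStabilizer hE (k.mem_holonomy y hy) y.ofLp (u' y)
    have st' := h.holonomy_le_curvStabilizer hE (k'.mem_holonomy y hy) y.ofLp (u y)
  · have e1 : euler (fun z => Q' z *ᵥ u z) y = _ :=
      euler_bilinear (mulVecBilin (Fin n) ℝ) dQ' du
    have e2 : euler (fun z => Q z *ᵥ u' z) y = _ :=
      euler_bilinear (mulVecBilin (Fin n) ℝ) dQ du'
    simp only [mulVecBilin, LinearMap.mk₂_apply] at e1 e2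
    rw [euler_sub (d s1) (d s2), e1, e2, k.euler_vec h hy, k'.euler_vec h hy, k.euler_mat h hy,
      k'.euler_mat h hy]
    have b := h.bianchi y.ofLp (u y) (u' y)
    have a1 := curvOp_antisymm hE y.ofLp (u' y)
    simp only [Matrix.sub_mulVec, ← Matrix.mulVec_mulVec]
    rw [a1, Matrix.neg_mulVec] at b
    linear_combination (norm := abel) -b
  · have e3 : euler (fun z => curvOp R (u z) (u' z)) y = _ := euler_bilinear (curvOp R) du du'
    have e4 : euler (fun z => Q z * Q' z) y = _ := euler_bilinear (mulBilin (Fin n) ℝ) dQ dQ'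
    have e5 : euler (fun z => Q' z * Q z) y = _ := euler_bilinear (mulBilin (Fin n) ℝ) dQ' dQ
    simp only [mulBilin, LinearMap.mk₂_apply] at e4 e5
    rw [euler_sub (d s3) (d (s4.sub s5)), euler_sub (d s4) (d s5), e3, e4, e5,
      k.euler_vec h hy, k'.euler_vec h hy, k.euler_mat h hy, k'.euler_mat h hy]
    have a1 := curvOp_antisymm hE (Q' y *ᵥ y.ofLp) (u y)
    simp only [map_sub]
    rw [a1]
    linear_combination (norm := abel) st' - st

/-- The infinitesimal transvections. -/
theorem transvection (h : SymmetricFrame U θ Ω R) (hE : IsCurvDecomp R E β) (a : Fin n) :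
    IsKillingPair U θ Ω R E (fun y => Pi.single a 1 + Ω y a *ᵥ y.ofLp)
      (fun y => curvOp R y.ofLp (θ y a)) := by
  have hU := h.isOpen
  have s1 := contDiffOn_mulVec (h.smooth_conn a) (contDiffOn_coord (U := U))
  refine of_radial h hE (contDiffOn_const.add s1)
    (contDiffOn_bilinear (curvOp R) contDiffOn_coord (h.smooth_coframe a))
    (fun y _ => curvOp_mem_holonomy hE _ _) (fun y hy => ?_) (fun y hy => ?_)
  · have e1 : euler (fun z => Ω z a *ᵥ z.ofLp) y = _ :=
      euler_bilinear (mulVecBilin (Fin n) ℝ) (h.diff_conn hy a) differentiableAt_coord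
    simp only [mulVecBilin, LinearMap.mk₂_apply] at e1
    rw [euler_add (differentiableAt_const _) (differentiableAt_of_smooth s1 hU hy), euler_const,
      e1, euler_coord, zero_add, ← Matrix.add_mulVec, h.euler_conn hy]
  · rw [euler_bilinear (curvOp R) differentiableAt_coord (h.diff_coframe hy a), euler_coord,
      ← map_add, add_comm, h.euler_coframe hy]

/-- The infinitesimal rotations about the centre. -/
theorem rotation (h : SymmetricFrame U θ Ω R) (hE : IsCurvDecomp R E β)
    {D : Matrix (Fin n) (Fin n) ℝ} (hD : D ∈ holonomy E) :
    IsKillingPair U θ Ω R E (fun y => -∑ μ, (D *ᵥ y.ofLp) μ • θ y μ)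
      (fun y => -D - ∑ μ, (D *ᵥ y.ofLp) μ • Ω y μ) := by
  have hU := h.isOpen
  have sl : ∀ μ, ContDiffOn ℝ ∞ (fun z : Coord n => (D *ᵥ z.ofLp) μ) U := fun μ =>
    contDiffOn_linear ((LinearMap.proj μ).comp (Matrix.mulVecLin D)) contDiffOn_coord
  have dl : ∀ μ (y : Coord n), DifferentiableAt ℝ (fun z : Coord n => (D *ᵥ z.ofLp) μ) y :=
    fun μ y => differentiableAt_of_smooth
      (contDiffOn_linear ((LinearMap.proj μ).comp (Matrix.mulVecLin D)) contDiffOn_coord)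
      isOpen_univ (Set.mem_univ y)
  have el : ∀ μ (y : Coord n), euler (fun z : Coord n => (D *ᵥ z.ofLp) μ) y = (D *ᵥ y.ofLp) μ := by
    intro μ y
    have := euler_linear (y := y) ((LinearMap.proj μ).comp (Matrix.mulVecLin D))
      differentiableAt_coord
    rw [euler_coord] at this
    exact this
  have s1 : ∀ μ, ContDiffOn ℝ ∞ (fun z => (D *ᵥ z.ofLp) μ • θ z μ) U := fun μ =>
    (sl μ).smul (h.smooth_coframe μ)
  have s2 : ∀ μ, ContDiffOn ℝ ∞ (fun z => (D *ᵥ z.ofLp) μ • Ω z μ) U := fun μ =>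
    (sl μ).smul (h.smooth_conn μ)
  refine of_radial h hE (ContDiffOn.sum fun μ _ => s1 μ).neg
    (contDiffOn_const.sub (ContDiffOn.sum fun μ _ => s2 μ)) ?_ ?_ ?_
  · intro y hy
    exact Submodule.sub_mem _ (Submodule.neg_mem _ hD) (Submodule.sum_mem _ fun μ _ =>
      Submodule.smul_mem _ _ (h.conn_mem_holonomy hE hy μ))
  · intro y hy
    have e : ∀ μ, euler (fun z => (D *ᵥ z.ofLp) μ • θ z μ) y
        = (D *ᵥ y.ofLp) μ • (Pi.single μ 1 + Ω y μ *ᵥ y.ofLp) := by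
      intro μ
      have := euler_bilinear (LinearMap.lsmul ℝ (Fin n → ℝ)) (dl μ y) (h.diff_coframe hy μ)
      rw [el] at this
      rw [← h.euler_coframe hy, smul_add, add_comm]
      exact this
    rw [euler_neg, euler_sum (f := fun μ z => (D *ᵥ z.ofLp) μ • θ z μ) _
      fun μ _ => differentiableAt_of_smooth (s1 μ) hU hy]
    simp only [e, smul_add, Finset.sum_add_distrib, Matrix.sub_mulVec, Matrix.neg_mulVec,
      Matrix.sum_mulVec, Matrix.smul_mulVec, ← pi_eq_sum_univ']
    abel
  · intro y hy
    have e : ∀ μ, euler (fun z => (D *ᵥ z.ofLp) μ • Ω z μ) y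
        = (D *ᵥ y.ofLp) μ • curvOp R y.ofLp (θ y μ) := by
      intro μ
      have := euler_bilinear (LinearMap.lsmul ℝ (Matrix (Fin n) (Fin n) ℝ)) (dl μ y)
        (h.diff_conn hy μ)
      rw [el] at this
      rw [← h.euler_conn hy, smul_add, add_comm]
      exact this
    rw [euler_sub (differentiableAt_const _)
      (differentiableAt_of_smooth (ContDiffOn.sum fun μ _ => s2 μ) hU hy), euler_const,
      euler_sum (f := fun μ z => (D *ᵥ z.ofLp) μ • Ω z μ) _
      fun μ _ => differentiableAt_of_smooth (s2 μ) hU hy]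
    simp only [e, map_neg, map_sum, map_smul, zero_sub]

end IsKillingPair

end KillingPair

/-! ### The curvature algebra of the Killing fields -/

section StructureConstants

variable {n p : ℕ} {U : Set (Coord n)} {θ : Coord n → Fin n → Fin n → ℝ}
  {Ω : Coord n → Fin n → Matrix (Fin n) (Fin n) ℝ} {R : Fin n → Fin n → Fin n → Fin n → ℝ}
  {E : Fin p → Matrix (Fin n) (Fin n) ℝ} {β : Matrix (Fin p) (Fin p) ℝ}
  {F : Fin p → Fin p → Fin p → ℝ}

theorem sum_smul_holonomyGen (c : Fin p → ℝ) :
    ∑ i, c i • holonomyGen E β i = -∑ k, (c ᵥ* β) k • E k := by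
  simp only [holonomyGen, smul_neg, Finset.sum_neg_distrib, Finset.smul_sum, smul_smul,
    Matrix.vecMul, dotProduct, Finset.sum_smul]
  rw [Finset.sum_comm]

theorem linearIndependent_holonomyGen (hE : IsCurvDecomp R E β) :
    LinearIndependent ℝ (holonomyGen E β) := by
  rw [Fintype.linearIndependent_iff]
  intro c hc
  rw [sum_smul_holonomyGen, neg_eq_zero] at hc
  have h1 : c ᵥ* β = 0 := funext (Fintype.linearIndependent_iff.1 hE.linearIndependent _ hc)
  have h2 := congrArg (fun w => w ᵥ* β⁻¹) h1
  simp only [Matrix.vecMul_vecMul, Matrix.mul_nonsing_inv β hE.nondegenerate, Matrix.vecMul_one,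
    Matrix.zero_vecMul] at h2
  exact congrFun h2

theorem exists_eq_sum_holonomyGen (hE : IsCurvDecomp R E β) {Q : Matrix (Fin n) (Fin n) ℝ}
    (hQ : Q ∈ holonomy E) : ∃ c : Fin p → ℝ, Q = ∑ j, c j • holonomyGen E β j := by
  have hle : holonomy E ≤ Submodule.span ℝ (Set.range (holonomyGen E β)) := by
    refine holonomy_le hE fun u v => ?_
    rw [curvOp_eq_neg_sum hE]
    exact Submodule.neg_mem _ (Submodule.sum_mem _ fun k _ => Submodule.smul_mem _ _
      (Submodule.subset_span ⟨k, rfl⟩))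
  obtain ⟨c, hc⟩ := (Submodule.mem_span_range_iff_exists_fun ℝ).1 (hle hQ)
  exact ⟨c, hc.symm⟩

theorem SymmetricFrame.exists_structConst (h : SymmetricFrame U θ Ω R)
    (hE : IsCurvDecomp R E β) : ∃ F : Fin p → Fin p → Fin p → ℝ,
      ∀ i k, holonomyGen E β i * holonomyGen E β k - holonomyGen E β k * holonomyGen E β i =
        ∑ j, F j i k • holonomyGen E β j := by
  have hex := fun i k => exists_eq_sum_holonomyGen hE (h.holonomy_commutator hE
    (holonomyGen_mem_holonomy (E := E) (β := β) i) (holonomyGen_mem_holonomy (E := E) (β := β) k))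
  choose c hc using hex
  exact ⟨fun j i k => c i k j, hc⟩

/-- The adjoint action of the holonomy generators on the matrices `E^j`. -/
theorem SymmetricFrame.sum_structConst_smul (h : SymmetricFrame U θ Ω R)
    (hE : IsCurvDecomp R E β)
    (hF : ∀ i k, holonomyGen E β i * holonomyGen E β k - holonomyGen E β k * holonomyGen E β i =
      ∑ j, F j i k • holonomyGen E β j) (i j : Fin p) :
    ∑ k, F j i k • E k = E j * holonomyGen E β i - holonomyGen E β i * E j := by
  rw [← sub_eq_zero]
  apply eq_zero_of_dotProduct
  intro u v
  have hDi := holonomyGen_mem_holonomy (E := E) (β := β) i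
  have h1 := h.holonomy_le_curvStabilizer hE hDi u v
  have hT := transpose_of_mem_holonomy hE hDi
  simp only [curvOp_eq_neg_sum hE] at h1
  have h2 : ∑ j, (∑ k, F j i k * (u ⬝ᵥ E k *ᵥ v) - ((holonomyGen E β i *ᵥ u) ⬝ᵥ E j *ᵥ v
      + u ⬝ᵥ E j *ᵥ (holonomyGen E β i *ᵥ v))) • holonomyGen E β j = 0 := by
    simp only [sub_smul, add_smul, Finset.sum_sub_distrib, Finset.sum_add_distrib, Finset.sum_smul]
    have h3 : ∑ j, ∑ k, (F j i k * (u ⬝ᵥ E k *ᵥ v)) • holonomyGen E β j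
        = ∑ k, (u ⬝ᵥ E k *ᵥ v) • (holonomyGen E β i * holonomyGen E β k
          - holonomyGen E β k * holonomyGen E β i) := by
      rw [Finset.sum_comm]
      refine Finset.sum_congr rfl fun k _ => ?_
      rw [hF, Finset.smul_sum]
      exact Finset.sum_congr rfl fun j _ => by rw [smul_smul, mul_comm]
    rw [h3]
    simp only [smul_sub, Finset.sum_sub_distrib]
    simp only [mul_neg, neg_mul, Finset.mul_sum, Finset.sum_mul, mul_smul_comm,
      smul_mul_assoc] at h1
    linear_combination (norm := abel) -h1
  have h4 := Fintype.linearIndependent_iff.1 (linearIndependent_holonomyGen hE) _ h2 j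
  have h5 : (holonomyGen E β i *ᵥ u) ⬝ᵥ E j *ᵥ v = -(u ⬝ᵥ holonomyGen E β i *ᵥ (E j *ᵥ v)) := by
    rw [dotProduct_comm, dotProduct_mulVec_antisymm hT]
  rw [h5] at h4
  simp only [Matrix.sub_mulVec, Matrix.sum_mulVec, Matrix.smul_mulVec, dotProduct_sub,
    dotProduct_sum, dotProduct_smul, smul_eq_mul, ← Matrix.mulVec_mulVec]
  linear_combination h4

theorem SymmetricFrame.structConst_antisymm (h : SymmetricFrame U θ Ω R)
    (hE : IsCurvDecomp R E β)
    (hF : ∀ i k, holonomyGen E β i * holonomyGen E β k - holonomyGen E β k * holonomyGen E β i =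
      ∑ j, F j i k • holonomyGen E β j) (i k l : Fin p) :
    ∑ j, β l j * F j i k + ∑ j, F j i l * β j k = 0 := by
  have h1 : ∑ k, (∑ j, β l j * F j i k + ∑ j, F j i l * β j k) • E k = 0 := by
    have h2 : ∑ k, (∑ j, F j i l * β j k) • E k
        = -(holonomyGen E β i * holonomyGen E β l - holonomyGen E β l * holonomyGen E β i) := by
      rw [hF, sum_smul_holonomyGen, neg_neg]
      rfl
    have h3 : ∑ k, (∑ j, β l j * F j i k) • E k
        = ∑ j, β l j • (E j * holonomyGen E β i - holonomyGen E β i * E j) := by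
      simp only [← h.sum_structConst_smul hE hF, Finset.smul_sum, Finset.sum_smul, smul_smul]
      rw [Finset.sum_comm]
    have h4 : ∑ j, β l j • E j = -holonomyGen E β l := by simp [holonomyGen]
    simp only [add_smul, Finset.sum_add_distrib]
    rw [h2, h3]
    have h5 : ∑ j, β l j • (E j * holonomyGen E β i - holonomyGen E β i * E j)
        = (∑ j, β l j • E j) * holonomyGen E β i - holonomyGen E β i * ∑ j, β l j • E j := by
      simp only [smul_sub, Finset.sum_sub_distrib, Finset.sum_mul, Finset.mul_sum, smul_mul_assoc,
        mul_smul_comm]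
    rw [h5, h4]
    noncomm_ring
  exact Fintype.linearIndependent_iff.1 hE.linearIndependent _ h1 k

theorem holonomyGen_antisymm (hE : IsCurvDecomp R E β) (i : Fin p) (a b : Fin n) :
    holonomyGen E β i b a = -holonomyGen E β i a b :=
  congrFun (congrFun (transpose_of_mem_holonomy hE (holonomyGen_mem_holonomy (β := β) i)) a) b

theorem isUnit_det_gammaMat (hE : IsCurvDecomp R E β) : IsUnit (gammaMat n β).det := by
  rw [gammaMat, Matrix.det_fromBlocks_zero₂₁, Matrix.det_one, one_mul]
  exact hE.nondegenerate

/-- The matrix `γ` is invariant under the adjoint action of the curvature algebra. -/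
theorem SymmetricFrame.gammaMat_invariant (h : SymmetricFrame U θ Ω R)
    (hE : IsCurvDecomp R E β)
    (hF : ∀ i k, holonomyGen E β i * holonomyGen E β k - holonomyGen E β k * holonomyGen E β i =
      ∑ j, F j i k • holonomyGen E β j) (A : Fin n ⊕ Fin p) :
    gammaMat n β * Matrix.of (fun D B => structConst E β F D A B)
      + (Matrix.of fun D B => structConst E β F D A B)ᵀ * gammaMat n β = 0 := by
  have hD : ∀ i a b, holonomyGen E β i a b = -∑ k, β i k * E k a b := by
    intro i a b
    simp [holonomyGen, Matrix.sum_apply]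
  have hA : ∀ i a b, E i b a = -E i a b := fun i a b =>
    congrFun (congrFun (hE.antisymm i) a) b
  ext D B
  rw [Matrix.add_apply, Matrix.mul_apply, Matrix.mul_apply, Fintype.sum_sum_type,
    Fintype.sum_sum_type]
  rcases A with a | i <;> rcases D with d | j <;> rcases B with b | k <;>
    simp only [gammaMat, Matrix.fromBlocks_apply₁₁, Matrix.fromBlocks_apply₁₂,
      Matrix.fromBlocks_apply₂₁, Matrix.fromBlocks_apply₂₂, Matrix.of_apply,
      Matrix.transpose_apply, structConst, Matrix.zero_apply, Matrix.one_apply, zero_mul, mul_zero,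
      Finset.sum_const_zero, add_zero, zero_add, ite_mul, mul_ite, one_mul, mul_one,
      Finset.sum_ite_eq, Finset.sum_ite_eq', Finset.mem_univ, if_true]
  · rw [hD, neg_neg, ← Finset.sum_add_distrib]
    refine Finset.sum_eq_zero fun l _ => ?_
    rw [hE.symm.apply, hA l a d]
    ring
  · rw [hD, neg_neg, ← Finset.sum_add_distrib]
    refine Finset.sum_eq_zero fun l _ => ?_
    rw [hA l a b]
    ring
  · rw [holonomyGen_antisymm hE i d b]
    ring
  · exact h.structConst_antisymm hE hF i k j

theorem SymmetricFrame.gammaMat_inv_invariant (h : SymmetricFrame U θ Ω R)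
    (hE : IsCurvDecomp R E β)
    (hF : ∀ i k, holonomyGen E β i * holonomyGen E β k - holonomyGen E β k * holonomyGen E β i =
      ∑ j, F j i k • holonomyGen E β j) (A B D : Fin n ⊕ Fin p) :
    ∑ C, structConst E β F B A C * (gammaMat n β)⁻¹ C D
      + ∑ C, (gammaMat n β)⁻¹ B C * structConst E β F D A C = 0 := by
  have hu := isUnit_det_gammaMat (n := n) hE
  set M : Matrix (Fin n ⊕ Fin p) (Fin n ⊕ Fin p) ℝ :=
    Matrix.of (fun D B => structConst E β F D A B) with hM
  have h1 := h.gammaMat_invariant hE hF A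
  have h2 : M * (gammaMat n β)⁻¹ + (gammaMat n β)⁻¹ * Mᵀ = 0 := by
    have h3 := congrArg (fun N => (gammaMat n β)⁻¹ * N * (gammaMat n β)⁻¹) h1
    simp only [mul_add, add_mul, mul_zero, zero_mul] at h3
    rw [← hM, ← mul_assoc (gammaMat n β)⁻¹ (gammaMat n β), Matrix.nonsing_inv_mul _ hu, one_mul,
      mul_assoc (gammaMat n β)⁻¹ _ (gammaMat n β)⁻¹, mul_assoc _ (gammaMat n β) (gammaMat n β)⁻¹,
      Matrix.mul_nonsing_inv _ hu, mul_one] at h3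
    exact h3
  exact congrFun (congrFun h2 B) D

/-- The frame components of the Killing fields `ξ_A`. -/
def killVec (θ : Coord n → Fin n → Fin n → ℝ) (Ω : Coord n → Fin n → Matrix (Fin n) (Fin n) ℝ)
    (E : Fin p → Matrix (Fin n) (Fin n) ℝ) (β : Matrix (Fin p) (Fin p) ℝ) :
    Fin n ⊕ Fin p → Coord n → Fin n → ℝ
  | .inl a, y => Pi.single a 1 + Ω y a *ᵥ y.ofLp
  | .inr i, y => -∑ μ, (holonomyGen E β i *ᵥ y.ofLp) μ • θ y μ

/-- The covariant derivatives of the Killing fields `ξ_A`. -/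
def killMat (R : Fin n → Fin n → Fin n → Fin n → ℝ) (θ : Coord n → Fin n → Fin n → ℝ)
    (Ω : Coord n → Fin n → Matrix (Fin n) (Fin n) ℝ)
    (E : Fin p → Matrix (Fin n) (Fin n) ℝ) (β : Matrix (Fin p) (Fin p) ℝ) :
    Fin n ⊕ Fin p → Coord n → Matrix (Fin n) (Fin n) ℝ
  | .inl a, y => curvOp R y.ofLp (θ y a)
  | .inr i, y => -holonomyGen E β i - ∑ μ, (holonomyGen E β i *ᵥ y.ofLp) μ • Ω y μ

theorem SymmetricFrame.isKillingPair (h : SymmetricFrame U θ Ω R) (hE : IsCurvDecomp R E β)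
    (A : Fin n ⊕ Fin p) :
    IsKillingPair U θ Ω R E (killVec θ Ω E β A) (killMat R θ Ω E β A) := by
  rcases A with a | i
  · exact IsKillingPair.transvection h hE a
  · exact IsKillingPair.rotation h hE (holonomyGen_mem_holonomy i)

/-- The Killing fields span the curvature algebra. -/
theorem SymmetricFrame.killing_bracket (h : SymmetricFrame U θ Ω R) (hE : IsCurvDecomp R E β)
    (hF : ∀ i k, holonomyGen E β i * holonomyGen E β k - holonomyGen E β k * holonomyGen E β i =
      ∑ j, F j i k • holonomyGen E β j) (A B : Fin n ⊕ Fin p) {y : Coord n} (hy : y ∈ U) :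
    killMat R θ Ω E β B y *ᵥ killVec θ Ω E β A y - killMat R θ Ω E β A y *ᵥ killVec θ Ω E β B y
        = ∑ C, structConst E β F C A B • killVec θ Ω E β C y ∧
      curvOp R (killVec θ Ω E β A y) (killVec θ Ω E β B y)
          - (killMat R θ Ω E β A y * killMat R θ Ω E β B y
            - killMat R θ Ω E β B y * killMat R θ Ω E β A y)
        = ∑ C, structConst E β F C A B • killMat R θ Ω E β C y := by
  have hP0 : ∀ a : Fin n, killVec θ Ω E β (.inl a) 0 = Pi.single a 1 := by
    intro a
    simp [killVec]
  have hL0 : ∀ i, killVec θ Ω E β (.inr i) 0 = 0 := by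
    intro i
    simp [killVec]
  have hPM0 : ∀ a : Fin n, killMat R θ Ω E β (.inl a) 0 = 0 := by
    intro a
    simp [killMat]
  have hLM0 : ∀ i, killMat R θ Ω E β (.inr i) 0 = -holonomyGen E β i := by
    intro i
    simp [killMat]
  have hcol : ∀ (M : Matrix (Fin n) (Fin n) ℝ) (b : Fin n),
      M *ᵥ Pi.single b 1 = ∑ a, M a b • (Pi.single a 1 : Fin n → ℝ) := by
    intro M b
    ext a
    simp [Pi.single_apply]
  refine IsKillingPair.ext_center h ((h.isKillingPair hE A).bracket h hE (h.isKillingPair hE B))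
    (IsKillingPair.sum h.isOpen (fun C => h.isKillingPair hE C)
      (fun C => structConst E β F C A B)) ?_ ?_ hy
  · simp only [Fintype.sum_sum_type, hP0, hL0]
    rcases A with a | i <;> rcases B with b | k <;>
      simp only [hP0, hL0, hPM0, hLM0, structConst, Matrix.zero_apply, Matrix.neg_apply,
        Matrix.mulVec_zero, zero_smul, smul_zero, Finset.sum_const_zero, hcol, neg_smul,
        Finset.sum_neg_distrib, sub_zero, add_zero, zero_sub, neg_neg]
  · simp only [Fintype.sum_sum_type, hPM0, hLM0]
    rcases A with a | i <;> rcases B with b | k <;>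
      simp only [hP0, hL0, hPM0, hLM0, structConst, zero_smul, smul_zero, Finset.sum_const_zero,
        map_zero, LinearMap.zero_apply, mul_zero, zero_mul, sub_zero, zero_add, neg_zero,
        smul_neg, Finset.sum_neg_distrib, zero_sub, neg_mul_neg]
    · rw [curvOp_eq_neg_sum hE]
      simp
    · rw [hF]

end StructureConstants

/-! ### The radially parallel frame of a locally symmetric metric -/

section Frame

variable {n p : ℕ} {U : Set (Coord n)} {g e : Coord n → Matrix (Fin n) (Fin n) ℝ} {y : Coord n}

/-- The dual coframe: the vector `coframe e y μ` has the components `e^a_μ(y)`. -/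
def coframe (e : Coord n → Matrix (Fin n) (Fin n) ℝ) (y : Coord n) (μ a : Fin n) : ℝ :=
  (e y)⁻¹ a μ

theorem mulVec_coframe (M : Matrix (Fin n) (Fin n) ℝ) (μ a : Fin n) :
    (M *ᵥ coframe e y μ) a = (M * (e y)⁻¹) a μ := rfl

theorem sum_smul_coframe (v : Fin n → ℝ) : ∑ μ, v μ • coframe e y μ = (e y)⁻¹ *ᵥ v := by
  ext a
  simp [coframe, Matrix.mulVec, dotProduct, mul_comm]

namespace IsRadialFrame

theorem inv_mul (he : IsRadialFrame g e U) (hy : y ∈ U) : (e y)⁻¹ * e y = 1 := by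
  rw [Matrix.inv_eq_left_inv (he.orthonormal y hy), he.orthonormal y hy]

theorem mul_inv (he : IsRadialFrame g e U) (hy : y ∈ U) : e y * (e y)⁻¹ = 1 :=
  mul_eq_one_comm.1 (he.inv_mul hy)

theorem metric_eq (he : IsRadialFrame g e U) (hy : y ∈ U) :
    g y = ((e y)⁻¹)ᵀ * (e y)⁻¹ := by
  have h1 := congrArg (fun M => ((e y)⁻¹)ᵀ * M * (e y)⁻¹) (he.orthonormal y hy)
  simp only [mul_one] at h1
  rw [← h1, ← mul_assoc, ← mul_assoc, ← Matrix.transpose_mul, he.mul_inv hy,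
    Matrix.transpose_one, one_mul, mul_assoc, he.mul_inv hy, mul_one]

theorem metric_inv_eq (he : IsRadialFrame g e U) (hy : y ∈ U) : (g y)⁻¹ = e y * (e y)ᵀ := by
  apply Matrix.inv_eq_left_inv
  rw [he.metric_eq hy, mul_assoc, ← mul_assoc (e y)ᵀ, ← Matrix.transpose_mul, he.inv_mul hy,
    Matrix.transpose_one, one_mul, he.mul_inv hy]

theorem metric_mul_inv (he : IsRadialFrame g e U) (hy : y ∈ U) : g y * (g y)⁻¹ = 1 := by
  rw [he.metric_inv_eq hy, he.metric_eq hy, mul_assoc, ← mul_assoc (e y)⁻¹, he.inv_mul hy, one_mul,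
    ← Matrix.transpose_mul, he.mul_inv hy, Matrix.transpose_one]

theorem metric_symm (he : IsRadialFrame g e U) (hy : y ∈ U) (μ ν : Fin n) :
    g y μ ν = g y ν μ := by
  have h : (g y)ᵀ = g y := by
    rw [he.metric_eq hy, Matrix.transpose_mul, Matrix.transpose_transpose]
  exact congrFun (congrFun h ν) μ

theorem smooth_frame (he : IsRadialFrame g e U) : ContDiffOn ℝ ∞ e U :=
  contDiffOn_matrix he.smooth

theorem smooth_inv (he : IsRadialFrame g e U) : ContDiffOn ℝ ∞ (fun y => (e y)⁻¹) U := by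
  have : CompleteSpace (Matrix (Fin n) (Fin n) ℝ) := FiniteDimensional.complete ℝ _
  intro y hy
  simp only [Matrix.nonsing_inv_eq_ringInverse]
  let u : (Matrix (Fin n) (Fin n) ℝ)ˣ := ⟨e y, (e y)⁻¹, he.mul_inv hy, he.inv_mul hy⟩
  have h : ContDiffAt ℝ ∞ Ring.inverse (e y) := contDiffAt_ringInverse ℝ u
  exact h.comp_contDiffWithinAt y (he.smooth_frame y hy)

theorem smooth_metric (he : IsRadialFrame g e U) : ContDiffOn ℝ ∞ g U := by
  have hT : ContDiffOn ℝ ∞ (fun y => ((e y)⁻¹)ᵀ) U :=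
    contDiffOn_linear (Matrix.transposeLinearEquiv (Fin n) (Fin n) ℝ ℝ).toLinearMap he.smooth_inv
  exact (contDiffOn_mul hT he.smooth_inv).congr fun y hy => he.metric_eq hy

theorem smooth_metric_inv (he : IsRadialFrame g e U) : ContDiffOn ℝ ∞ (fun y => (g y)⁻¹) U := by
  have hT : ContDiffOn ℝ ∞ (fun y => (e y)ᵀ) U :=
    contDiffOn_linear (Matrix.transposeLinearEquiv (Fin n) (Fin n) ℝ ℝ).toLinearMap
      he.smooth_frame
  exact (contDiffOn_mul he.smooth_frame hT).congr fun y hy => he.metric_inv_eq hy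

theorem smooth_christoffel (he : IsRadialFrame g e U) (hU : IsOpen U) (ν μ ρ : Fin n) :
    ContDiffOn ℝ ∞ (fun y => christoffel g y ν μ ρ) U := by
  have hp : ∀ α a b, ContDiffOn ℝ ∞ (fun y => pd α (fun z => g z a b) y) U := fun α a b =>
    contDiffOn_pd (contDiffOn_entry he.smooth_metric a b) hU α
  exact contDiffOn_const.mul (ContDiffOn.sum fun τ _ =>
    (contDiffOn_entry he.smooth_metric_inv ν τ).mul (((hp _ _ _).add (hp _ _ _)).sub (hp _ _ _)))

theorem christoffel_symm (he : IsRadialFrame g e U) (hU : IsOpen U) (hy : y ∈ U) (ν μ ρ : Fin n) :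
    christoffel g y ν μ ρ = christoffel g y ν ρ μ := by
  simp only [christoffel]
  congr 1
  refine Finset.sum_congr rfl fun τ _ => ?_
  rw [pd_congr hU hy (f := fun z => g z μ ρ) (fun z hz => he.metric_symm hz μ ρ) τ]
  ring

/-- The matrix `(Γ_μ)^ν_ρ`. -/
def chrMat (g : Coord n → Matrix (Fin n) (Fin n) ℝ) (y : Coord n) (μ : Fin n) :
    Matrix (Fin n) (Fin n) ℝ :=
  Matrix.of fun ν ρ => christoffel g y ν μ ρ

theorem metric_mul_chrMat (he : IsRadialFrame g e U) (hy : y ∈ U)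
    (τ μ ρ : Fin n) : (g y * chrMat g y μ) τ ρ = 1 / 2 *
      (pd μ (fun z => g z τ ρ) y + pd ρ (fun z => g z τ μ) y - pd τ (fun z => g z μ ρ) y) := by
  have h1 : chrMat g y μ = (g y)⁻¹ * Matrix.of fun τ ρ => 1 / 2 *
      (pd μ (fun z => g z τ ρ) y + pd ρ (fun z => g z τ μ) y - pd τ (fun z => g z μ ρ) y) := by
    ext ν ρ
    simp only [chrMat, christoffel, Matrix.of_apply, Matrix.mul_apply, Finset.mul_sum]
    exact Finset.sum_congr rfl fun τ _ => by ring
  rw [h1, ← mul_assoc, he.metric_mul_inv hy, one_mul]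
  rfl

theorem spinConn_eq (he : IsRadialFrame g e U) (hU : IsOpen U) (hy : y ∈ U) (μ : Fin n) :
    spinConn g e y μ = (e y)⁻¹ * (pd μ e y + chrMat g y μ * e y) := by
  have hd := differentiableAt_of_smooth he.smooth_frame hU hy
  ext a b
  simp only [spinConn, frameDeriv, Matrix.of_apply, Matrix.mul_apply, Matrix.add_apply, chrMat,
    pd_matrix_apply μ hd]

theorem smooth_spinConn (he : IsRadialFrame g e U) (hU : IsOpen U) (μ : Fin n) :
    ContDiffOn ℝ ∞ (fun y => spinConn g e y μ) U := by
  have hΓ : ContDiffOn ℝ ∞ (fun y => chrMat g y μ) U :=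
    contDiffOn_matrix fun i j => he.smooth_christoffel hU i μ j
  exact (contDiffOn_mul he.smooth_inv ((contDiffOn_pd he.smooth_frame hU μ).add
    (contDiffOn_mul hΓ he.smooth_frame))).congr fun y hy => he.spinConn_eq hU hy μ

theorem pd_inv (he : IsRadialFrame g e U) (hU : IsOpen U) (hy : y ∈ U) (μ : Fin n) :
    pd μ (fun z => (e z)⁻¹) y = -((e y)⁻¹ * pd μ e y * (e y)⁻¹) := by
  have h1 := pd_mul μ (differentiableAt_of_smooth he.smooth_inv hU hy)
    (differentiableAt_of_smooth he.smooth_frame hU hy)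
  rw [pd_congr hU hy (fun z hz => he.inv_mul hz), pd_const] at h1
  have h2 := congrArg (· * (e y)⁻¹) h1
  simp only [zero_mul, add_mul] at h2
  rw [mul_assoc, he.mul_inv hy, mul_one] at h2
  exact eq_neg_of_add_eq_zero_left h2.symm

theorem pd_inv_add (he : IsRadialFrame g e U) (hU : IsOpen U) (hy : y ∈ U) (μ : Fin n) :
    pd μ (fun z => (e z)⁻¹) y + spinConn g e y μ * (e y)⁻¹ = (e y)⁻¹ * chrMat g y μ := by
  rw [he.pd_inv hU hy, he.spinConn_eq hU hy, mul_add, add_mul, ← mul_assoc (e y)⁻¹ (chrMat g y μ),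
    mul_assoc _ (e y), he.mul_inv hy, mul_one]
  abel

theorem pd_coframe_apply (he : IsRadialFrame g e U) (hU : IsOpen U) (hy : y ∈ U)
    (μ ν a : Fin n) :
    pd μ (fun z => coframe e z ν) y a = pd μ (fun z => (e z)⁻¹) y a ν := by
  have hc : ContDiffOn ℝ ∞ (fun z => coframe e z ν) U :=
    contDiffOn_pi.2 fun a => contDiffOn_entry he.smooth_inv a ν
  rw [pd_pi_apply μ (differentiableAt_of_smooth hc hU hy),
    pd_matrix_apply μ (differentiableAt_of_smooth he.smooth_inv hU hy)]
  rfl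

theorem pd_coframe_add (he : IsRadialFrame g e U) (hU : IsOpen U) (hy : y ∈ U) (μ ν : Fin n) :
    pd μ (fun z => coframe e z ν) y + spinConn g e y μ *ᵥ coframe e y ν
      = (e y)⁻¹ *ᵥ fun ρ => christoffel g y ρ μ ν := by
  ext a
  rw [Pi.add_apply, he.pd_coframe_apply hU hy, mulVec_coframe, ← Matrix.add_apply,
    he.pd_inv_add hU hy]
  rfl

theorem spinConn_antisymm (he : IsRadialFrame g e U) (hU : IsOpen U) (hy : y ∈ U) (μ : Fin n) :
    (spinConn g e y μ)ᵀ = -spinConn g e y μ := by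
  have hinv : (e y)⁻¹ = (e y)ᵀ * g y := Matrix.inv_eq_left_inv (he.orthonormal y hy)
  have de := differentiableAt_of_smooth he.smooth_frame hU hy
  have dg := differentiableAt_of_smooth he.smooth_metric hU hy
  have sT : ContDiffOn ℝ ∞ (fun z => (e z)ᵀ) U :=
    contDiffOn_linear (Matrix.transposeLinearEquiv (Fin n) (Fin n) ℝ ℝ).toLinearMap
      he.smooth_frame
  have dT := differentiableAt_of_smooth sT hU hy
  have pT : pd μ (fun z => (e z)ᵀ) y = (pd μ e y)ᵀ :=
    pd_linear (Matrix.transposeLinearEquiv (Fin n) (Fin n) ℝ ℝ).toLinearMap μ de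
  have h1 := pd_congr hU hy he.orthonormal μ
  rw [pd_const, pd_mul μ (differentiableAt_of_smooth (contDiffOn_mul sT he.smooth_metric) hU hy) de,
    pd_mul μ dT dg, pT] at h1
  have hgs : (g y)ᵀ = g y := by
    ext a b
    exact he.metric_symm hy b a
  have h2 : g y * chrMat g y μ + (g y * chrMat g y μ)ᵀ = pd μ g y := by
    ext τ ρ
    rw [Matrix.add_apply, Matrix.transpose_apply, he.metric_mul_chrMat hy, he.metric_mul_chrMat hy,
      pd_matrix_apply μ dg, pd_congr hU hy (f := fun z => g z ρ τ)
        (fun z hz => he.metric_symm hz ρ τ) μ,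
      pd_congr hU hy (f := fun z => g z ρ μ) (fun z hz => he.metric_symm hz ρ μ) τ,
      pd_congr hU hy (f := fun z => g z μ τ) (fun z hz => he.metric_symm hz μ τ) ρ]
    ring
  rw [eq_neg_iff_add_eq_zero, he.spinConn_eq hU hy, hinv]
  simp only [Matrix.transpose_mul, Matrix.transpose_add, Matrix.transpose_transpose, hgs] at h2 ⊢
  rw [← h2] at h1
  rw [← h1]
  noncomm_ring

theorem radial_spinConn (he : IsRadialFrame g e U) (hy : y ∈ U) :
    ∑ μ, y μ • spinConn g e y μ = 0 := by
  ext a b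
  simp only [Matrix.sum_apply, Matrix.smul_apply, smul_eq_mul, spinConn, Matrix.of_apply,
    Finset.mul_sum, Matrix.zero_apply]
  rw [Finset.sum_comm]
  refine Finset.sum_eq_zero fun ν _ => ?_
  rw [← mul_zero ((e y)⁻¹ a ν), ← he.parallel y hy ν b, Finset.mul_sum]
  exact Finset.sum_congr rfl fun μ _ => by ring

theorem smooth_coframe (he : IsRadialFrame g e U) (μ : Fin n) :
    ContDiffOn ℝ ∞ (fun z => coframe e z μ) U :=
  contDiffOn_pi.2 fun a => contDiffOn_entry he.smooth_inv a μ

theorem radial_coframe (he : IsRadialFrame g e U) (hU : IsOpen U) (hs : StarConvex ℝ 0 U)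
    (hgeo : ∀ y ∈ U, ∀ ν, ∑ μ, ∑ ρ, christoffel g y ν μ ρ * y μ * y ρ = 0) (hy : y ∈ U) :
    ∑ μ, y μ • coframe e y μ = y.ofLp := by
  have key : ∀ z ∈ U, ∑ μ, z μ • ∑ ν, z ν • pd ν (fun x => coframe e x μ) z = 0 := by
    intro z hz
    have h1 : ∀ ν μ, pd ν (fun x => coframe e x μ) z = ((e z)⁻¹ *ᵥ fun ρ => christoffel g z ρ ν μ)
        - spinConn g e z ν *ᵥ coframe e z μ := fun ν μ =>
      eq_sub_of_add_eq (he.pd_coframe_add hU hz ν μ)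
    have h2 : ∀ μ, ∑ ν, z ν • (spinConn g e z ν *ᵥ coframe e z μ) = 0 := fun μ => by
      simp only [← Matrix.smul_mulVec, ← Matrix.sum_mulVec, he.radial_spinConn hz,
        Matrix.zero_mulVec]
    simp only [h1, smul_sub, Finset.sum_sub_distrib, h2, sub_zero]
    simp only [Finset.smul_sum, ← Matrix.mulVec_smul, ← Matrix.mulVec_sum]
    rw [show (∑ μ, ∑ ν, z μ • z ν • fun ρ => christoffel g z ρ ν μ) = 0 from ?_,
      Matrix.mulVec_zero]
    ext ν
    simp only [Finset.sum_apply, Pi.smul_apply, smul_eq_mul, Pi.zero_apply]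
    rw [← hgeo z hz ν, Finset.sum_comm]
    exact Finset.sum_congr rfl fun μ _ => Finset.sum_congr rfl fun ρ _ => by ring
  have sf : ContDiffOn ℝ ∞ (fun z => ∑ μ, y μ • coframe e z μ) U :=
    ContDiffOn.sum fun μ _ => (he.smooth_coframe μ).const_smul _
  have hray : ∀ t ∈ Set.Icc (0 : ℝ) 1, HasDerivAt
      (fun s : ℝ => ∑ μ, y μ • coframe e (s • y) μ) _ t := fun t ht =>
    hasDerivAt_ray (f := fun z => ∑ μ, y μ • coframe e z μ)
      (differentiableAt_of_smooth sf hU (smul_mem_of_starConvex hs hy ht))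
  have h := eq_of_hasDerivAt_zero
    (fun t ht => (hray t ht).continuousAt.continuousWithinAt) (fun t ht => ?_)
  · rw [one_smul] at h
    rw [h, sum_smul_coframe, zero_smul, he.center, inv_one, Matrix.one_mulVec]
  · have hti := Set.Ioo_subset_Icc_self ht
    have hm := smul_mem_of_starConvex hs hy hti
    have hk := key _ hm
    refine (hray t hti).congr_deriv ((fderiv_eq_sum_pd _ _ _).trans ?_)
    have hp : ∀ ν, pd ν (fun z => ∑ μ, y μ • coframe e z μ) (t • y)
        = ∑ μ, y μ • pd ν (fun z => coframe e z μ) (t • y) := by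
      intro ν
      rw [pd_sum (f := fun μ z => y μ • coframe e z μ) _ _ fun μ _ =>
        differentiableAt_of_smooth ((he.smooth_coframe μ).const_smul _) hU hm]
      exact Finset.sum_congr rfl fun μ _ => pd_linear (LinearMap.lsmul ℝ (Fin n → ℝ) (y μ)) ν
        (differentiableAt_of_smooth (he.smooth_coframe μ) hU hm)
    simp only [hp, Finset.smul_sum]
    rw [Finset.sum_comm]
    simp only [PiLp.smul_apply, smul_eq_mul, Finset.smul_sum, mul_smul,
      smul_comm _ t] at hk
    simp only [← Finset.smul_sum, smul_eq_zero, ht.1.ne', false_or] at hk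
    rw [← hk]
    refine Finset.sum_congr rfl fun μ _ => ?_
    rw [Finset.smul_sum]
    exact Finset.sum_congr rfl fun ν _ => smul_comm _ _ _

theorem curvForm_eq (he : IsRadialFrame g e U) (hU : IsOpen U) (hy : y ∈ U) (μ ν : Fin n) :
    curvForm g e y μ ν = pd μ (fun z => spinConn g e z ν) y - pd ν (fun z => spinConn g e z μ) y
      + (spinConn g e y μ * spinConn g e y ν - spinConn g e y ν * spinConn g e y μ) := by
  rw [curvForm, pdMat_eq_pd μ (differentiableAt_of_smooth (he.smooth_spinConn hU ν) hU hy),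
    pdMat_eq_pd ν (differentiableAt_of_smooth (he.smooth_spinConn hU μ) hU hy)]

theorem sum_coframe_mul (he : IsRadialFrame g e U) (hy : y ∈ U) (μ ν : Fin n) :
    ∑ c, coframe e y μ c * e y ν c = if ν = μ then 1 else 0 := by
  have h := congrFun (congrFun (he.mul_inv hy) ν) μ
  rw [Matrix.mul_apply, Matrix.one_apply] at h
  rw [← h]
  exact Finset.sum_congr rfl fun c _ => mul_comm _ _

/-- The coordinate components of a two-form with given frame components. -/
theorem sum_coframe_coframe {V : Type*} [AddCommGroup V] [Module ℝ V]
    (he : IsRadialFrame g e U) (hy : y ∈ U) (f : Fin n → Fin n → V) (μ ν : Fin n) :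
    ∑ c, ∑ d, (coframe e y μ c * coframe e y ν d) •
      ∑ α, ∑ γ, (e y α c * e y γ d) • f α γ = f μ ν := by
  have h1 : ∀ c d, (coframe e y μ c * coframe e y ν d) • ∑ α, ∑ γ, (e y α c * e y γ d) • f α γ
      = ∑ α, ∑ γ, ((coframe e y μ c * e y α c) * (coframe e y ν d * e y γ d)) • f α γ := by
    intro c d
    simp only [Finset.smul_sum, smul_smul]
    exact Finset.sum_congr rfl fun α _ => Finset.sum_congr rfl fun γ _ => by congr 1; ring
  simp only [h1]
  calc _ = ∑ α, ∑ γ, ((∑ c, coframe e y μ c * e y α c) * (∑ d, coframe e y ν d * e y γ d))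
          • f α γ := by
        simp only [Finset.sum_mul_sum, Finset.sum_smul]
        rw [Finset.sum_congr rfl fun c _ => Finset.sum_comm, Finset.sum_comm]
        refine Finset.sum_congr rfl fun α _ => ?_
        rw [Finset.sum_congr rfl fun c _ => Finset.sum_comm, Finset.sum_comm]
    _ = f μ ν := by
        simp [he.sum_coframe_mul hy]

theorem curvForm_eq_curvOp (he : IsRadialFrame g e U) (hy : y ∈ U) (μ ν : Fin n) :
    curvForm g e y μ ν = curvOp (riemann g e y) (coframe e y μ) (coframe e y ν) := by
  ext a b
  rw [curvOp_apply, ← he.sum_coframe_coframe hy (fun α γ => curvForm g e y α γ a b) μ ν]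
  rfl

theorem smooth_riemann (he : IsRadialFrame g e U) (hU : IsOpen U) (a b c d : Fin n) :
    ContDiffOn ℝ ∞ (fun z => riemann g e z a b c d) U := by
  have hs := fun μ => he.smooth_spinConn hU μ
  have hc : ∀ μ ν, ContDiffOn ℝ ∞ (fun z => curvForm g e z μ ν) U := fun μ ν =>
    (((contDiffOn_pd (hs ν) hU μ).sub (contDiffOn_pd (hs μ) hU ν)).add
      ((contDiffOn_mul (hs μ) (hs ν)).sub (contDiffOn_mul (hs ν) (hs μ)))).congr
      fun z hz => he.curvForm_eq hU hz μ ν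
  exact ContDiffOn.sum fun μ _ => ContDiffOn.sum fun ν _ =>
    ((he.smooth μ c).mul (he.smooth ν d)).mul (contDiffOn_entry (hc μ ν) a b)

/-- The frame components of a parallel curvature tensor are constant in the radial gauge. -/
theorem riemann_const (he : IsRadialFrame g e U) (hU : IsOpen U) (hs : StarConvex ℝ 0 U)
    (hR : ∀ y ∈ U, ∀ μ a b c d, covRiemann g e y μ a b c d = 0) (hy : y ∈ U) :
    riemann g e y = riemann g e 0 := by
  funext a b c d
  rw [← sub_eq_zero]
  have hd : ∀ z ∈ U, DifferentiableAt ℝ (fun z => riemann g e z a b c d) z := fun z hz =>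
    differentiableAt_of_smooth (he.smooth_riemann hU a b c d) hU hz
  refine radial_eq_zero hs (Z := fun z => riemann g e z a b c d - riemann g e 0 a b c d)
    (fun z hz => (hd z hz).sub_const _) 0 (fun z hz => ?_) (sub_self _) y hy
  rw [euler_sub (hd z hz) (differentiableAt_const _), euler_const, sub_zero, euler_eq_sum_pd]
  have h1 : ∀ i j, ∑ μ, z μ * spinConn g e z μ i j = 0 := by
    intro i j
    have := congrFun (congrFun (he.radial_spinConn hz) i) j
    simpa [Matrix.sum_apply] using this
  have h2 : ∀ (μ : Fin n) , z μ • pd μ (fun z => riemann g e z a b c d) z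
      = ∑ f, (z μ * spinConn g e z μ f a * riemann g e z f b c d
          + z μ * spinConn g e z μ f b * riemann g e z a f c d
          + z μ * spinConn g e z μ f c * riemann g e z a b f d
          + z μ * spinConn g e z μ f d * riemann g e z a b c f) := by
    intro μ
    have := sub_eq_zero.1 (hR z hz μ a b c d)
    rw [this, smul_eq_mul, Finset.mul_sum]
    exact Finset.sum_congr rfl fun f _ => by ring
  simp only [h2]
  rw [Finset.sum_comm]
  simp only [Finset.sum_add_distrib, ← Finset.sum_mul, h1, zero_mul, Finset.sum_const_zero]
  simp

theorem spinConn_mem_curvStabilizer (he : IsRadialFrame g e U) (hU : IsOpen U)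
    (hs : StarConvex ℝ 0 U) (hR : ∀ y ∈ U, ∀ μ a b c d, covRiemann g e y μ a b c d = 0)
    (hy : y ∈ U) (μ : Fin n) : spinConn g e y μ ∈ curvStabilizer (riemann g e 0) := by
  have hanti := he.spinConn_antisymm hU hy μ
  have key : ∀ a b c d, ∑ f, (spinConn g e y μ f a * riemann g e 0 f b c d
          + spinConn g e y μ f b * riemann g e 0 a f c d
          + spinConn g e y μ f c * riemann g e 0 a b f d
          + spinConn g e y μ f d * riemann g e 0 a b c f) = 0 := by
    intro a b c d
    have h := hR y hy μ a b c d
    rw [covRiemann, pd_congr hU hy (h := fun _ => riemann g e 0 a b c d)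
      (fun z hz => by rw [he.riemann_const hU hs hR hz]), pd_const, zero_sub, neg_eq_zero,
      he.riemann_const hU hs hR hy] at h
    exact h
  set W := spinConn g e y μ with hW
  set R := riemann g e 0
  have hcol : ∀ c : Fin n, W *ᵥ Pi.single c 1 = ∑ f, W f c • (Pi.single f 1 : Fin n → ℝ) := by
    intro b
    ext a
    simp [Pi.single_apply]
  have basis : ∀ c d : Fin n, W * curvOp R (Pi.single c 1) (Pi.single d 1)
      - curvOp R (Pi.single c 1) (Pi.single d 1) * W
      = curvOp R (W *ᵥ Pi.single c 1) (Pi.single d 1)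
        + curvOp R (Pi.single c 1) (W *ᵥ Pi.single d 1) := by
    intro c d
    ext a b
    have hk := key a b c d
    simp only [hcol, map_sum, LinearMap.sum_apply, map_smul, LinearMap.smul_apply,
      Matrix.sub_apply, Matrix.add_apply, Matrix.sum_apply, Matrix.smul_apply, Matrix.mul_apply,
      curvOp_single, smul_eq_mul]
    simp only [Finset.sum_add_distrib] at hk
    have h1 : ∑ f, W a f * R f b c d = -∑ f, W f a * R f b c d := by
      rw [← Finset.sum_neg_distrib]
      refine Finset.sum_congr rfl fun f _ => ?_
      have : W f a = -W a f := congrFun (congrFun hanti a) f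
      rw [this]
      ring
    have h2 : ∑ f, R a f c d * W f b = ∑ f, W f b * R a f c d :=
      Finset.sum_congr rfl fun f _ => mul_comm _ _
    rw [h1, h2]
    linear_combination -hk
  intro u v
  refine vec_induction (P := fun u => W * curvOp R u v - curvOp R u v * W
    = curvOp R (W *ᵥ u) v + curvOp R u (W *ᵥ v)) (by simp) ?_ ?_ (fun c => ?_) u
  · intro x z hx hz
    simp only [map_add, LinearMap.add_apply, Matrix.mulVec_add, mul_add, add_mul]
    linear_combination (norm := abel) hx + hz
  · intro t x hx
    simp only [map_smul, LinearMap.smul_apply, Matrix.mulVec_smul, mul_smul_comm, smul_mul_assoc,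
      ← smul_sub, hx, smul_add]
  refine vec_induction (P := fun v => W * curvOp R (Pi.single c 1) v
    - curvOp R (Pi.single c 1) v * W
    = curvOp R (W *ᵥ Pi.single c 1) v + curvOp R (Pi.single c 1) (W *ᵥ v)) (by simp) ?_ ?_
    (basis c) v
  · intro x z hx hz
    simp only [map_add, Matrix.mulVec_add, mul_add, add_mul]
    linear_combination (norm := abel) hx + hz
  · intro t x hx
    simp only [map_smul, Matrix.mulVec_smul, mul_smul_comm, smul_mul_assoc, ← smul_sub, hx,
      smul_add]

theorem symmetricFrame (he : IsRadialFrame g e U) (hU : IsOpen U) (hs : StarConvex ℝ 0 U)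
    (h0 : (0 : Coord n) ∈ U)
    (hgeo : ∀ y ∈ U, ∀ ν, ∑ μ, ∑ ρ, christoffel g y ν μ ρ * y μ * y ρ = 0)
    (hR : ∀ y ∈ U, ∀ μ a b c d, covRiemann g e y μ a b c d = 0) :
    SymmetricFrame U (coframe e) (spinConn g e) (riemann g e 0) where
  isOpen := hU
  starConvex := hs
  zero_mem := h0
  smooth_coframe := he.smooth_coframe
  smooth_conn := he.smooth_spinConn hU
  center μ := by
    ext a
    rw [coframe, he.center, inv_one, Matrix.one_apply, Pi.single_apply]
  radial_coframe y hy := he.radial_coframe hU hs hgeo hy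
  radial_conn y hy := he.radial_spinConn hy
  torsion y hy μ ν := by
    rw [he.pd_coframe_add hU hy, he.pd_coframe_add hU hy]
    simp only [he.christoffel_symm hU hy _ μ ν]
  curv y hy μ ν := by
    rw [← he.curvForm_eq hU hy, he.curvForm_eq_curvOp hy, he.riemann_const hU hs hR hy]
  parallel y hy μ := he.spinConn_mem_curvStabilizer hU hs hR hy μ

end IsRadialFrame

end Frame

/-! ### The Killing fields in normal coordinates -/

section PowerSeries

variable {𝔸 : Type*} [NormedRing 𝔸] [NormedAlgebra ℝ 𝔸]

/-- The generator `(a, b) ↦ (b, -K a)` of the equation `a'' = -K a`. -/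
def oscillator (K : 𝔸) : (𝔸 × 𝔸) →L[ℝ] (𝔸 × 𝔸) :=
  (ContinuousLinearMap.snd ℝ 𝔸 𝔸).prod
    ((ContinuousLinearMap.mul ℝ 𝔸 (-K)).comp (ContinuousLinearMap.fst ℝ 𝔸 𝔸))

theorem oscillator_apply (K a b : 𝔸) : oscillator K (a, b) = (b, -K * a) := rfl

theorem oscillator_pow_even (K : 𝔸) (m : ℕ) :
    (oscillator K ^ (2 * m)) (0, 1) = (0, (-K) ^ m) := by
  induction m with
  | zero => simp
  | succ m ih =>
    rw [show 2 * (m + 1) = (2 * m + 1) + 1 from rfl, pow_succ', pow_succ', mul_apply_eq_comp,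
      mul_apply_eq_comp, ih, oscillator_apply, oscillator_apply, pow_succ', mul_zero]

theorem oscillator_pow_odd (K : 𝔸) (m : ℕ) :
    (oscillator K ^ (2 * m + 1)) (0, 1) = ((-K) ^ m, 0) := by
  rw [pow_succ', mul_apply_eq_comp, oscillator_pow_even, oscillator_apply, mul_zero]

theorem inv_smul_neg_pow (K : 𝔸) (c : ℝ) (m : ℕ) :
    c⁻¹ • (-K) ^ m = ((-1 : ℝ) ^ m / c) • K ^ m := by
  rw [neg_pow, div_eq_mul_inv, mul_comm, mul_smul]
  rcases m.even_or_odd with hm | hm <;> simp [hm.neg_one_pow]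

/-- The power series solution of `a'' = -K a` with `a(0) = 0` and `a'(0) = 1`. -/
theorem hasSum_of_oscillator [CompleteSpace 𝔸] {K : 𝔸} {a b : ℝ → 𝔸}
    (ha : ∀ t ∈ Set.Icc (0 : ℝ) 1, HasDerivAt a (b t) t) (hb : ContinuousOn b (Set.Icc 0 1))
    (hd : ∀ t ∈ Set.Ioo (0 : ℝ) 1, HasDerivAt b (-K * a t) t) (ha0 : a 0 = 0) (hb0 : b 0 = 1) :
    HasSum (fun m : ℕ => ((-1 : ℝ) ^ m / (2 * m + 1).factorial) • K ^ m) (a 1) ∧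
      HasSum (fun m : ℕ => ((-1 : ℝ) ^ m / (2 * m).factorial) • K ^ m) (b 1) := by
  have key := eq_exp_of_hasDerivAt (x := fun s => (a s, b s)) (oscillator K)
    (fun t ht => (ha t ht).continuousAt.continuousWithinAt.prodMk (hb t ht))
    (fun t ht => (ha t (Set.Ioo_subset_Icc_self ht)).prodMk (hd t ht))
  have hs : HasSum (fun m : ℕ => ((m.factorial : ℝ)⁻¹) • (oscillator K ^ m) (0, 1))
      (a 1, b 1) := by
    rw [key, ha0, hb0]
    have h1 := NormedSpace.exp_series_hasSum_exp' (𝕂 := ℝ) (oscillator K)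
    have h2 := (ContinuousLinearMap.apply ℝ (𝔸 × 𝔸) ((0, 1) : 𝔸 × 𝔸)).hasSum h1
    simp only [ContinuousLinearMap.apply_apply, smul_apply] at h2
    exact h2
  constructor
  · have h := (ContinuousLinearMap.fst ℝ 𝔸 𝔸).hasSum hs
    have hinj : Function.Injective (fun m : ℕ => 2 * m + 1) := fun a b hab => by
      simpa using hab
    rw [← hinj.hasSum_iff] at h
    · convert h using 2 with m
      · simp only [Function.comp_apply, oscillator_pow_odd, ContinuousLinearMap.coe_fst',
          Prod.smul_fst, inv_smul_neg_pow]
      · rfl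
    · intro k hk
      obtain ⟨m, rfl | rfl⟩ := k.even_or_odd'
      · simp only [oscillator_pow_even, ContinuousLinearMap.coe_fst', Prod.smul_fst, smul_zero]
      · exact absurd ⟨m, rfl⟩ hk
  · have h := (ContinuousLinearMap.snd ℝ 𝔸 𝔸).hasSum hs
    have hinj : Function.Injective (fun m : ℕ => 2 * m) := fun a b hab => by
      simpa using hab
    rw [← hinj.hasSum_iff] at h
    · convert h using 2 with m
      · simp only [Function.comp_apply, oscillator_pow_even, ContinuousLinearMap.coe_snd',
          Prod.smul_snd, inv_smul_neg_pow]
      · rfl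
    · intro k hk
      obtain ⟨m, rfl | rfl⟩ := k.even_or_odd'
      · exact absurd ⟨m, rfl⟩ hk
      · simp only [oscillator_pow_odd, ContinuousLinearMap.coe_snd', Prod.smul_snd, smul_zero]

theorem commute_of_hasSum {𝔸 : Type*} [NormedRing 𝔸] {f : ℕ → 𝔸} {S A : 𝔸} (h : HasSum f S)
    (hc : ∀ m, Commute (f m) A) : Commute S A := by
  have h1 := h.mul_right A
  have h2 := h.mul_left A
  simp only [(hc _).eq] at h1
  exact h1.unique h2

theorem commute_of_hasSum_smul_pow {f k : ℕ → ℝ} {K S T : 𝔸}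
    (hS : HasSum (fun m => f m • K ^ m) S) (hT : HasSum (fun m => k m • K ^ m) T) :
    Commute S T := by
  refine commute_of_hasSum hS fun m => Commute.symm (commute_of_hasSum hT fun l => ?_)
  exact ((Commute.refl K).pow_pow l m).smul_left _ |>.smul_right _

end PowerSeries

section KillingFrame

variable {n p : ℕ} {U : Set (Coord n)} {g e : Coord n → Matrix (Fin n) (Fin n) ℝ} {y : Coord n}
  {R : Fin n → Fin n → Fin n → Fin n → ℝ} {E : Fin p → Matrix (Fin n) (Fin n) ℝ}
  {β : Matrix (Fin p) (Fin p) ℝ}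

theorem jacobiMat_smul (t : ℝ) (y : Coord n) :
    jacobiMat R (t • y) = (t * t) • jacobiMat R y := by
  ext a b
  simp only [jacobiMat, Matrix.of_apply, Matrix.smul_apply, smul_eq_mul, Finset.mul_sum,
    PiLp.smul_apply]
  exact Finset.sum_congr rfl fun c _ => Finset.sum_congr rfl fun d _ => by ring

theorem curvOp_mulVec_self (hE : IsCurvDecomp R E β) (y : Coord n) (w : Fin n → ℝ) :
    curvOp R y.ofLp w *ᵥ y.ofLp = -(jacobiMat R y *ᵥ w) := by
  rw [curvOp_antisymm hE w, Matrix.neg_mulVec, neg_inj]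
  ext a
  simp only [Matrix.mulVec, dotProduct, curvOp_apply, jacobiMat, Matrix.of_apply, Finset.sum_mul]
  rw [Finset.sum_comm]
  exact Finset.sum_congr rfl fun c _ => Finset.sum_congr rfl fun b _ =>
    Finset.sum_congr rfl fun d _ => by ring

/-- The matrix with the columns `P_a`, in the radially parallel frame. -/
def transvectionMat (g e : Coord n → Matrix (Fin n) (Fin n) ℝ) (y : Coord n) :
    Matrix (Fin n) (Fin n) ℝ :=
  Matrix.of fun b a => ((Pi.single a 1 : Fin n → ℝ) + spinConn g e y a *ᵥ y.ofLp) b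

theorem euler_matrix_apply {f : Coord n → Matrix (Fin n) (Fin n) ℝ}
    (hf : DifferentiableAt ℝ f y) (i j : Fin n) : euler f y i j = euler (fun z => f z i j) y :=
  (euler_linear (Matrix.entryLinearMap ℝ ℝ i j) hf).symm

theorem euler_pi_apply {f : Coord n → Fin n → ℝ} (hf : DifferentiableAt ℝ f y) (i : Fin n) :
    euler f y i = euler (fun z => f z i) y :=
  (euler_linear (LinearMap.proj (R := ℝ) (φ := fun _ : Fin n => ℝ) i) hf).symm

theorem coframe_eq_sincSqrt (he : IsRadialFrame g e U)
    (h : SymmetricFrame U (coframe e) (spinConn g e) (riemann g e 0))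
    (hE : IsCurvDecomp (riemann g e 0) E β) (hy : y ∈ U) :
    (e y)⁻¹ = sincSqrt (jacobiMat (riemann g e 0) y) ∧
      transvectionMat g e y = cosSqrt (jacobiMat (riemann g e 0) y) ∧
      Commute (e y)⁻¹ (transvectionMat g e y) := by
  have hU := h.isOpen
  have hP := fun a => IsKillingPair.transvection h hE a
  have sC : ContDiffOn ℝ ∞ (transvectionMat g e) U :=
    contDiffOn_matrix fun b a => contDiffOn_pi.1 (hP a).smooth_vec b
  have dinv : ∀ z ∈ U, DifferentiableAt ℝ (fun z => (e z)⁻¹) z := fun z hz =>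
    differentiableAt_of_smooth he.smooth_inv hU hz
  have dC : ∀ z ∈ U, DifferentiableAt ℝ (transvectionMat g e) z := fun z hz =>
    differentiableAt_of_smooth sC hU hz
  have e1 : ∀ z ∈ U, euler (fun z => (e z)⁻¹) z + (e z)⁻¹ = transvectionMat g e z := by
    intro z hz
    ext b a
    have h1 := congrFun (h.euler_coframe hz a) b
    rw [Pi.add_apply, euler_pi_apply (h.diff_coframe hz a)] at h1
    rw [Matrix.add_apply, euler_matrix_apply (dinv z hz)]
    exact h1
  have e2 : ∀ z ∈ U, euler (transvectionMat g e) z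
      = -(jacobiMat (riemann g e 0) z * (e z)⁻¹) := by
    intro z hz
    ext b a
    have h1 := congrFun ((hP a).euler_vec h hz) b
    rw [curvOp_mulVec_self hE, euler_pi_apply
      (differentiableAt_of_smooth (hP a).smooth_vec hU hz)] at h1
    rw [euler_matrix_apply (dC z hz)]
    exact h1
  have r1 : ∀ t ∈ Set.Icc (0 : ℝ) 1, HasDerivAt (fun s : ℝ => s • (e (s • y))⁻¹)
      (transvectionMat g e (t • y)) t := by
    intro t ht
    have hm := smul_mem_of_starConvex h.starConvex hy ht
    have h1 := (hasDerivAt_id t).smul (hasDerivAt_ray (f := fun z => (e z)⁻¹) (dinv _ hm))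
    refine h1.congr_deriv ?_
    rw [← e1 _ hm, euler]
    simp only [id, one_smul, map_smul]
  have r2 : ∀ t ∈ Set.Icc (0 : ℝ) 1, HasDerivAt (fun s : ℝ => transvectionMat g e (s • y))
      (fderiv ℝ (transvectionMat g e) (t • y) y) t := fun t ht =>
    hasDerivAt_ray (dC _ (smul_mem_of_starConvex h.starConvex hy ht))
  have : CompleteSpace (Matrix (Fin n) (Fin n) ℝ) := FiniteDimensional.complete ℝ _
  have hC0 : transvectionMat g e 0 = 1 := by
    ext b a
    simp [transvectionMat, Pi.single_apply, Matrix.one_apply]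
  have key := hasSum_of_oscillator (K := jacobiMat (riemann g e 0) y) r1
    (fun t ht => (r2 t ht).continuousAt.continuousWithinAt) ?_ (zero_smul _ _)
    (by rw [zero_smul, hC0])
  · rw [one_smul, one_smul] at key
    exact ⟨key.1.tsum_eq.symm, key.2.tsum_eq.symm, commute_of_hasSum_smul_pow key.1 key.2⟩
  · intro t ht
    have hti := Set.Ioo_subset_Icc_self ht
    have hm := smul_mem_of_starConvex h.starConvex hy hti
    refine (r2 t hti).congr_deriv ?_
    have h4 := e2 _ hm
    rw [euler, map_smul, jacobiMat_smul, smul_mul_assoc, mul_smul, ← smul_neg] at h4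
    refine (smul_right_injective _ ht.1.ne' h4).trans ?_
    rw [neg_mul, mul_smul_comm]

theorem killingFrame_eq (he : IsRadialFrame g e U)
    (h : SymmetricFrame U (coframe e) (spinConn g e) (riemann g e 0))
    (hE : IsCurvDecomp (riemann g e 0) E β) (hy : y ∈ U) (A : Fin n ⊕ Fin p) (b : Fin n) :
    killingFrame g e E β A y b = killVec (coframe e) (spinConn g e) E β A y b := by
  rcases A with a | i
  · obtain ⟨h1, h2, hcomm⟩ := coframe_eq_sincSqrt he h hE hy
    have h3 : killingFrame g e E β (.inl a) y b
        = ((e y)⁻¹ * sqrtCotSqrt (jacobiMat (riemann g e 0) y)) b a := rfl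
    have h4 : (e y)⁻¹ * sqrtCotSqrt (jacobiMat (riemann g e 0) y) = transvectionMat g e y := by
      rw [sqrtCotSqrt, ← h2, ← h1, ← mul_assoc, hcomm.eq, mul_assoc,
        Matrix.mul_nonsing_inv _ (Matrix.isUnit_det_of_right_inverse (he.inv_mul hy)), mul_one]
    rw [h3, h4]
    rfl
  · simp only [killVec, sum_smul_coframe]
    simp only [killingFrame, killing, Pi.neg_apply, Matrix.mulVec, dotProduct, mul_neg,
      Finset.sum_neg_distrib]

theorem killing_eq (he : IsRadialFrame g e U)
    (h : SymmetricFrame U (coframe e) (spinConn g e) (riemann g e 0))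
    (hE : IsCurvDecomp (riemann g e 0) E β) (hy : y ∈ U) (A : Fin n ⊕ Fin p) :
    killing g e E β A y = e y *ᵥ killVec (coframe e) (spinConn g e) E β A y := by
  have h1 : killVec (coframe e) (spinConn g e) E β A y = (e y)⁻¹ *ᵥ killing g e E β A y := by
    ext b
    rw [← killingFrame_eq he h hE hy]
    rfl
  rw [h1, Matrix.mulVec_mulVec, he.mul_inv hy, Matrix.one_mulVec]

theorem killingDeriv_eq (he : IsRadialFrame g e U)
    (h : SymmetricFrame U (coframe e) (spinConn g e) (riemann g e 0))
    (hE : IsCurvDecomp (riemann g e 0) E β) (hy : y ∈ U) (A : Fin n ⊕ Fin p) (a b : Fin n) :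
    killingDeriv g e E β A y a b
      = killMat (riemann g e 0) (coframe e) (spinConn g e) E β A y a b := by
  have hk := h.isKillingPair hE A
  set Q := killMat (riemann g e 0) (coframe e) (spinConn g e) E β A y
  have h1 : ∀ μ, pd μ (fun z => killingFrame g e E β A z a) y
      + ∑ c, spinConn g e y μ a c * killingFrame g e E β A y c = (Q * (e y)⁻¹) a μ := by
    intro μ
    have h2 := congrFun (hk.pd_vec y hy μ) a
    rw [Pi.add_apply, pd_pi_apply μ (differentiableAt_of_smooth hk.smooth_vec h.isOpen hy)] at h2
    rw [pd_congr h.isOpen hy (fun z hz => killingFrame_eq he h hE hz A a)]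
    simp only [killingFrame_eq he h hE hy]
    exact h2
  simp only [killingDeriv, h1]
  have h3 : (Q * (e y)⁻¹ * e y) a b = Q a b := by rw [mul_assoc, he.inv_mul hy, mul_one]
  rw [← h3, Matrix.mul_apply]
  exact Finset.sum_congr rfl fun μ _ => mul_comm _ _

end KillingFrame

/-! ### Flat directions -/

section Flat

variable {n p : ℕ} {R : Fin n → Fin n → Fin n → Fin n → ℝ}
  {E : Fin p → Matrix (Fin n) (Fin n) ℝ} {β : Matrix (Fin p) (Fin p) ℝ}

theorem mem_flatSpace_iff (hE : IsCurvDecomp R E β) (v : Coord n) :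
    v ∈ flatSpace R ↔ ∀ x z, curvOp R x z *ᵥ v.ofLp = 0 := by
  have hanti : ∀ a b c d, R a b c d = -R b a c d := by
    intro a b c d
    have h := congrFun (congrFun (transpose_of_mem_holonomy hE
      (curvOp_mem_holonomy hE (Pi.single c 1) (Pi.single d 1))) b) a
    rw [Matrix.transpose_apply, Matrix.neg_apply, curvOp_single, curvOp_single] at h
    exact h
  have h1 : v ∈ flatSpace R ↔ ∀ b c d, ∑ a, R a b c d * v a = 0 := Iff.rfl
  rw [h1]
  constructor
  · intro h
    have hb : ∀ c d : Fin n, curvOp R (Pi.single c 1) (Pi.single d 1) *ᵥ v.ofLp = 0 := by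
      intro c d
      ext a
      have := h a c d
      simp only [Matrix.mulVec, dotProduct, curvOp_single, Pi.zero_apply]
      rw [← neg_eq_zero, ← Finset.sum_neg_distrib, ← this]
      exact Finset.sum_congr rfl fun b _ => by rw [hanti a b]; ring
    intro x z
    refine vec_induction (P := fun x => curvOp R x z *ᵥ v.ofLp = 0) (by simp)
      (fun u w hu hw => by simp [Matrix.add_mulVec, hu, hw])
      (fun t u hu => by simp [Matrix.smul_mulVec, hu]) (fun c => ?_) x
    exact vec_induction (P := fun z => curvOp R (Pi.single c 1) z *ᵥ v.ofLp = 0) (by simp)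
      (fun u w hu hw => by simp [Matrix.add_mulVec, hu, hw])
      (fun t u hu => by simp [Matrix.smul_mulVec, hu]) (hb c) z
  · intro h b c d
    have := congrFun (h (Pi.single c 1) (Pi.single d 1)) b
    simp only [Matrix.mulVec, dotProduct, curvOp_single, Pi.zero_apply] at this
    rw [← neg_eq_zero, ← Finset.sum_neg_distrib, ← this]
    exact Finset.sum_congr rfl fun a _ => by rw [hanti a b]; ring

theorem flatProj_mulVec (u : Fin n → ℝ) :
    flatProj R *ᵥ u = ((flatSpace R).starProjection (WithLp.toLp 2 u)).ofLp := by
  have h : (WithLp.toLp 2 u : Coord n) = ∑ b, u b • EuclideanSpace.single b (1 : ℝ) :=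
    coord_eq_sum (WithLp.toLp 2 u)
  rw [h]
  ext a
  simp only [map_sum, map_smul, Matrix.mulVec, dotProduct, flatProj, Matrix.of_apply,
    WithLp.ofLp_sum, WithLp.ofLp_smul, Finset.sum_apply, Pi.smul_apply, smul_eq_mul]
  exact Finset.sum_congr rfl fun b _ => mul_comm _ _

theorem curvOp_mulVec_flatProj (hE : IsCurvDecomp R E β) (x z u : Fin n → ℝ) :
    curvOp R x z *ᵥ (flatProj R *ᵥ u) = 0 := by
  rw [flatProj_mulVec]
  exact (mem_flatSpace_iff hE _).1 (Submodule.starProjection_apply_mem _ _) x z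

theorem flatProj_mulVec_eq (hE : IsCurvDecomp R E β) {w : Fin n → ℝ}
    (hw : ∀ x z, curvOp R x z *ᵥ w = 0) : flatProj R *ᵥ w = w := by
  have hm : WithLp.toLp 2 w ∈ flatSpace R := (mem_flatSpace_iff hE _).2 hw
  rw [flatProj_mulVec, Submodule.starProjection_eq_self_iff.2 hm]

theorem flatProj_transpose : (flatProj R)ᵀ = flatProj R := by
  ext a b
  have h := Submodule.starProjection_isSymmetric (flatSpace R)
    (EuclideanSpace.single a (1 : ℝ)) (EuclideanSpace.single b (1 : ℝ))
  simpa [flatProj, EuclideanSpace.inner_single_left, EuclideanSpace.inner_single_right] using h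

theorem mul_flatProj (hE : IsCurvDecomp R E β) {Q : Matrix (Fin n) (Fin n) ℝ}
    (hQ : Q ∈ holonomy E) : Q * flatProj R = 0 := by
  have hle : holonomy E ≤ LinearMap.ker (LinearMap.mulRight ℝ (flatProj R)) := by
    refine holonomy_le hE fun x z => ?_
    rw [LinearMap.mem_ker, LinearMap.mulRight_apply]
    ext a b
    have h := congrFun (curvOp_mulVec_flatProj hE x z (Pi.single b 1)) a
    rw [Matrix.mulVec_mulVec] at h
    simpa using h
  exact hle hQ

theorem flatProj_mul (hE : IsCurvDecomp R E β) {Q : Matrix (Fin n) (Fin n) ℝ}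
    (hQ : Q ∈ holonomy E) : flatProj R * Q = 0 := by
  have h := congrArg Matrix.transpose (mul_flatProj hE hQ)
  rw [Matrix.transpose_mul, flatProj_transpose, transpose_of_mem_holonomy hE hQ, mul_neg,
    Matrix.transpose_zero, neg_eq_zero] at h
  exact h

theorem semisimpleProj_mul (hE : IsCurvDecomp R E β) {Q : Matrix (Fin n) (Fin n) ℝ}
    (hQ : Q ∈ holonomy E) : semisimpleProj R * Q = Q := by
  rw [semisimpleProj, sub_mul, flatProj_mul hE hQ, one_mul, sub_zero]

theorem mul_semisimpleProj (hE : IsCurvDecomp R E β) {Q : Matrix (Fin n) (Fin n) ℝ}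
    (hQ : Q ∈ holonomy E) : Q * semisimpleProj R = Q := by
  rw [semisimpleProj, mul_sub, mul_flatProj hE hQ, mul_one, sub_zero]

theorem curvOp_of_flat (hE : IsCurvDecomp R E β) {w : Fin n → ℝ}
    (hw : ∀ x z, curvOp R x z *ᵥ w = 0) (z : Fin n → ℝ) : curvOp R w z = 0 := by
  have hk : ∀ Q ∈ holonomy E, Q *ᵥ w = 0 := by
    have hle : holonomy E ≤ LinearMap.ker ((mulVecBilin (Fin n) ℝ).flip w) :=
      holonomy_le hE fun x z => hw x z
    exact fun Q hQ => hle hQ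
  rw [curvOp_antisymm hE z, curvOp_eq_sum hE]
  simp [hk _ (mem_holonomy E _)]

/-- A linear map which vanishes on the image of the curvature vanishes on the orthogonal
complement of the flat directions. -/
theorem map_semisimpleProj_eq_zero (hE : IsCurvDecomp R E β) {V : Type*} [AddCommGroup V]
    [Module ℝ V] (T : (Fin n → ℝ) →ₗ[ℝ] V) (hT : ∀ x z u, T (curvOp R x z *ᵥ u) = 0)
    (u : Fin n → ℝ) : T (semisimpleProj R *ᵥ u) = 0 := by
  rw [← Module.forall_dual_apply_eq_zero_iff ℝ]
  intro l
  set w : Fin n → ℝ := fun a => l (T (Pi.single a 1)) with hwdef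
  have hl : ∀ v, l (T v) = w ⬝ᵥ v := by
    intro v
    conv_lhs => rw [pi_eq_sum_univ' v]
    simp only [map_sum, map_smul, smul_eq_mul, dotProduct, hwdef]
    exact Finset.sum_congr rfl fun a _ => mul_comm _ _
  have hw : ∀ x z, curvOp R x z *ᵥ w = 0 := by
    intro x z
    have h1 : ∀ v, v ⬝ᵥ curvOp R x z *ᵥ w = 0 := by
      intro v
      rw [dotProduct_mulVec_antisymm (transpose_of_mem_holonomy hE (curvOp_mem_holonomy hE x z)),
        ← hl, hT, map_zero, neg_zero]
    exact dotProduct_eq_zero _ fun v => by rw [dotProduct_comm]; exact h1 v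
  have h2 : semisimpleProj R *ᵥ w = 0 := by
    rw [semisimpleProj, Matrix.sub_mulVec, flatProj_mulVec_eq hE hw, Matrix.one_mulVec, sub_self]
  have h3 : (semisimpleProj R)ᵀ = semisimpleProj R := by
    rw [semisimpleProj, Matrix.transpose_sub, flatProj_transpose, Matrix.transpose_one]
  rw [hl, Matrix.dotProduct_mulVec, ← Matrix.mulVec_transpose, h3, h2, zero_dotProduct]

end Flat

/-! ### Representations of the rotation algebra -/

section Representation

variable {n : ℕ} {ι 𝕜 : Type*} [RCLike 𝕜]

/-- The representation `A ↦ ½ A^{ab} Z_{ab}` of antisymmetric matrices. -/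
def repMap (Z : Fin n → Fin n → Matrix ι ι 𝕜) :
    Matrix (Fin n) (Fin n) ℝ →ₗ[ℝ] Matrix ι ι 𝕜 where
  toFun A := (1 / 2 : ℝ) • ∑ a, ∑ b, A a b • Z a b
  map_add' A B := by
    simp only [Matrix.add_apply, add_smul, Finset.sum_add_distrib, smul_add]
  map_smul' c A := by
    simp only [Matrix.smul_apply, smul_eq_mul, mul_smul, ← Finset.smul_sum, RingHom.id_apply]
    rw [smul_comm]

theorem repMap_apply (Z : Fin n → Fin n → Matrix ι ι 𝕜) (A : Matrix (Fin n) (Fin n) ℝ) :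
    repMap Z A = (1 / 2 : ℝ) • ∑ a, ∑ b, A a b • Z a b := rfl

theorem repMap_commutator_apply [Fintype ι] {Z : Fin n → Fin n → Matrix ι ι 𝕜}
    (hZ : IsSOGenerators Z)
    {A : Matrix (Fin n) (Fin n) ℝ} (hA : Aᵀ = -A) (c d : Fin n) :
    repMap Z A * Z c d - Z c d * repMap Z A = ∑ a, (A a c • Z a d + A a d • Z c a) := by
  have hAe : ∀ a b, A b a = -A a b := fun a b => congrFun (congrFun hA a) b
  have h1 : repMap Z A * Z c d - Z c d * repMap Z A
      = (1 / 2 : ℝ) • ∑ a, ∑ b, A a b • (Z a b * Z c d - Z c d * Z a b) := by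
    simp only [repMap_apply, smul_mul_assoc, mul_smul_comm, Finset.sum_mul, Finset.mul_sum,
      ← smul_sub, ← Finset.sum_sub_distrib]
  rw [h1]
  simp only [hZ.commutator, smul_sub, smul_add, Finset.sum_add_distrib, Finset.sum_sub_distrib,
    smul_ite, smul_zero, Finset.sum_ite_eq', Finset.mem_univ, if_true]
  have e1 : ∑ x, ∑ y, (if x = c then A x y • Z y d else 0) = ∑ y, A c y • Z y d := by
    rw [Finset.sum_comm]; simp
  have e2 : ∑ x, ∑ y, (if x = d then A x y • Z y c else 0) = ∑ y, A d y • Z y c := by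
    rw [Finset.sum_comm]; simp
  rw [e1, e2]
  have e3 : ∑ y, A c y • Z y d = -∑ y, A y c • Z y d := by
    rw [← Finset.sum_neg_distrib]
    exact Finset.sum_congr rfl fun y _ => by rw [hAe y c, neg_smul]
  have e4 : ∑ y, A d y • Z y c = ∑ y, A y d • Z c y :=
    Finset.sum_congr rfl fun y _ => by rw [hAe y d, hZ.antisymm c y, neg_smul, smul_neg, neg_neg]
  have e5 : ∑ y, A y d • Z y c = -∑ y, A y d • Z c y := by
    rw [← Finset.sum_neg_distrib]
    exact Finset.sum_congr rfl fun y _ => by rw [hZ.antisymm c y, smul_neg]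
  rw [e3, e4, e5]
  module

theorem repMap_commutator [Fintype ι] {Z : Fin n → Fin n → Matrix ι ι 𝕜} (hZ : IsSOGenerators Z)
    {A : Matrix (Fin n) (Fin n) ℝ} (hA : Aᵀ = -A) (B : Matrix (Fin n) (Fin n) ℝ) :
    repMap Z A * repMap Z B - repMap Z B * repMap Z A = repMap Z (A * B - B * A) := by
  have hAe : ∀ a b, A b a = -A a b := fun a b => congrFun (congrFun hA a) b
  have h1 : repMap Z A * repMap Z B - repMap Z B * repMap Z A
      = (1 / 2 : ℝ) • ∑ c, ∑ d, B c d • (repMap Z A * Z c d - Z c d * repMap Z A) := by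
    conv_lhs => rw [repMap_apply Z B]
    simp only [smul_mul_assoc, mul_smul_comm, Finset.sum_mul, Finset.mul_sum,
      ← smul_sub, ← Finset.sum_sub_distrib]
  simp only [repMap_commutator_apply hZ hA] at h1
  rw [h1, repMap_apply]
  congr 1
  simp only [Finset.smul_sum, smul_add, smul_smul,
    Finset.sum_add_distrib, Matrix.sub_apply, Matrix.mul_apply, sub_smul, Finset.sum_smul,
    Finset.sum_sub_distrib]
  rw [sub_eq_add_neg]
  congr 1
  · rw [Finset.sum_congr rfl fun c _ => Finset.sum_comm, Finset.sum_comm]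
    refine Finset.sum_congr rfl fun a _ => ?_
    rw [Finset.sum_comm]
    exact Finset.sum_congr rfl fun d _ => Finset.sum_congr rfl fun c _ => by rw [mul_comm]
  · rw [← Finset.sum_neg_distrib]
    refine Finset.sum_congr rfl fun c _ => ?_
    rw [Finset.sum_comm, ← Finset.sum_neg_distrib]
    refine Finset.sum_congr rfl fun a _ => ?_
    rw [← Finset.sum_neg_distrib]
    exact Finset.sum_congr rfl fun d _ => by rw [hAe d a, mul_neg, neg_smul]

end Representation

/-! ### Parallel Yang-Mills curvature -/

section FormOp

variable {n : ℕ} {V : Type*} [AddCommGroup V] [Module ℝ V]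

/-- The bilinear form with the components `f_{ab}`. -/
def formOp (f : Fin n → Fin n → V) : (Fin n → ℝ) →ₗ[ℝ] (Fin n → ℝ) →ₗ[ℝ] V :=
  LinearMap.mk₂ ℝ (fun u v => ∑ a, ∑ b, (u a * v b) • f a b)
    (by intros; simp [add_mul, add_smul, Finset.sum_add_distrib])
    (by intros; simp [mul_assoc, mul_smul, Finset.smul_sum])
    (by intros; simp [mul_add, add_smul, Finset.sum_add_distrib])
    (by
      intro c u v
      simp only [Pi.smul_apply, smul_eq_mul, mul_left_comm _ c, mul_smul c, Finset.smul_sum])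

theorem formOp_apply (f : Fin n → Fin n → V) (u v : Fin n → ℝ) :
    formOp f u v = ∑ a, ∑ b, (u a * v b) • f a b := rfl

theorem formOp_single (f : Fin n → Fin n → V) (a b : Fin n) :
    formOp f (Pi.single a 1) (Pi.single b 1) = f a b := by
  rw [formOp_apply, Finset.sum_eq_single a, Finset.sum_eq_single b] <;>
    simp +contextual [Pi.single_apply]

theorem formOp_add (f f' : Fin n → Fin n → V) (u v : Fin n → ℝ) :
    formOp (f + f') u v = formOp f u v + formOp f' u v := by
  simp [formOp_apply, Finset.sum_add_distrib]

theorem formOp_smul (c : ℝ) (f : Fin n → Fin n → V) (u v : Fin n → ℝ) :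
    formOp (c • f) u v = c • formOp f u v := by
  simp only [formOp_apply, Pi.smul_apply, Finset.smul_sum, smul_comm c]

/-- `formOp` as a bilinear map of the form and its first argument. -/
def formLeft (v : Fin n → ℝ) : (Fin n → Fin n → V) →ₗ[ℝ] (Fin n → ℝ) →ₗ[ℝ] V :=
  LinearMap.mk₂ ℝ (fun f u => formOp f u v) (fun f f' u => formOp_add f f' u v)
    (fun c f u => formOp_smul c f u v) (fun f u u' => by simp) (fun c f u => by simp)

/-- `formOp` as a bilinear map of the form and its second argument. -/
def formRight (u : Fin n → ℝ) : (Fin n → Fin n → V) →ₗ[ℝ] (Fin n → ℝ) →ₗ[ℝ] V :=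
  LinearMap.mk₂ ℝ (fun f v => formOp f u v) (fun f f' v => formOp_add f f' u v)
    (fun c f v => formOp_smul c f u v) (fun f v v' => by simp) (fun c f v => by simp)

theorem formLeft_apply (v u : Fin n → ℝ) (f : Fin n → Fin n → V) :
    formLeft v f u = formOp f u v := rfl

theorem formRight_apply (v u : Fin n → ℝ) (f : Fin n → Fin n → V) :
    formRight u f v = formOp f u v := rfl

theorem formOp_ext {f : Fin n → Fin n → V} {B : (Fin n → ℝ) →ₗ[ℝ] (Fin n → ℝ) →ₗ[ℝ] V}
    (h : ∀ a b, f a b = B (Pi.single a 1) (Pi.single b 1)) (u v : Fin n → ℝ) :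
    formOp f u v = B u v := by
  refine vec_induction (P := fun u => formOp f u v = B u v) (by simp)
    (fun x y hx hy => by simp [hx, hy]) (fun c x hx => by simp [hx]) (fun a => ?_) u
  exact vec_induction (P := fun v => formOp f (Pi.single a 1) v = B (Pi.single a 1) v) (by simp)
    (fun x y hx hy => by simp [hx, hy]) (fun c x hx => by simp [hx])
    (fun b => by rw [formOp_single, h]) v

end FormOp

theorem pd_formOp_const {n : ℕ} {V : Type*} [NormedAddCommGroup V] [NormedSpace ℝ V]
    [FiniteDimensional ℝ V] {y : Coord n} (μ : Fin n) {f : Coord n → Fin n → Fin n → V}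
    (hf : DifferentiableAt ℝ f y) (u v : Fin n → ℝ) :
    pd μ (fun z => formOp (f z) u v) y = formOp (pd μ f y) u v := by
  have h := pd_bilinear (formLeft v) μ hf (differentiableAt_const u)
  rw [pd_const, map_zero, add_zero] at h
  exact h

/-- A connection `𝒜` over a symmetric frame, whose curvature has the frame components `F`, is
parallel, and acts through the generators `X` outside of the flat directions. -/
structure ParallelGauge {n : ℕ} {κ 𝕜 : Type*} [Fintype κ] [RCLike 𝕜] (U : Set (Coord n))
    (θ : Coord n → Fin n → Fin n → ℝ) (Ω : Coord n → Fin n → Matrix (Fin n) (Fin n) ℝ)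
    (R : Fin n → Fin n → Fin n → Fin n → ℝ) (X : Fin n → Fin n → Matrix κ κ 𝕜)
    (𝒜 : Coord n → Fin n → Matrix κ κ 𝕜) (F : Coord n → Fin n → Fin n → Matrix κ κ 𝕜) :
    Prop where
  spanning : ∀ y ∈ U, ∀ x : Fin n → ℝ, ∃ c : Fin n → ℝ, x = ∑ μ, c μ • θ y μ
  smooth_conn : ∀ μ, ContDiffOn ℝ ∞ (fun y => 𝒜 y μ) U
  smooth_curv : ContDiffOn ℝ ∞ F U
  curv : ∀ y ∈ U, ∀ μ ν, pd μ (fun z => 𝒜 z ν) y - pd ν (fun z => 𝒜 z μ) y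
    + (𝒜 y μ * 𝒜 y ν - 𝒜 y ν * 𝒜 y μ) = formOp (F y) (θ y μ) (θ y ν)
  parallel : ∀ y ∈ U, ∀ μ u v, pd μ (fun z => formOp (F z) u v) y
    + (𝒜 y μ * formOp (F y) u v - formOp (F y) u v * 𝒜 y μ)
      = formOp (F y) (Ω y μ *ᵥ u) v + formOp (F y) u (Ω y μ *ᵥ v)
  antisymm : ∀ y ∈ U, ∀ u v, formOp (F y) u v = -formOp (F y) v u
  semisimple : ∀ y ∈ U, ∀ u v, formOp (F y) (semisimpleProj R *ᵥ u) (semisimpleProj R *ᵥ v)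
    = repMap X (curvOp R u v)

namespace ParallelGauge

variable {n p : ℕ} {U : Set (Coord n)} {θ : Coord n → Fin n → Fin n → ℝ}
  {Ω : Coord n → Fin n → Matrix (Fin n) (Fin n) ℝ} {R : Fin n → Fin n → Fin n → Fin n → ℝ}
  {E : Fin p → Matrix (Fin n) (Fin n) ℝ} {β : Matrix (Fin p) (Fin p) ℝ} {y : Coord n}
  {κ 𝕜 : Type*} [Fintype κ] [RCLike 𝕜] {X : Fin n → Fin n → Matrix κ κ 𝕜}
  {𝒜 : Coord n → Fin n → Matrix κ κ 𝕜} {F : Coord n → Fin n → Fin n → Matrix κ κ 𝕜}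

theorem diff_conn (G : ParallelGauge U θ Ω R X 𝒜 F) (hU : IsOpen U) (hy : y ∈ U) (μ : Fin n) :
    DifferentiableAt ℝ (fun z => 𝒜 z μ) y :=
  differentiableAt_of_smooth (G.smooth_conn μ) hU hy

theorem diff_curv (G : ParallelGauge U θ Ω R X 𝒜 F) (hU : IsOpen U) (hy : y ∈ U) :
    DifferentiableAt ℝ F y :=
  differentiableAt_of_smooth G.smooth_curv hU hy

theorem smooth_formOp (G : ParallelGauge U θ Ω R X 𝒜 F) (u v : Fin n → ℝ) :
    ContDiffOn ℝ ∞ (fun z => formOp (F z) u v) U :=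
  contDiffOn_bilinear (formLeft v) G.smooth_curv contDiffOn_const

theorem pd_formOp (G : ParallelGauge U θ Ω R X 𝒜 F) (hU : IsOpen U) (hy : y ∈ U) (μ : Fin n)
    (u v : Fin n → ℝ) : pd μ (fun z => formOp (F z) u v) y = formOp (pd μ F y) u v :=
  pd_formOp_const μ (G.diff_curv hU hy) u v

theorem pd_left (G : ParallelGauge U θ Ω R X 𝒜 F) (hU : IsOpen U) (hy : y ∈ U) (μ : Fin n)
    {u : Coord n → Fin n → ℝ} (hu : DifferentiableAt ℝ u y) (v : Fin n → ℝ) :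
    pd μ (fun z => formOp (F z) (u z) v) y
      = formOp (F y) (Ω y μ *ᵥ u y) v + formOp (F y) (u y) (Ω y μ *ᵥ v)
        - (𝒜 y μ * formOp (F y) (u y) v - formOp (F y) (u y) v * 𝒜 y μ)
        + formOp (F y) (pd μ u y) v := by
  have h : pd μ (fun z => formOp (F z) (u z) v) y = _ :=
    pd_bilinear (formLeft v) μ (G.diff_curv hU hy) hu
  rw [formLeft_apply, formLeft_apply, ← G.pd_formOp hU hy] at h
  rw [h, ← G.parallel y hy]
  abel

theorem pd_right (G : ParallelGauge U θ Ω R X 𝒜 F) (hU : IsOpen U) (hy : y ∈ U) (μ : Fin n)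
    (u : Fin n → ℝ) {v : Coord n → Fin n → ℝ} (hv : DifferentiableAt ℝ v y) :
    pd μ (fun z => formOp (F z) u (v z)) y
      = formOp (F y) (Ω y μ *ᵥ u) (v y) + formOp (F y) u (Ω y μ *ᵥ v y)
        - (𝒜 y μ * formOp (F y) u (v y) - formOp (F y) u (v y) * 𝒜 y μ)
        + formOp (F y) u (pd μ v y) := by
  have h : pd μ (fun z => formOp (F z) u (v z)) y = _ :=
    pd_bilinear (formRight u) μ (G.diff_curv hU hy) hv
  rw [formRight_apply, formRight_apply, ← G.pd_formOp hU hy] at h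
  rw [h, ← G.parallel y hy]
  abel

theorem ricci_coframe (h : SymmetricFrame U θ Ω R) (G : ParallelGauge U θ Ω R X 𝒜 F)
    (hy : y ∈ U) (μ ν : Fin n) (u v : Fin n → ℝ) :
    formOp (F y) (θ y μ) (θ y ν) * formOp (F y) u v
        - formOp (F y) u v * formOp (F y) (θ y μ) (θ y ν)
      = formOp (F y) (curvOp R (θ y μ) (θ y ν) *ᵥ u) v
        + formOp (F y) u (curvOp R (θ y μ) (θ y ν) *ᵥ v) := by
  have hU := h.isOpen
  have sΩ : ∀ (α : Fin n) (w : Fin n → ℝ), ContDiffOn ℝ ∞ (fun z => Ω z α *ᵥ w) U := fun α w =>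
    contDiffOn_mulVec (h.smooth_conn α) contDiffOn_const
  have dΩ : ∀ (α : Fin n) (w : Fin n → ℝ), DifferentiableAt ℝ (fun z => Ω z α *ᵥ w) y :=
    fun α w => differentiableAt_of_smooth (sΩ α w) hU hy
  have pΩ : ∀ (γ α : Fin n) (w : Fin n → ℝ),
      pd γ (fun z => Ω z α *ᵥ w) y = pd γ (fun z => Ω z α) y *ᵥ w := by
    intro γ α w
    rw [pd_mulVec γ (h.diff_conn hy α) (differentiableAt_const w), pd_const, Matrix.mulVec_zero,
      add_zero]
  have sH := G.smooth_formOp u v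
  have dH := differentiableAt_of_smooth sH hU hy
  have second : ∀ γ α : Fin n, pd γ (pd α (fun z => formOp (F z) u v)) y
      = pd γ (fun z => formOp (F z) (Ω z α *ᵥ u) v) y
        + pd γ (fun z => formOp (F z) u (Ω z α *ᵥ v)) y
        - (pd γ (fun z => 𝒜 z α) y * formOp (F y) u v
          + 𝒜 y α * pd γ (fun z => formOp (F z) u v) y
          - (pd γ (fun z => formOp (F z) u v) y * 𝒜 y α
            + formOp (F y) u v * pd γ (fun z => 𝒜 z α) y)) := by
    intro γ α
    have s1 : ContDiffOn ℝ ∞ (fun z => formOp (F z) (Ω z α *ᵥ u) v) U :=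
      contDiffOn_bilinear (formLeft v) G.smooth_curv (sΩ α u)
    have s2 : ContDiffOn ℝ ∞ (fun z => formOp (F z) u (Ω z α *ᵥ v)) U :=
      contDiffOn_bilinear (formRight u) G.smooth_curv (sΩ α v)
    have s3 := contDiffOn_mul (G.smooth_conn α) sH
    have s4 := contDiffOn_mul sH (G.smooth_conn α)
    rw [pd_congr hU hy (f := pd α (fun z => formOp (F z) u v))
      (fun z hz => eq_sub_of_add_eq (G.parallel z hz α u v)) γ,
      pd_sub γ (differentiableAt_of_smooth (s1.add s2) hU hy)
        (differentiableAt_of_smooth (s3.sub s4) hU hy),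
      pd_add γ (differentiableAt_of_smooth s1 hU hy) (differentiableAt_of_smooth s2 hU hy),
      pd_sub γ (differentiableAt_of_smooth s3 hU hy) (differentiableAt_of_smooth s4 hU hy),
      pd_mul γ (G.diff_conn hU hy α) dH, pd_mul γ dH (G.diff_conn hU hy α)]
  have hc := pd_comm sH hU hy μ ν
  have first : ∀ γ, pd γ (fun z => formOp (F z) u v) y = _ := fun γ =>
    eq_sub_of_add_eq (G.parallel y hy γ u v)
  rw [second, second, first, first, G.pd_left hU hy μ (dΩ ν u), G.pd_left hU hy ν (dΩ μ u),
    G.pd_right hU hy μ u (dΩ ν v), G.pd_right hU hy ν u (dΩ μ v), pΩ, pΩ, pΩ, pΩ] at hc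
  rw [← G.curv y hy, ← h.curv y hy]
  simp only [Matrix.add_mulVec, Matrix.sub_mulVec, ← Matrix.mulVec_mulVec, map_add, map_sub,
    LinearMap.add_apply, LinearMap.sub_apply]
  linear_combination (norm := noncomm_ring) -hc

theorem ricci (h : SymmetricFrame U θ Ω R) (G : ParallelGauge U θ Ω R X 𝒜 F)
    (hy : y ∈ U) (x z u v : Fin n → ℝ) :
    formOp (F y) x z * formOp (F y) u v - formOp (F y) u v * formOp (F y) x z
      = formOp (F y) (curvOp R x z *ᵥ u) v + formOp (F y) u (curvOp R x z *ᵥ v) := by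
  obtain ⟨c, rfl⟩ := G.spanning y hy x
  obtain ⟨d, rfl⟩ := G.spanning y hy z
  simp only [map_sum, LinearMap.sum_apply, map_smul, LinearMap.smul_apply, Matrix.sum_mulVec,
    Matrix.smul_mulVec, Finset.sum_mul, Finset.mul_sum, smul_mul_assoc, mul_smul_comm,
    Finset.smul_sum, ← Finset.sum_sub_distrib, ← Finset.sum_add_distrib, ← smul_sub, ← smul_add,
    G.ricci_coframe h hy]

theorem commute_of_flat (h : SymmetricFrame U θ Ω R) (hE : IsCurvDecomp R E β)
    (G : ParallelGauge U θ Ω R X 𝒜 F) (hy : y ∈ U) {w : Fin n → ℝ}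
    (hw : ∀ x z, curvOp R x z *ᵥ w = 0) (z u v : Fin n → ℝ) :
    formOp (F y) w z * formOp (F y) u v = formOp (F y) u v * formOp (F y) w z := by
  have hr := G.ricci h hy w z u v
  rw [curvOp_of_flat hE hw z, Matrix.zero_mulVec, Matrix.zero_mulVec, map_zero, map_zero,
    LinearMap.zero_apply, add_zero] at hr
  exact sub_eq_zero.1 hr

/-- The mixed components of the curvature vanish. -/
theorem mixed_eq_zero (h : SymmetricFrame U θ Ω R) (hE : IsCurvDecomp R E β)
    (G : ParallelGauge U θ Ω R X 𝒜 F) (hy : y ∈ U) {w : Fin n → ℝ}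
    (hw : ∀ x z, curvOp R x z *ᵥ w = 0) (u : Fin n → ℝ) :
    formOp (F y) (semisimpleProj R *ᵥ u) w = 0 := by
  refine map_semisimpleProj_eq_zero hE ((formOp (F y)).flip w) (fun x z v => ?_) u
  have hr := G.ricci h hy x z v w
  rw [hw, map_zero, add_zero, G.antisymm y hy v w, mul_neg, neg_mul,
    G.commute_of_flat h hE hy hw v x z, sub_self] at hr
  exact hr.symm

/-- The flat part of the curvature. -/
theorem eq_flat_add_rep (h : SymmetricFrame U θ Ω R) (hE : IsCurvDecomp R E β)
    (G : ParallelGauge U θ Ω R X 𝒜 F) (hy : y ∈ U) (u v : Fin n → ℝ) :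
    formOp (F y) u v = repMap X (curvOp R u v)
      + formOp (F y) (flatProj R *ᵥ u) (flatProj R *ᵥ v) := by
  have hs : ∀ w : Fin n → ℝ, w = semisimpleProj R *ᵥ w + flatProj R *ᵥ w := by
    intro w
    rw [← Matrix.add_mulVec, semisimpleProj, sub_add_cancel, Matrix.one_mulVec]
  have hq : ∀ w x z : Fin n → ℝ, curvOp R x z *ᵥ (flatProj R *ᵥ w) = 0 := fun w x z =>
    curvOp_mulVec_flatProj hE x z w
  conv_lhs => rw [hs u, hs v]
  simp only [map_add, LinearMap.add_apply, G.semisimple y hy, G.mixed_eq_zero h hE hy (hq v)]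
  rw [G.antisymm y hy (flatProj R *ᵥ u) (semisimpleProj R *ᵥ v),
    G.mixed_eq_zero h hE hy (hq u)]
  simp

theorem flat_commute_rep (h : SymmetricFrame U θ Ω R) (hE : IsCurvDecomp R E β)
    (G : ParallelGauge U θ Ω R X 𝒜 F) (hy : y ∈ U) {Q : Matrix (Fin n) (Fin n) ℝ}
    (hQ : Q ∈ holonomy E) (u v : Fin n → ℝ) :
    formOp (F y) (flatProj R *ᵥ u) (flatProj R *ᵥ v) * repMap X Q
      = repMap X Q * formOp (F y) (flatProj R *ᵥ u) (flatProj R *ᵥ v) := by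
  set B := formOp (F y) (flatProj R *ᵥ u) (flatProj R *ᵥ v)
  have hle : holonomy E ≤ LinearMap.ker
      ((mulBilin κ 𝕜 B - (mulBilin κ 𝕜).flip B).comp (repMap X)) := by
    refine holonomy_le hE fun x z => ?_
    rw [LinearMap.mem_ker]
    change B * repMap X (curvOp R x z) - repMap X (curvOp R x z) * B = 0
    rw [← G.semisimple y hy, sub_eq_zero]
    exact G.commute_of_flat h hE hy (fun x z => curvOp_mulVec_flatProj hE x z u) _ _ _
  exact sub_eq_zero.1 (LinearMap.mem_ker.1 (hle hQ))

/-- The generators are parallel along the holonomy algebra. -/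
theorem conn_commutator_rep (h : SymmetricFrame U θ Ω R) (hE : IsCurvDecomp R E β)
    (G : ParallelGauge U θ Ω R X 𝒜 F) (hy : y ∈ U) (μ : Fin n) {Q : Matrix (Fin n) (Fin n) ℝ}
    (hQ : Q ∈ holonomy E) :
    𝒜 y μ * repMap X Q - repMap X Q * 𝒜 y μ = repMap X (Ω y μ * Q - Q * Ω y μ) := by
  have hle : holonomy E ≤ LinearMap.ker
      ((mulBilin κ 𝕜 (𝒜 y μ) - (mulBilin κ 𝕜).flip (𝒜 y μ)).comp (repMap X)
        - (repMap X).comp (mulBilin (Fin n) ℝ (Ω y μ) - (mulBilin (Fin n) ℝ).flip (Ω y μ))) := by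
    refine holonomy_le hE fun u v => ?_
    rw [LinearMap.mem_ker]
    change 𝒜 y μ * repMap X (curvOp R u v) - repMap X (curvOp R u v) * 𝒜 y μ
      - repMap X (Ω y μ * curvOp R u v - curvOp R u v * Ω y μ) = 0
    have hΩ := h.conn_mem_holonomy hE hy μ
    have hp := G.parallel y hy μ (semisimpleProj R *ᵥ u) (semisimpleProj R *ᵥ v)
    have hcomm : ∀ w : Fin n → ℝ, Ω y μ *ᵥ (semisimpleProj R *ᵥ w)
        = semisimpleProj R *ᵥ (Ω y μ *ᵥ w) := by
      intro w
      rw [Matrix.mulVec_mulVec, Matrix.mulVec_mulVec, mul_semisimpleProj hE hΩ,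
        semisimpleProj_mul hE hΩ]
    rw [pd_congr h.isOpen hy (fun z hz => G.semisimple z hz u v), pd_const, zero_add, hcomm, hcomm,
      G.semisimple y hy, G.semisimple y hy, G.semisimple y hy] at hp
    rw [hp, h.parallel y hy μ u v, map_add, sub_self]
  exact sub_eq_zero.1 (LinearMap.mem_ker.1 (hle hQ))

/-- The flat part of the curvature is parallel. -/
theorem pd_flat (h : SymmetricFrame U θ Ω R) (hE : IsCurvDecomp R E β)
    (G : ParallelGauge U θ Ω R X 𝒜 F) (hy : y ∈ U) (μ : Fin n) (u v : Fin n → ℝ) :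
    pd μ (fun z => formOp (F z) (flatProj R *ᵥ u) (flatProj R *ᵥ v)) y
      + (𝒜 y μ * formOp (F y) (flatProj R *ᵥ u) (flatProj R *ᵥ v)
        - formOp (F y) (flatProj R *ᵥ u) (flatProj R *ᵥ v) * 𝒜 y μ) = 0 := by
  have hΩ := h.conn_mem_holonomy hE hy μ
  rw [G.parallel y hy, Matrix.mulVec_mulVec, Matrix.mulVec_mulVec, mul_flatProj hE hΩ,
    Matrix.zero_mulVec, Matrix.zero_mulVec, map_zero, map_zero, LinearMap.zero_apply, add_zero]

end ParallelGauge

/-! ### The Yang-Mills connection in the radially parallel frame -/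

theorem formOp_mulVec {n : ℕ} {V : Type*} [AddCommGroup V] [Module ℝ V]
    (M N : Matrix (Fin n) (Fin n) ℝ) (f : Fin n → Fin n → V) (u v : Fin n → ℝ) :
    formOp (fun a b => ∑ c, ∑ d, (M c a * N d b) • f c d) u v
      = formOp f (M *ᵥ u) (N *ᵥ v) := by
  refine formOp_ext (B := (formOp f).compl₁₂ M.mulVecLin N.mulVecLin) (fun a b => ?_) u v
  simp [formOp_apply]

section Gauge

variable {n p : ℕ} {U : Set (Coord n)} {g e : Coord n → Matrix (Fin n) (Fin n) ℝ} {y : Coord n}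
  {κ 𝕜 : Type*} [Fintype κ] [RCLike 𝕜] {X : Fin n → Fin n → Matrix κ κ 𝕜}
  {𝒜 : Coord n → Fin n → Matrix κ κ 𝕜}

theorem formOp_gaugeCurv (y : Coord n) (u v : Fin n → ℝ) :
    formOp (gaugeCurv e 𝒜 y) u v = formOp (gaugeCurvForm 𝒜 y) (e y *ᵥ u) (e y *ᵥ v) :=
  formOp_mulVec (e y) (e y) (gaugeCurvForm 𝒜 y) u v

theorem formOp_flatCurv (y : Coord n) (u v : Fin n → ℝ) :
    formOp (flatCurv g e 𝒜 y) u v = formOp (gaugeCurv e 𝒜 y) (flatProj (riemann g e y) *ᵥ u)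
      (flatProj (riemann g e y) *ᵥ v) :=
  formOp_mulVec _ _ (gaugeCurv e 𝒜 y) u v

theorem formOp_semisimpleCurv (y : Coord n) (u v : Fin n → ℝ) :
    formOp (semisimpleCurv g e 𝒜 y) u v = formOp (gaugeCurv e 𝒜 y)
      (semisimpleProj (riemann g e y) *ᵥ u) (semisimpleProj (riemann g e y) *ᵥ v) :=
  formOp_mulVec _ _ (gaugeCurv e 𝒜 y) u v

theorem gaugeCurvForm_eq (h𝒜 : ∀ μ, ContDiffOn ℝ ∞ (fun y => 𝒜 y μ) U) (hU : IsOpen U)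
    (hy : y ∈ U) (μ ν : Fin n) : gaugeCurvForm 𝒜 y μ ν
      = pd μ (fun z => 𝒜 z ν) y - pd ν (fun z => 𝒜 z μ) y
        + (𝒜 y μ * 𝒜 y ν - 𝒜 y ν * 𝒜 y μ) := by
  rw [gaugeCurvForm, pdMat_eq_pd μ (differentiableAt_of_smooth (h𝒜 ν) hU hy),
    pdMat_eq_pd ν (differentiableAt_of_smooth (h𝒜 μ) hU hy)]

theorem gaugeCurvForm_antisymm (μ ν : Fin n) :
    gaugeCurvForm 𝒜 y μ ν = -gaugeCurvForm 𝒜 y ν μ := by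
  simp only [gaugeCurvForm]
  abel

theorem smooth_gaugeCurv (h𝒜 : ∀ μ, ContDiffOn ℝ ∞ (fun y => 𝒜 y μ) U) (hU : IsOpen U)
    (he : IsRadialFrame g e U) : ContDiffOn ℝ ∞ (gaugeCurv e 𝒜) U := by
  have hc : ∀ μ ν, ContDiffOn ℝ ∞ (fun z => gaugeCurvForm 𝒜 z μ ν) U := fun μ ν =>
    (((contDiffOn_pd (h𝒜 ν) hU μ).sub (contDiffOn_pd (h𝒜 μ) hU ν)).add
      ((contDiffOn_mul (h𝒜 μ) (h𝒜 ν)).sub (contDiffOn_mul (h𝒜 ν) (h𝒜 μ)))).congr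
      fun z hz => gaugeCurvForm_eq h𝒜 hU hz μ ν
  exact contDiffOn_pi.2 fun a => contDiffOn_pi.2 fun b => ContDiffOn.sum fun μ _ =>
    ContDiffOn.sum fun ν _ => ((he.smooth μ a).mul (he.smooth ν b)).smul (hc μ ν)

theorem IsRadialFrame.parallelGauge (he : IsRadialFrame g e U) (hU : IsOpen U)
    (hs : StarConvex ℝ 0 U) (hR : ∀ y ∈ U, ∀ μ a b c d, covRiemann g e y μ a b c d = 0)
    (h𝒜 : ∀ μ i j, ContDiffOn ℝ ∞ (fun y => 𝒜 y μ i j) U)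
    (hF : ∀ y ∈ U, ∀ μ a b, covGaugeCurv g e 𝒜 y μ a b = 0)
    (hFX : ∀ y ∈ U, ∀ a b, semisimpleCurv g e 𝒜 y a b =
      (1 / 2 : ℝ) • ∑ c, ∑ d, riemann g e y c d a b • X c d) :
    ParallelGauge U (coframe e) (spinConn g e) (riemann g e 0) X 𝒜 (gaugeCurv e 𝒜) := by
  have sA : ∀ μ, ContDiffOn ℝ ∞ (fun y => 𝒜 y μ) U := fun μ => contDiffOn_matrix (h𝒜 μ)
  have sF := smooth_gaugeCurv sA hU he
  refine ⟨fun y hy x => ⟨e y *ᵥ x, ?_⟩, sA, sF, fun y hy μ ν => ?_, fun y hy μ u v => ?_,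
    fun y hy u v => ?_, fun y hy u v => ?_⟩
  · rw [sum_smul_coframe, Matrix.mulVec_mulVec, he.inv_mul hy, Matrix.one_mulVec]
  · have hc : ∀ α, e y *ᵥ coframe e y α = Pi.single α 1 := by
      intro α
      ext a
      rw [mulVec_coframe, he.mul_inv hy, Matrix.one_apply, Pi.single_apply]
    rw [formOp_gaugeCurv, hc, hc, formOp_single, gaugeCurvForm_eq sA hU hy]
  · have dF := differentiableAt_of_smooth sF hU hy
    have hp : ∀ a b, pd μ (gaugeCurv e 𝒜) y a b
        + (𝒜 y μ * gaugeCurv e 𝒜 y a b - gaugeCurv e 𝒜 y a b * 𝒜 y μ)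
        = formOp (gaugeCurv e 𝒜 y) (spinConn g e y μ *ᵥ Pi.single a 1) (Pi.single b 1)
          + formOp (gaugeCurv e 𝒜 y) (Pi.single a 1) (spinConn g e y μ *ᵥ Pi.single b 1) := by
      intro a b
      have d1 : DifferentiableAt ℝ (fun z => gaugeCurv e 𝒜 z a) y := differentiableAt_pi.1 dF a
      have d2 : DifferentiableAt ℝ (fun z => gaugeCurv e 𝒜 z a b) y := differentiableAt_pi.1 d1 b
      have h1 := hF y hy μ a b
      rw [covGaugeCurv, pdMat_eq_pd μ d2, sub_eq_zero] at h1
      rw [pd_pi_apply μ dF, pd_pi_apply μ d1, h1, Finset.sum_add_distrib]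
      have hcol : ∀ c : Fin n, spinConn g e y μ *ᵥ Pi.single c 1
          = ∑ f, spinConn g e y μ f c • (Pi.single f 1 : Fin n → ℝ) := by
        intro c
        ext a
        simp [Pi.single_apply]
      simp only [hcol, map_sum, LinearMap.sum_apply, map_smul, LinearMap.smul_apply, formOp_single]
    rw [pd_formOp_const μ dF]
    have h2 := formOp_ext (f := fun a b => pd μ (gaugeCurv e 𝒜) y a b
        + (𝒜 y μ * gaugeCurv e 𝒜 y a b - gaugeCurv e 𝒜 y a b * 𝒜 y μ))
      (B := (formOp (gaugeCurv e 𝒜 y)).compl₁₂ (spinConn g e y μ).mulVecLin LinearMap.id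
        + (formOp (gaugeCurv e 𝒜 y)).compl₁₂ LinearMap.id (spinConn g e y μ).mulVecLin)
      (fun a b => hp a b) u v
    refine Eq.trans ?_ h2
    simp only [formOp_apply, smul_add, smul_sub, Finset.sum_add_distrib, Finset.sum_sub_distrib,
      Finset.mul_sum, Finset.sum_mul, mul_smul_comm, smul_mul_assoc]
  · rw [formOp_gaugeCurv, formOp_gaugeCurv, formOp_apply, formOp_apply, Finset.sum_comm,
      ← Finset.sum_neg_distrib]
    refine Finset.sum_congr rfl fun a _ => ?_
    rw [← Finset.sum_neg_distrib]
    refine Finset.sum_congr rfl fun b _ => ?_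
    rw [gaugeCurvForm_antisymm b a, smul_neg, mul_comm]
  · rw [← he.riemann_const hU hs hR hy, ← formOp_semisimpleCurv]
    refine formOp_ext (B := (curvOp (riemann g e y)).compr₂ (repMap X)) (fun a b => ?_) u v
    rw [hFX y hy, LinearMap.compr₂_apply, repMap_apply]
    simp only [curvOp_single]

end Gauge

/-! ### Commutators of first order operators -/

section DirDeriv

variable {n : ℕ} {U : Set (Coord n)} {y : Coord n} {v w : Coord n → Fin n → ℝ}
  {V W Z : Type*} [NormedAddCommGroup V] [NormedSpace ℝ V] [NormedAddCommGroup W]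
  [NormedSpace ℝ W] [NormedAddCommGroup Z] [NormedSpace ℝ Z]

/-- The derivative `v^μ ∂_μ f` along a vector field. -/
def dirDeriv (v : Coord n → Fin n → ℝ) (f : Coord n → V) (y : Coord n) : V :=
  ∑ μ, v y μ • pd μ f y

theorem dirDeriv_congr {f h : Coord n → V} (hU : IsOpen U) (hy : y ∈ U)
    (hfh : ∀ z ∈ U, f z = h z) : dirDeriv v f y = dirDeriv v h y := by
  simp only [dirDeriv, pd_congr hU hy hfh]

theorem contDiffOn_dirDeriv {f : Coord n → V} (hv : ContDiffOn ℝ ∞ v U)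
    (hf : ContDiffOn ℝ ∞ f U) (hU : IsOpen U) : ContDiffOn ℝ ∞ (dirDeriv v f) U :=
  ContDiffOn.sum fun μ _ => (contDiffOn_pi.1 hv μ).smul (contDiffOn_pd hf hU μ)

theorem dirDeriv_add {f h : Coord n → V} (hf : DifferentiableAt ℝ f y)
    (hh : DifferentiableAt ℝ h y) :
    dirDeriv v (fun z => f z + h z) y = dirDeriv v f y + dirDeriv v h y := by
  simp only [dirDeriv, pd_add _ hf hh, smul_add, Finset.sum_add_distrib]

theorem dirDeriv_sum {α : Type*} (s : Finset α) {f : α → Coord n → V}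
    (hf : ∀ i ∈ s, DifferentiableAt ℝ (f i) y) :
    dirDeriv v (fun z => ∑ i ∈ s, f i z) y = ∑ i ∈ s, dirDeriv v (f i) y := by
  simp only [dirDeriv, pd_sum s _ hf, Finset.smul_sum]
  exact Finset.sum_comm


theorem dirDeriv_bilinear [FiniteDimensional ℝ V] [FiniteDimensional ℝ W]
    (B : V →ₗ[ℝ] W →ₗ[ℝ] Z) {f : Coord n → V} {h : Coord n → W}
    (hf : DifferentiableAt ℝ f y) (hh : DifferentiableAt ℝ h y) :
    dirDeriv v (fun z => B (f z) (h z)) y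
      = B (dirDeriv v f y) (h y) + B (f y) (dirDeriv v h y) := by
  simp only [dirDeriv, pd_bilinear B _ hf hh, map_sum, LinearMap.sum_apply, map_smul,
    LinearMap.smul_apply, smul_add, Finset.sum_add_distrib]

/-- The product rule for `w^μ f_μ`. -/
theorem dirDeriv_sum_smul [FiniteDimensional ℝ V] {f : Fin n → Coord n → V}
    (hw : DifferentiableAt ℝ w y)
    (hf : ∀ μ, DifferentiableAt ℝ (f μ) y) :
    dirDeriv v (fun z => ∑ μ, w z μ • f μ z) y
      = ∑ μ, dirDeriv v w y μ • f μ y + ∑ μ, w y μ • dirDeriv v (f μ) y := by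
  have hw' : ∀ μ, DifferentiableAt ℝ (fun z => w z μ) y := differentiableAt_pi.1 hw
  have h : ∀ μ, dirDeriv v (fun z => w z μ • f μ z) y
      = dirDeriv v (fun z => w z μ) y • f μ y + w y μ • dirDeriv v (f μ) y := fun μ =>
    dirDeriv_bilinear (smulBilin V) (hw' μ) (hf μ)
  rw [dirDeriv_sum _ (f := fun μ z => w z μ • f μ z) fun μ _ => (hw' μ).smul (hf μ)]
  simp only [h, Finset.sum_add_distrib]
  congr 1
  refine Finset.sum_congr rfl fun μ _ => ?_
  congr 1
  simp only [dirDeriv, Finset.sum_apply, Pi.smul_apply, pd_pi_apply _ hw]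

/-- The Lie bracket of vector fields, in coordinates. -/
def fieldBracket (v w : Coord n → Fin n → ℝ) (y : Coord n) : Fin n → ℝ :=
  dirDeriv v w y - dirDeriv w v y

theorem dirDeriv_commutator [FiniteDimensional ℝ V] {f : Coord n → V}
    (hf : ContDiffOn ℝ ∞ f U) (hU : IsOpen U)
    (hy : y ∈ U) (hv : ContDiffOn ℝ ∞ v U) (hw : ContDiffOn ℝ ∞ w U) :
    dirDeriv v (dirDeriv w f) y - dirDeriv w (dirDeriv v f) y
      = dirDeriv (fieldBracket v w) f y := by
  have hd : ∀ μ, DifferentiableAt ℝ (pd μ f) y := fun μ =>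
    differentiableAt_of_smooth (contDiffOn_pd hf hU μ) hU hy
  have h1 : ∀ {v w : Coord n → Fin n → ℝ}, ContDiffOn ℝ ∞ w U →
      dirDeriv v (dirDeriv w f) y = dirDeriv (dirDeriv v w) f y
        + ∑ μ, ∑ ν, (w y μ * v y ν) • pd ν (pd μ f) y := by
    intro v w hw
    refine (dirDeriv_sum_smul (differentiableAt_of_smooth hw hU hy) hd).trans ?_
    simp only [dirDeriv, Finset.smul_sum, smul_smul]
  have h2 : ∑ μ, ∑ ν, (w y μ * v y ν) • pd ν (pd μ f) y
      = ∑ μ, ∑ ν, (v y μ * w y ν) • pd ν (pd μ f) y := by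
    rw [Finset.sum_comm]
    refine Finset.sum_congr rfl fun μ _ => Finset.sum_congr rfl fun ν _ => ?_
    rw [pd_comm hf hU hy, mul_comm]
  rw [h1 hw, h1 hv, h2, add_sub_add_right_eq_sub]
  simp only [dirDeriv, fieldBracket, Pi.sub_apply, sub_smul, Finset.sum_sub_distrib]

end DirDeriv

section CovOp

variable {n : ℕ} {U : Set (Coord n)} {y : Coord n} {v w : Coord n → Fin n → ℝ}
  {ι 𝕜 : Type*} [Fintype ι] [RCLike 𝕜] {Γ : Coord n → Fin n → Matrix ι ι 𝕜}
  {S T : Coord n → Matrix ι ι 𝕜} {s : Coord n → ι → 𝕜}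

/-- The first order operator `v^μ (∂_μ + Γ_μ) + S`. -/
def covOp (Γ : Coord n → Fin n → Matrix ι ι 𝕜) (v : Coord n → Fin n → ℝ)
    (S : Coord n → Matrix ι ι 𝕜) (s : Coord n → ι → 𝕜) (y : Coord n) : ι → 𝕜 :=
  dirDeriv v s y + (∑ μ, v y μ • Γ y μ + S y) *ᵥ s y

theorem covOp_congr {s t : Coord n → ι → 𝕜} (hU : IsOpen U) (hy : y ∈ U)
    (hst : ∀ z ∈ U, s z = t z) : covOp Γ v S s y = covOp Γ v S t y := by
  rw [covOp, covOp, dirDeriv_congr hU hy hst, hst y hy]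

theorem covOp_sum_smul {α : Type*} (a : Finset α) (c : α → ℝ) {f : α → Coord n → ι → 𝕜}
    (hf : ∀ i ∈ a, DifferentiableAt ℝ (f i) y) :
    covOp Γ v S (fun z => ∑ i ∈ a, c i • f i z) y = ∑ i ∈ a, c i • covOp Γ v S (f i) y := by
  have h : ∀ i ∈ a, dirDeriv v (fun z => c i • f i z) y = c i • dirDeriv v (f i) y := by
    intro i hi
    have := pd_linear (y := y) (f := f i) (LinearMap.lsmul ℝ (ι → 𝕜) (c i))
    simp only [dirDeriv, Finset.smul_sum, smul_comm (c i)]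
    exact Finset.sum_congr rfl fun μ _ => congrArg _ (this μ (hf i hi))
  simp only [covOp]
  rw [dirDeriv_sum _ (f := fun i z => c i • f i z) fun i hi => (hf i hi).const_smul (c i),
    Finset.sum_congr rfl h]
  simp only [smul_add, Finset.sum_add_distrib, Matrix.mulVec_sum, Matrix.mulVec_smul]

theorem contDiffOn_potential (hΓ : ∀ μ, ContDiffOn ℝ ∞ (fun z => Γ z μ) U)
    (hv : ContDiffOn ℝ ∞ v U) (hS : ContDiffOn ℝ ∞ S U) :
    ContDiffOn ℝ ∞ (fun z => ∑ μ, v z μ • Γ z μ + S z) U :=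
  (ContDiffOn.sum fun μ _ => (contDiffOn_pi.1 hv μ).smul (hΓ μ)).add hS

theorem contDiffOn_covOp (hU : IsOpen U) (hΓ : ∀ μ, ContDiffOn ℝ ∞ (fun z => Γ z μ) U)
    (hv : ContDiffOn ℝ ∞ v U) (hS : ContDiffOn ℝ ∞ S U) (hs : ContDiffOn ℝ ∞ s U) :
    ContDiffOn ℝ ∞ (covOp Γ v S s) U :=
  (contDiffOn_dirDeriv hv hs hU).add (contDiffOn_mulVec (contDiffOn_potential hΓ hv hS) hs)

theorem covOp_comp (hU : IsOpen U) (hy : y ∈ U) (hΓ : ∀ μ, ContDiffOn ℝ ∞ (fun z => Γ z μ) U)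
    (hw : ContDiffOn ℝ ∞ w U) (hT : ContDiffOn ℝ ∞ T U) (hs : ContDiffOn ℝ ∞ s U) :
    covOp Γ v S (covOp Γ w T s) y = dirDeriv v (dirDeriv w s) y
      + (∑ μ, dirDeriv v w y μ • Γ y μ + ∑ μ, w y μ • dirDeriv v (fun z => Γ z μ) y
          + dirDeriv v T y) *ᵥ s y
      + (∑ μ, w y μ • Γ y μ + T y) *ᵥ dirDeriv v s y
      + (∑ μ, v y μ • Γ y μ + S y) *ᵥ dirDeriv w s y
      + ((∑ μ, v y μ • Γ y μ + S y) * (∑ μ, w y μ • Γ y μ + T y)) *ᵥ s y := by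
  have sP := contDiffOn_potential hΓ hw hT
  have h1 : dirDeriv v (covOp Γ w T s) y = _ :=
    dirDeriv_add (v := v) (differentiableAt_of_smooth (contDiffOn_dirDeriv hw hs hU) hU hy)
      (differentiableAt_of_smooth (contDiffOn_mulVec sP hs) hU hy)
  have h2 : dirDeriv v (fun z => (∑ μ, w z μ • Γ z μ + T z) *ᵥ s z) y = _ :=
    dirDeriv_bilinear (v := v) (mulVecBilin ι 𝕜) (differentiableAt_of_smooth sP hU hy)
      (differentiableAt_of_smooth hs hU hy)
  have h3 : dirDeriv v (fun z => ∑ μ, w z μ • Γ z μ + T z) y = _ :=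
    dirDeriv_add (v := v) (differentiableAt_of_smooth
      (ContDiffOn.sum fun μ _ => (contDiffOn_pi.1 hw μ).smul (hΓ μ)) hU hy)
      (differentiableAt_of_smooth hT hU hy)
  rw [dirDeriv_sum_smul (differentiableAt_of_smooth hw hU hy)
    fun μ => differentiableAt_of_smooth (hΓ μ) hU hy] at h3
  rw [covOp, h1, h2, h3, covOp, Matrix.mulVec_add, Matrix.mulVec_mulVec]
  simp only [mulVecBilin, LinearMap.mk₂_apply]
  abel

/-- The commutator of two first order operators. -/
theorem covOp_commutator (hU : IsOpen U) (hy : y ∈ U)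
    (hΓ : ∀ μ, ContDiffOn ℝ ∞ (fun z => Γ z μ) U) (hv : ContDiffOn ℝ ∞ v U)
    (hw : ContDiffOn ℝ ∞ w U) (hS : ContDiffOn ℝ ∞ S U) (hT : ContDiffOn ℝ ∞ T U)
    (hs : ContDiffOn ℝ ∞ s U) :
    covOp Γ v S (covOp Γ w T s) y - covOp Γ w T (covOp Γ v S s) y
      = dirDeriv (fieldBracket v w) s y + (∑ μ, fieldBracket v w y μ • Γ y μ
        + ∑ ν, ∑ μ, (v y ν * w y μ) • (pd ν (fun z => Γ z μ) y - pd μ (fun z => Γ z ν) y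
          + (Γ y ν * Γ y μ - Γ y μ * Γ y ν))
        + ∑ ν, v y ν • (pd ν T y + (Γ y ν * T y - T y * Γ y ν))
        - ∑ ν, w y ν • (pd ν S y + (Γ y ν * S y - S y * Γ y ν))
        + (S y * T y - T y * S y)) *ᵥ s y := by
  rw [covOp_comp hU hy hΓ hw hT hs, covOp_comp hU hy hΓ hv hS hs,
    ← dirDeriv_commutator hs hU hy hv hw]
  have e1 : ∑ ν, ∑ μ, (v y ν * w y μ) • (pd ν (fun z => Γ z μ) y - pd μ (fun z => Γ z ν) y
      + (Γ y ν * Γ y μ - Γ y μ * Γ y ν))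
      = ∑ μ, w y μ • dirDeriv v (fun z => Γ z μ) y - ∑ μ, v y μ • dirDeriv w (fun z => Γ z μ) y
        + ((∑ μ, v y μ • Γ y μ) * (∑ μ, w y μ • Γ y μ)
          - (∑ μ, w y μ • Γ y μ) * (∑ μ, v y μ • Γ y μ)) := by
    simp only [smul_add, smul_sub, Finset.sum_add_distrib, Finset.sum_sub_distrib, dirDeriv,
      Finset.smul_sum, smul_smul, Finset.sum_mul_sum, smul_mul_smul_comm]
    congr 2
    · rw [Finset.sum_comm]
      simp only [mul_comm]
    · rw [Finset.sum_comm]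
      simp only [mul_comm]
  have e2 : ∀ (v : Coord n → Fin n → ℝ) (T : Coord n → Matrix ι ι 𝕜),
      ∑ ν, v y ν • (pd ν T y + (Γ y ν * T y - T y * Γ y ν))
      = dirDeriv v T y + ((∑ ν, v y ν • Γ y ν) * T y - T y * ∑ ν, v y ν • Γ y ν) := by
    intro v T
    simp only [smul_add, smul_sub, Finset.sum_add_distrib, Finset.sum_sub_distrib, dirDeriv,
      Finset.sum_mul, Finset.mul_sum, smul_mul_assoc, mul_smul_comm]
  rw [e1, e2, e2]
  simp only [fieldBracket, Pi.sub_apply, sub_smul, Finset.sum_sub_distrib]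
  generalize dirDeriv v s y = a1
  simp only [Matrix.add_mulVec, Matrix.sub_mulVec, add_mul, mul_add]
  abel

end CovOp

/-! ### The twisted connection and the twisted Lie derivatives in coordinates -/

section Kronecker

variable {n : ℕ} {ι κ 𝕜 : Type*} [RCLike 𝕜]

/-- The action `M ↦ M ⊗ 1` on the first tensor factor. -/
def leftMap (ι κ 𝕜 : Type*) [DecidableEq κ] [RCLike 𝕜] :
    Matrix ι ι 𝕜 →ₗ[ℝ] Matrix (ι × κ) (ι × κ) 𝕜 where
  toFun M := M ⊗ₖ (1 : Matrix κ κ 𝕜)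
  map_add' M N := Matrix.add_kronecker M N 1
  map_smul' c M := Matrix.smul_kronecker c M 1

/-- The action `M ↦ 1 ⊗ M` on the second tensor factor. -/
def rightMap (ι κ 𝕜 : Type*) [DecidableEq ι] [RCLike 𝕜] :
    Matrix κ κ 𝕜 →ₗ[ℝ] Matrix (ι × κ) (ι × κ) 𝕜 where
  toFun M := (1 : Matrix ι ι 𝕜) ⊗ₖ M
  map_add' M N := Matrix.kronecker_add 1 M N
  map_smul' c M := Matrix.kronecker_smul c 1 M

theorem leftMap_mul [Fintype ι] [Fintype κ] [DecidableEq κ] (M N : Matrix ι ι 𝕜) :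
    leftMap ι κ 𝕜 (M * N) = leftMap ι κ 𝕜 M * leftMap ι κ 𝕜 N := by
  refine Eq.trans ?_ (Matrix.mul_kronecker_mul M N 1 1)
  rw [one_mul]
  rfl

theorem rightMap_mul [Fintype ι] [DecidableEq ι] [Fintype κ] (M N : Matrix κ κ 𝕜) :
    rightMap ι κ 𝕜 (M * N) = rightMap ι κ 𝕜 M * rightMap ι κ 𝕜 N := by
  refine Eq.trans ?_ (Matrix.mul_kronecker_mul 1 1 M N)
  rw [one_mul]
  rfl

theorem leftMap_mul_rightMap [Fintype ι] [DecidableEq ι] [Fintype κ] [DecidableEq κ]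
    (M : Matrix ι ι 𝕜) (N : Matrix κ κ 𝕜) :
    leftMap ι κ 𝕜 M * rightMap ι κ 𝕜 N = rightMap ι κ 𝕜 N * leftMap ι κ 𝕜 M := by
  refine (Matrix.mul_kronecker_mul M 1 1 N).symm.trans
    (Eq.trans ?_ (Matrix.mul_kronecker_mul 1 M N 1))
  rw [one_mul, mul_one, one_mul, mul_one]

/-- Commutators of operators that act on both tensor factors. -/
theorem leftMap_add_rightMap_commutator [Fintype ι] [DecidableEq ι] [Fintype κ] [DecidableEq κ]
    (M M' : Matrix ι ι 𝕜) (N N' : Matrix κ κ 𝕜) :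
    (leftMap ι κ 𝕜 M + rightMap ι κ 𝕜 N) * (leftMap ι κ 𝕜 M' + rightMap ι κ 𝕜 N')
      - (leftMap ι κ 𝕜 M' + rightMap ι κ 𝕜 N') * (leftMap ι κ 𝕜 M + rightMap ι κ 𝕜 N)
      = leftMap ι κ 𝕜 (M * M' - M' * M) + rightMap ι κ 𝕜 (N * N' - N' * N) := by
  simp only [map_sub, leftMap_mul, rightMap_mul, add_mul, mul_add, leftMap_mul_rightMap]
  abel

/-- The representation `A ↦ ½ A^{ab} G_{ab}`. -/
def genMap [DecidableEq ι] [DecidableEq κ] (S : Fin n → Fin n → Matrix ι ι 𝕜)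
    (X : Fin n → Fin n → Matrix κ κ 𝕜) :
    Matrix (Fin n) (Fin n) ℝ →ₗ[ℝ] Matrix (ι × κ) (ι × κ) 𝕜 :=
  leftMap ι κ 𝕜 ∘ₗ repMap S + rightMap ι κ 𝕜 ∘ₗ repMap X

theorem genMap_apply [DecidableEq ι] [DecidableEq κ] (S : Fin n → Fin n → Matrix ι ι 𝕜)
    (X : Fin n → Fin n → Matrix κ κ 𝕜)
    (A : Matrix (Fin n) (Fin n) ℝ) :
    genMap S X A = leftMap ι κ 𝕜 (repMap S A) + rightMap ι κ 𝕜 (repMap X A) := rfl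

theorem genMap_commutator [Fintype ι] [DecidableEq ι] [Fintype κ] [DecidableEq κ]
    {S : Fin n → Fin n → Matrix ι ι 𝕜} {X : Fin n → Fin n → Matrix κ κ 𝕜}
    (hS : IsSOGenerators S) (hX : IsSOGenerators X) {A : Matrix (Fin n) (Fin n) ℝ} (hA : Aᵀ = -A)
    (B : Matrix (Fin n) (Fin n) ℝ) :
    genMap S X A * genMap S X B - genMap S X B * genMap S X A = genMap S X (A * B - B * A) := by
  simp only [genMap_apply, leftMap_add_rightMap_commutator, repMap_commutator hS hA,
    repMap_commutator hX hA]

end Kronecker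

section TotalConn

variable {n p : ℕ} {U : Set (Coord n)} {θ : Coord n → Fin n → Fin n → ℝ}
  {Ω : Coord n → Fin n → Matrix (Fin n) (Fin n) ℝ} {R : Fin n → Fin n → Fin n → Fin n → ℝ}
  {E : Fin p → Matrix (Fin n) (Fin n) ℝ} {β : Matrix (Fin p) (Fin p) ℝ} {y : Coord n}
  {ι κ 𝕜 : Type*} [Fintype ι] [DecidableEq ι] [Fintype κ] [DecidableEq κ] [RCLike 𝕜]
  {S : Fin n → Fin n → Matrix ι ι 𝕜} {X : Fin n → Fin n → Matrix κ κ 𝕜}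
  {𝒜 : Coord n → Fin n → Matrix κ κ 𝕜} {F : Coord n → Fin n → Fin n → Matrix κ κ 𝕜}

/-- The Lie bracket of the vector fields of two Killing pairs. -/
theorem IsKillingPair.fieldBracket (h : SymmetricFrame U θ Ω R) {u u' : Coord n → Fin n → ℝ}
    {Q Q' : Coord n → Matrix (Fin n) (Fin n) ℝ} (hu : IsKillingPair U θ Ω R E u Q)
    (hu' : IsKillingPair U θ Ω R E u' Q') {v v' : Coord n → Fin n → ℝ}
    (hv : ContDiffOn ℝ ∞ v U) (hv' : ContDiffOn ℝ ∞ v' U)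
    (huv : ∀ z ∈ U, u z = ∑ μ, v z μ • θ z μ) (huv' : ∀ z ∈ U, u' z = ∑ μ, v' z μ • θ z μ)
    (hy : y ∈ U) :
    ∑ μ, fieldBracket v v' y μ • θ y μ = Q' y *ᵥ u y - Q y *ᵥ u' y := by
  have hU := h.isOpen
  have key : ∀ {u' : Coord n → Fin n → ℝ} {Q' : Coord n → Matrix (Fin n) (Fin n) ℝ}
      {v v' : Coord n → Fin n → ℝ}, IsKillingPair U θ Ω R E u' Q' → ContDiffOn ℝ ∞ v' U →
      (∀ z ∈ U, u' z = ∑ μ, v' z μ • θ z μ) →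
      ∑ μ, dirDeriv v v' y μ • θ y μ = Q' y *ᵥ (∑ ν, v y ν • θ y ν)
        - ∑ μ, ∑ ν, (v' y μ * v y ν) • (pd ν (fun z => θ z μ) y + Ω y ν *ᵥ θ y μ) := by
    intro u' Q' v v' hu' hv' huv'
    have h1 := dirDeriv_sum_smul (v := v) (f := fun μ z => θ z μ)
      (differentiableAt_of_smooth hv' hU hy) fun μ => h.diff_coframe hy μ
    rw [← dirDeriv_congr hU hy huv'] at h1
    rw [eq_sub_of_add_eq h1.symm]
    have h2 : dirDeriv v u' y = Q' y *ᵥ (∑ ν, v y ν • θ y ν)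
        - ∑ μ, ∑ ν, (v' y μ * v y ν) • (Ω y ν *ᵥ θ y μ) := by
      have h3 : ∀ ν, pd ν u' y = Q' y *ᵥ θ y ν - ∑ μ, v' y μ • (Ω y ν *ᵥ θ y μ) := by
        intro ν
        rw [eq_sub_of_add_eq (hu'.pd_vec y hy ν), huv' y hy]
        simp only [Matrix.mulVec_sum, Matrix.mulVec_smul]
      simp only [dirDeriv, h3, smul_sub, Finset.sum_sub_distrib, Matrix.mulVec_sum,
        Matrix.mulVec_smul, Finset.smul_sum, smul_smul]
      congr 1
      rw [Finset.sum_comm]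
      simp only [mul_comm]
    rw [h2]
    simp only [dirDeriv, smul_add, Finset.sum_add_distrib, Finset.smul_sum, smul_smul]
    abel
  simp only [SymmetricBundle.fieldBracket, Pi.sub_apply, sub_smul, Finset.sum_sub_distrib]
  rw [key hu' hv' huv', key hu hv huv, ← huv y hy, ← huv' y hy]
  have h4 : ∑ μ, ∑ ν, (v' y μ * v y ν) • (pd ν (fun z => θ z μ) y + Ω y ν *ᵥ θ y μ)
      = ∑ μ, ∑ ν, (v y μ * v' y ν) • (pd ν (fun z => θ z μ) y + Ω y ν *ᵥ θ y μ) := by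
    rw [Finset.sum_comm]
    refine Finset.sum_congr rfl fun μ _ => Finset.sum_congr rfl fun ν _ => ?_
    rw [h.torsion y hy, mul_comm]
  rw [h4]
  abel

/-- The total connection form `½ ω_μ^{ab} Σ_{ab} ⊗ 1 + 1 ⊗ 𝒜_μ`. -/
def twistedConn (Ω : Coord n → Fin n → Matrix (Fin n) (Fin n) ℝ)
    (S : Fin n → Fin n → Matrix ι ι 𝕜) (𝒜 : Coord n → Fin n → Matrix κ κ 𝕜) (y : Coord n)
    (μ : Fin n) : Matrix (ι × κ) (ι × κ) 𝕜 :=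
  leftMap ι κ 𝕜 (repMap S (Ω y μ)) + rightMap ι κ 𝕜 (𝒜 y μ)

namespace ParallelGauge

theorem smooth_twistedConn (h : SymmetricFrame U θ Ω R) (G : ParallelGauge U θ Ω R X 𝒜 F)
    (μ : Fin n) : ContDiffOn ℝ ∞ (fun z => twistedConn Ω S 𝒜 z μ) U :=
  (contDiffOn_linear (leftMap ι κ 𝕜 ∘ₗ repMap S) (h.smooth_conn μ)).add
    (contDiffOn_linear (rightMap ι κ 𝕜) (G.smooth_conn μ))

theorem pd_twistedConn (h : SymmetricFrame U θ Ω R) (G : ParallelGauge U θ Ω R X 𝒜 F)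
    (hy : y ∈ U) (μ ν : Fin n) :
    pd ν (fun z => twistedConn Ω S 𝒜 z μ) y
      = leftMap ι κ 𝕜 (repMap S (pd ν (fun z => Ω z μ) y))
        + rightMap ι κ 𝕜 (pd ν (fun z => 𝒜 z μ) y) := by
  have d1 := h.diff_conn hy μ
  have d2 := G.diff_conn h.isOpen hy μ
  have h1 := pd_linear (leftMap ι κ 𝕜 ∘ₗ repMap S) ν d1
  have h2 := pd_linear (rightMap ι κ 𝕜) ν d2
  refine Eq.trans ?_ (congrArg₂ (· + ·) h1 h2)
  exact pd_add ν
    (differentiableAt_of_smooth (contDiffOn_linear (leftMap ι κ 𝕜 ∘ₗ repMap S) (h.smooth_conn μ))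
      h.isOpen hy)
    (differentiableAt_of_smooth (contDiffOn_linear (rightMap ι κ 𝕜) (G.smooth_conn μ)) h.isOpen hy)

/-- The curvature of the total connection. -/
theorem curv_twistedConn (h : SymmetricFrame U θ Ω R) (hE : IsCurvDecomp R E β)
    (G : ParallelGauge U θ Ω R X 𝒜 F) (hS : IsSOGenerators S) (hy : y ∈ U) (μ ν : Fin n) :
    pd ν (fun z => twistedConn Ω S 𝒜 z μ) y - pd μ (fun z => twistedConn Ω S 𝒜 z ν) y
      + (twistedConn Ω S 𝒜 y ν * twistedConn Ω S 𝒜 y μ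
        - twistedConn Ω S 𝒜 y μ * twistedConn Ω S 𝒜 y ν)
      = genMap S X (curvOp R (θ y ν) (θ y μ)) + rightMap ι κ 𝕜
        (formOp (F y) (flatProj R *ᵥ θ y ν) (flatProj R *ᵥ θ y μ)) := by
  have hΩ := transpose_of_mem_holonomy hE (h.conn_mem_holonomy hE hy ν)
  rw [G.pd_twistedConn h hy, G.pd_twistedConn h hy, twistedConn, twistedConn,
    leftMap_add_rightMap_commutator, repMap_commutator hS hΩ, genMap_apply, add_assoc, ← map_add,
    ← G.eq_flat_add_rep h hE hy, ← G.curv y hy, ← h.curv y hy]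
  simp only [map_add, map_sub]
  abel

/-- The covariant derivative of the operators of the holonomy algebra. -/
theorem pd_genMap (h : SymmetricFrame U θ Ω R) (hE : IsCurvDecomp R E β)
    (G : ParallelGauge U θ Ω R X 𝒜 F) (hS : IsSOGenerators S) {u : Coord n → Fin n → ℝ}
    {Q : Coord n → Matrix (Fin n) (Fin n) ℝ} (hu : IsKillingPair U θ Ω R E u Q) (hy : y ∈ U)
    (μ : Fin n) :
    pd μ (fun z => genMap S X (Q z)) y + (twistedConn Ω S 𝒜 y μ * genMap S X (Q y)
      - genMap S X (Q y) * twistedConn Ω S 𝒜 y μ) = genMap S X (curvOp R (θ y μ) (u y)) := by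
  have hΩ := transpose_of_mem_holonomy hE (h.conn_mem_holonomy hE hy μ)
  rw [pd_linear (genMap S X) μ (differentiableAt_of_smooth hu.smooth_mat h.isOpen hy),
    twistedConn, genMap_apply S X (Q y), leftMap_add_rightMap_commutator,
    repMap_commutator hS hΩ, G.conn_commutator_rep h hE hy μ (hu.mem_holonomy y hy),
    ← genMap_apply, ← map_add, hu.pd_mat y hy]

end ParallelGauge

end TotalConn

section LocalLie

variable {n p : ℕ} {U : Set (Coord n)} {g e : Coord n → Matrix (Fin n) (Fin n) ℝ} {y : Coord n}
  {E : Fin p → Matrix (Fin n) (Fin n) ℝ} {β : Matrix (Fin p) (Fin p) ℝ}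
  {ι κ 𝕜 : Type*} [Fintype ι] [Fintype κ] [RCLike 𝕜]
  {S : Fin n → Fin n → Matrix ι ι 𝕜} {X : Fin n → Fin n → Matrix κ κ 𝕜}
  {𝒜 : Coord n → Fin n → Matrix κ κ 𝕜} {s : Coord n → ι × κ → 𝕜}

/-- The local geometry of a twisted spin-tensor bundle with parallel curvature over a patch of a
locally symmetric space. -/
structure IsTwistedSymmetric (U : Set (Coord n)) (g e : Coord n → Matrix (Fin n) (Fin n) ℝ)
    (E : Fin p → Matrix (Fin n) (Fin n) ℝ) (β : Matrix (Fin p) (Fin p) ℝ)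
    (S : Fin n → Fin n → Matrix ι ι 𝕜) (X : Fin n → Fin n → Matrix κ κ 𝕜)
    (𝒜 : Coord n → Fin n → Matrix κ κ 𝕜) : Prop where
  radial : IsRadialFrame g e U
  frame : SymmetricFrame U (coframe e) (spinConn g e) (riemann g e 0)
  decomp : IsCurvDecomp (riemann g e 0) E β
  const : ∀ y ∈ U, riemann g e y = riemann g e 0
  gauge : ParallelGauge U (coframe e) (spinConn g e) (riemann g e 0) X 𝒜 (gaugeCurv e 𝒜)
  generators : IsSOGenerators S
  gauge_generators : IsSOGenerators X

namespace IsTwistedSymmetric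

theorem killingPair (H : IsTwistedSymmetric U g e E β S X 𝒜) (A : Fin n ⊕ Fin p) :
    IsKillingPair U (coframe e) (spinConn g e) (riemann g e 0) E
      (killVec (coframe e) (spinConn g e) E β A)
      (killMat (riemann g e 0) (coframe e) (spinConn g e) E β A) :=
  H.frame.isKillingPair H.decomp A

theorem smooth_killing (H : IsTwistedSymmetric U g e E β S X 𝒜) (A : Fin n ⊕ Fin p) :
    ContDiffOn ℝ ∞ (killing g e E β A) U :=
  (contDiffOn_mulVec H.radial.smooth_frame (H.killingPair A).smooth_vec).congr
    fun _ hz => killing_eq H.radial H.frame H.decomp hz A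

theorem killVec_eq (H : IsTwistedSymmetric U g e E β S X 𝒜) (hy : y ∈ U)
    (A : Fin n ⊕ Fin p) :
    killVec (coframe e) (spinConn g e) E β A y = ∑ μ, killing g e E β A y μ • coframe e y μ := by
  rw [sum_smul_coframe, killing_eq H.radial H.frame H.decomp hy, Matrix.mulVec_mulVec,
    H.radial.inv_mul hy, Matrix.one_mulVec]

theorem fieldBracket_killing (H : IsTwistedSymmetric U g e E β S X 𝒜)
    {F : Fin p → Fin p → Fin p → ℝ}
    (hF : ∀ i k, holonomyGen E β i * holonomyGen E β k - holonomyGen E β k * holonomyGen E β i =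
      ∑ j, F j i k • holonomyGen E β j) (hy : y ∈ U) (A B : Fin n ⊕ Fin p) :
    fieldBracket (killing g e E β A) (killing g e E β B) y
      = ∑ C, structConst E β F C A B • killing g e E β C y := by
  have h1 := IsKillingPair.fieldBracket H.frame (H.killingPair A) (H.killingPair B)
    (H.smooth_killing A) (H.smooth_killing B) (fun z hz => H.killVec_eq hz A)
    (fun z hz => H.killVec_eq hz B) hy
  rw [(H.frame.killing_bracket H.decomp hF A B hy).1, sum_smul_coframe] at h1
  have h2 := congrArg (e y *ᵥ ·) h1
  simp only [Matrix.mulVec_mulVec, H.radial.mul_inv hy, Matrix.one_mulVec, Matrix.mulVec_sum,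
    Matrix.mulVec_smul] at h2
  simp only [h2, killing_eq H.radial H.frame H.decomp hy]

theorem killingFlatCurv_eq [DecidableEq ι] (H : IsTwistedSymmetric U g e E β S X 𝒜) (hy : y ∈ U)
    (A B : Fin n ⊕ Fin p) :
    killingFlatCurv ι g e E β 𝒜 A B y = rightMap ι κ 𝕜 (formOp (gaugeCurv e 𝒜 y)
      (flatProj (riemann g e 0) *ᵥ killVec (coframe e) (spinConn g e) E β A y)
      (flatProj (riemann g e 0) *ᵥ killVec (coframe e) (spinConn g e) E β B y)) := by
  rw [← H.const y hy, ← formOp_flatCurv, formOp_apply]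
  simp only [← killingFrame_eq H.radial H.frame H.decomp hy]
  rfl

end IsTwistedSymmetric

variable [DecidableEq ι] [DecidableEq κ]

/-- The twisted Lie derivative `𝓛_A` in coordinates and a local frame. -/
def localLie (g e : Coord n → Matrix (Fin n) (Fin n) ℝ)
    (E : Fin p → Matrix (Fin n) (Fin n) ℝ) (β : Matrix (Fin p) (Fin p) ℝ)
    (S : Fin n → Fin n → Matrix ι ι 𝕜) (X : Fin n → Fin n → Matrix κ κ 𝕜)
    (𝒜 : Coord n → Fin n → Matrix κ κ 𝕜) (A : Fin n ⊕ Fin p) :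
    (Coord n → ι × κ → 𝕜) → Coord n → ι × κ → 𝕜 :=
  covOp (totalConn g e S 𝒜) (killing g e E β A) (lieEndo g e E β S X A)

namespace IsTwistedSymmetric

theorem lieEndo_eq (H : IsTwistedSymmetric U g e E β S X 𝒜) (hy : y ∈ U)
    (A : Fin n ⊕ Fin p) :
    lieEndo g e E β S X A y
      = -genMap S X (killMat (riemann g e 0) (coframe e) (spinConn g e) E β A y) := by
  have hQ := transpose_of_mem_holonomy H.decomp ((H.killingPair A).mem_holonomy y hy)
  rw [← map_neg, ← hQ, genMap_apply, repMap_apply, repMap_apply, map_smul, map_smul, ← smul_add,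
    lieEndo, Finset.sum_comm]
  congr 1
  simp only [map_sum, map_smul, ← Finset.sum_add_distrib, ← smul_add,
    killingDeriv_eq H.radial H.frame H.decomp hy]
  rfl

theorem smooth_lieEndo (H : IsTwistedSymmetric U g e E β S X 𝒜) (A : Fin n ⊕ Fin p) :
    ContDiffOn ℝ ∞ (lieEndo g e E β S X A) U :=
  (contDiffOn_linear (genMap S X) (H.killingPair A).smooth_mat).neg.congr
    fun _ hz => H.lieEndo_eq hz A

theorem smooth_totalConn (H : IsTwistedSymmetric U g e E β S X 𝒜)
    (μ : Fin n) : ContDiffOn ℝ ∞ (fun z => totalConn g e S 𝒜 z μ) U :=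
  H.gauge.smooth_twistedConn H.frame μ

theorem smooth_localLie (H : IsTwistedSymmetric U g e E β S X 𝒜)
    (A : Fin n ⊕ Fin p) (hs : ContDiffOn ℝ ∞ s U) :
    ContDiffOn ℝ ∞ (localLie g e E β S X 𝒜 A s) U :=
  contDiffOn_covOp H.frame.isOpen H.smooth_totalConn (H.smooth_killing A) (H.smooth_lieEndo A) hs

theorem pd_lieEndo (H : IsTwistedSymmetric U g e E β S X 𝒜) (hy : y ∈ U)
    (A : Fin n ⊕ Fin p) (μ : Fin n) :
    pd μ (lieEndo g e E β S X A) y + (totalConn g e S 𝒜 y μ * lieEndo g e E β S X A y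
      - lieEndo g e E β S X A y * totalConn g e S 𝒜 y μ)
      = -genMap S X (curvOp (riemann g e 0) (coframe e y μ)
        (killVec (coframe e) (spinConn g e) E β A y)) := by
  rw [← H.gauge.pd_genMap H.frame H.decomp H.generators (H.killingPair A) hy,
    pd_congr H.frame.isOpen hy (fun z hz => H.lieEndo_eq hz A), pd_neg, H.lieEndo_eq hy A]
  change _ + (twistedConn (spinConn g e) S 𝒜 y μ * _ - _ * twistedConn (spinConn g e) S 𝒜 y μ) = _
  rw [mul_neg, neg_mul]
  abel

/-- The commutation relations of the twisted Lie derivatives, in coordinates. -/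
theorem localLie_commutator (H : IsTwistedSymmetric U g e E β S X 𝒜)
    {F : Fin p → Fin p → Fin p → ℝ}
    (hF : ∀ i k, holonomyGen E β i * holonomyGen E β k - holonomyGen E β k * holonomyGen E β i =
      ∑ j, F j i k • holonomyGen E β j) (hy : y ∈ U) (hs : ContDiffOn ℝ ∞ s U)
    (A B : Fin n ⊕ Fin p) :
    localLie g e E β S X 𝒜 A (localLie g e E β S X 𝒜 B s) y
        - localLie g e E β S X 𝒜 B (localLie g e E β S X 𝒜 A s) y
      = ∑ C, structConst E β F C A B • localLie g e E β S X 𝒜 C s y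
        + killingFlatCurv ι g e E β 𝒜 A B y *ᵥ s y := by
  have hc := covOp_commutator H.frame.isOpen hy H.smooth_totalConn (H.smooth_killing A)
    (H.smooth_killing B) (H.smooth_lieEndo A) (H.smooth_lieEndo B) hs
  refine hc.trans ?_
  have hcurv : ∀ ν μ, pd ν (fun z => totalConn g e S 𝒜 z μ) y
      - pd μ (fun z => totalConn g e S 𝒜 z ν) y + (totalConn g e S 𝒜 y ν * totalConn g e S 𝒜 y μ
        - totalConn g e S 𝒜 y μ * totalConn g e S 𝒜 y ν) = _ := fun ν μ =>
    H.gauge.curv_twistedConn H.frame H.decomp H.generators hy μ ν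
  simp only [hcurv, H.pd_lieEndo hy]
  have hQ := transpose_of_mem_holonomy H.decomp ((H.killingPair A).mem_holonomy y hy)
  have e1 : ∑ ν, ∑ μ, (killing g e E β A y ν * killing g e E β B y μ) •
      (genMap S X (curvOp (riemann g e 0) (coframe e y ν) (coframe e y μ)) + rightMap ι κ 𝕜
        (formOp (gaugeCurv e 𝒜 y) (flatProj (riemann g e 0) *ᵥ coframe e y ν)
          (flatProj (riemann g e 0) *ᵥ coframe e y μ)))
      = genMap S X (curvOp (riemann g e 0) (killVec (coframe e) (spinConn g e) E β A y)
          (killVec (coframe e) (spinConn g e) E β B y))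
        + killingFlatCurv ι g e E β 𝒜 A B y := by
    rw [H.killingFlatCurv_eq hy, H.killVec_eq hy, H.killVec_eq hy]
    simp only [Matrix.mulVec_sum, Matrix.mulVec_smul, map_sum, map_smul, LinearMap.sum_apply,
      LinearMap.smul_apply, smul_add, Finset.sum_add_distrib, Finset.smul_sum, smul_smul]
    congr 1 <;>
    · rw [Finset.sum_comm]
      simp only [mul_comm]
  have e2 : ∀ A B : Fin n ⊕ Fin p, ∑ ν, killing g e E β A y ν • -genMap S X (curvOp (riemann g e 0)
      (coframe e y ν) (killVec (coframe e) (spinConn g e) E β B y))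
      = -genMap S X (curvOp (riemann g e 0) (killVec (coframe e) (spinConn g e) E β A y)
          (killVec (coframe e) (spinConn g e) E β B y)) := by
    intro A B
    rw [H.killVec_eq hy A]
    simp only [map_sum, map_smul, LinearMap.sum_apply, LinearMap.smul_apply, smul_neg,
      Finset.sum_neg_distrib]
  have e3 := (H.frame.killing_bracket H.decomp hF A B hy).2
  rw [sub_eq_iff_eq_add] at e3
  rw [e1, e2, e2, curvOp_antisymm H.decomp (killVec (coframe e) (spinConn g e) E β A y), e3,
    H.lieEndo_eq hy A, H.lieEndo_eq hy B, neg_mul_neg, neg_mul_neg,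
    genMap_commutator H.generators H.gauge_generators hQ]
  have e4 : ∀ C, localLie g e E β S X 𝒜 C s y = dirDeriv (killing g e E β C) s y
      + (∑ μ, killing g e E β C y μ • totalConn g e S 𝒜 y μ - genMap S X
        (killMat (riemann g e 0) (coframe e) (spinConn g e) E β C y)) *ᵥ s y := by
    intro C
    rw [localLie, covOp, H.lieEndo_eq hy, ← sub_eq_add_neg]
  have e5 : dirDeriv (fieldBracket (killing g e E β A) (killing g e E β B)) s y
      = ∑ C, structConst E β F C A B • dirDeriv (killing g e E β C) s y := by
    rw [dirDeriv, H.fieldBracket_killing hF hy]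
    simp only [Finset.sum_apply, Pi.smul_apply, smul_eq_mul, Finset.sum_smul, dirDeriv,
      Finset.smul_sum, smul_smul]
    exact Finset.sum_comm
  have e6 : ∑ μ, fieldBracket (killing g e E β A) (killing g e E β B) y μ • totalConn g e S 𝒜 y μ
      = ∑ C, structConst E β F C A B • ∑ μ, killing g e E β C y μ • totalConn g e S 𝒜 y μ := by
    rw [H.fieldBracket_killing hF hy]
    simp only [Finset.sum_apply, Pi.smul_apply, smul_eq_mul, Finset.sum_smul,
      Finset.smul_sum, smul_smul]
    exact Finset.sum_comm
  rw [e5, e6]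
  simp only [e4, smul_add, Finset.sum_add_distrib, ← Matrix.smul_mulVec, ← Matrix.sum_mulVec]
  rw [add_assoc (∑ C, structConst E β F C A B • dirDeriv (killing g e E β C) s y),
    ← Matrix.add_mulVec]
  congr 2
  simp only [map_add, map_sub, map_neg, map_sum, map_smul, smul_sub, Finset.sum_sub_distrib]
  abel

end IsTwistedSymmetric

end LocalLie

section FlatPart

variable {n p : ℕ} {U : Set (Coord n)} {g e : Coord n → Matrix (Fin n) (Fin n) ℝ} {y : Coord n}
  {E : Fin p → Matrix (Fin n) (Fin n) ℝ} {β : Matrix (Fin p) (Fin p) ℝ}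

/-- A parallel endomorphism which commutes with `S` commutes with `v^μ ∇_μ + S`. -/
theorem covOp_mulVec {ι 𝕜 : Type*} [Fintype ι] [RCLike 𝕜] {Γ : Coord n → Fin n → Matrix ι ι 𝕜}
    {v : Coord n → Fin n → ℝ} {S T : Coord n → Matrix ι ι 𝕜} {s : Coord n → ι → 𝕜}
    (hT : DifferentiableAt ℝ T y) (hs : DifferentiableAt ℝ s y)
    (hΓ : ∀ μ, pd μ T y + (Γ y μ * T y - T y * Γ y μ) = 0) (hS : S y * T y = T y * S y) :
    covOp Γ v S (fun z => T z *ᵥ s z) y = T y *ᵥ covOp Γ v S s y := by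
  have h1 : dirDeriv v (fun z => T z *ᵥ s z) y = dirDeriv v T y *ᵥ s y + T y *ᵥ dirDeriv v s y :=
    dirDeriv_bilinear (mulVecBilin ι 𝕜) hT hs
  have h2 : dirDeriv v T y + ((∑ μ, v y μ • Γ y μ) * T y - T y * ∑ μ, v y μ • Γ y μ) = 0 := by
    have h3 : ∑ μ, v y μ • (pd μ T y + (Γ y μ * T y - T y * Γ y μ)) = 0 := by simp [hΓ]
    rw [← h3]
    simp only [smul_add, smul_sub, Finset.sum_add_distrib, Finset.sum_sub_distrib, dirDeriv,
      Finset.sum_mul, Finset.mul_sum, smul_mul_assoc, mul_smul_comm]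
  have h4 : dirDeriv v T y + (∑ μ, v y μ • Γ y μ + S y) * T y
      = T y * (∑ μ, v y μ • Γ y μ + S y) := by
    rw [add_mul, mul_add, hS]
    linear_combination (norm := abel) h2
  rw [covOp, h1, Matrix.mulVec_mulVec, covOp, Matrix.mulVec_add, Matrix.mulVec_mulVec, ← h4,
    Matrix.add_mulVec]
  abel

/-- The flat components of the vector of a Killing pair are constant. -/
theorem IsKillingPair.flatProj_mulVec_eq {θ : Coord n → Fin n → Fin n → ℝ}
    {Ω : Coord n → Fin n → Matrix (Fin n) (Fin n) ℝ} {R : Fin n → Fin n → Fin n → Fin n → ℝ}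
    {u : Coord n → Fin n → ℝ} {Q : Coord n → Matrix (Fin n) (Fin n) ℝ}
    (h : SymmetricFrame U θ Ω R) (hE : IsCurvDecomp R E β) (hu : IsKillingPair U θ Ω R E u Q)
    (hy : y ∈ U) : flatProj R *ᵥ u y = flatProj R *ᵥ u 0 := by
  rw [← sub_eq_zero]
  have hs : ContDiffOn ℝ ∞ (fun z => flatProj R *ᵥ u z) U :=
    contDiffOn_mulVec contDiffOn_const hu.smooth_vec
  have hd : ∀ z ∈ U, DifferentiableAt ℝ (fun z => flatProj R *ᵥ u z) z := fun z hz =>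
    differentiableAt_of_smooth hs h.isOpen hz
  refine radial_eq_zero h.starConvex (Z := fun z => flatProj R *ᵥ u z - flatProj R *ᵥ u 0)
    (fun z hz => (hd z hz).sub_const _) 0 (fun z hz => ?_) (sub_self _) y hy
  rw [euler_sub (hd z hz) (differentiableAt_const _), euler_const, sub_zero, euler_eq_sum_pd,
    LinearMap.zero_apply, LinearMap.zero_apply]
  refine Finset.sum_eq_zero fun μ _ => ?_
  rw [pd_mulVec μ (differentiableAt_const _)
    (differentiableAt_of_smooth hu.smooth_vec h.isOpen hz), pd_const, Matrix.zero_mulVec, zero_add,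
    eq_sub_of_add_eq (hu.pd_vec z hz μ), Matrix.mulVec_sub, Matrix.mulVec_mulVec,
    Matrix.mulVec_mulVec, flatProj_mul hE (hu.mem_holonomy z hz),
    flatProj_mul hE (h.conn_mem_holonomy hE hz μ), Matrix.zero_mulVec, Matrix.zero_mulVec,
    sub_zero, smul_zero]

variable {ι κ 𝕜 : Type*} [Fintype ι] [DecidableEq ι] [Fintype κ] [RCLike 𝕜]
  {S : Fin n → Fin n → Matrix ι ι 𝕜} {X : Fin n → Fin n → Matrix κ κ 𝕜}
  {𝒜 : Coord n → Fin n → Matrix κ κ 𝕜} {s : Coord n → ι × κ → 𝕜}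

namespace IsTwistedSymmetric

theorem smooth_killingFlatCurv (H : IsTwistedSymmetric U g e E β S X 𝒜) (A B : Fin n ⊕ Fin p) :
    ContDiffOn ℝ ∞ (killingFlatCurv ι g e E β 𝒜 A B) U := by
  refine (contDiffOn_linear (rightMap ι κ 𝕜) (H.gauge.smooth_formOp
    (flatProj (riemann g e 0) *ᵥ killVec (coframe e) (spinConn g e) E β A 0)
    (flatProj (riemann g e 0) *ᵥ killVec (coframe e) (spinConn g e) E β B 0))).congr
      fun z hz => ?_
  rw [H.killingFlatCurv_eq hz, (H.killingPair A).flatProj_mulVec_eq H.frame H.decomp hz,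
    (H.killingPair B).flatProj_mulVec_eq H.frame H.decomp hz]

variable [DecidableEq κ]

/-- The flat part of the curvature commutes with the twisted Lie derivatives. -/
theorem localLie_killingFlatCurv (H : IsTwistedSymmetric U g e E β S X 𝒜) (hy : y ∈ U)
    (hs : ContDiffOn ℝ ∞ s U) (A B C : Fin n ⊕ Fin p) :
    localLie g e E β S X 𝒜 C (fun z => killingFlatCurv ι g e E β 𝒜 A B z *ᵥ s z) y
      = killingFlatCurv ι g e E β 𝒜 A B y *ᵥ localLie g e E β S X 𝒜 C s y := by
  have hU := H.frame.isOpen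
  set u := killVec (coframe e) (spinConn g e) E β A 0
  set v := killVec (coframe e) (spinConn g e) E β B 0
  set q := flatProj (riemann g e 0)
  have heq : ∀ z ∈ U, killingFlatCurv ι g e E β 𝒜 A B z
      = rightMap ι κ 𝕜 (formOp (gaugeCurv e 𝒜 z) (q *ᵥ u) (q *ᵥ v)) := by
    intro z hz
    rw [H.killingFlatCurv_eq hz, (H.killingPair A).flatProj_mulVec_eq H.frame H.decomp hz,
      (H.killingPair B).flatProj_mulVec_eq H.frame H.decomp hz]
  refine covOp_mulVec (differentiableAt_of_smooth (H.smooth_killingFlatCurv A B) hU hy)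
    (differentiableAt_of_smooth hs hU hy) (fun μ => ?_) ?_
  · have h1 : totalConn g e S 𝒜 y μ
        = leftMap ι κ 𝕜 (repMap S (spinConn g e y μ)) + rightMap ι κ 𝕜 (𝒜 y μ) := rfl
    have h2 := leftMap_add_rightMap_commutator (repMap S (spinConn g e y μ)) 0 (𝒜 y μ)
      (formOp (gaugeCurv e 𝒜 y) (q *ᵥ u) (q *ᵥ v))
    rw [map_zero, zero_add, mul_zero, zero_mul, sub_zero, map_zero, zero_add] at h2
    rw [pd_congr hU hy heq, heq y hy, h1, h2, pd_linear (rightMap ι κ 𝕜) μ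
      (differentiableAt_of_smooth (H.gauge.smooth_formOp _ _) hU hy), ← map_add,
      H.gauge.pd_flat H.frame H.decomp hy, map_zero]
  · rw [H.lieEndo_eq hy, heq y hy, genMap_apply, neg_mul, mul_neg, add_mul, mul_add,
      leftMap_mul_rightMap, ← rightMap_mul, ← rightMap_mul,
      H.gauge.flat_commute_rep H.frame H.decomp hy ((H.killingPair C).mem_holonomy y hy)]

theorem localLie_congr (H : IsTwistedSymmetric U g e E β S X 𝒜) (hy : y ∈ U)
    {s t : Coord n → ι × κ → 𝕜} (hst : ∀ z ∈ U, s z = t z) (A : Fin n ⊕ Fin p) :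
    localLie g e E β S X 𝒜 A s y = localLie g e E β S X 𝒜 A t y :=
  covOp_congr H.frame.isOpen hy hst

theorem localLie_sum_smul (H : IsTwistedSymmetric U g e E β S X 𝒜) (hy : y ∈ U)
    {α : Type*} [Fintype α] (c : α → ℝ) {f : α → Coord n → ι × κ → 𝕜}
    (hf : ∀ i, ContDiffOn ℝ ∞ (f i) U) (A : Fin n ⊕ Fin p) :
    localLie g e E β S X 𝒜 A (fun z => ∑ i, c i • f i z) y
      = ∑ i, c i • localLie g e E β S X 𝒜 A (f i) y :=
  covOp_sum_smul _ c fun i _ => differentiableAt_of_smooth (hf i) H.frame.isOpen hy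

theorem localLie_comp_commutator (H : IsTwistedSymmetric U g e E β S X 𝒜)
    {F : Fin p → Fin p → Fin p → ℝ}
    (hF : ∀ i k, holonomyGen E β i * holonomyGen E β k - holonomyGen E β k * holonomyGen E β i =
      ∑ j, F j i k • holonomyGen E β j) (hy : y ∈ U) (hs : ContDiffOn ℝ ∞ s U)
    (A B C : Fin n ⊕ Fin p) :
    localLie g e E β S X 𝒜 A (localLie g e E β S X 𝒜 B (localLie g e E β S X 𝒜 C s)) y
        - localLie g e E β S X 𝒜 B (localLie g e E β S X 𝒜 C (localLie g e E β S X 𝒜 A s)) y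
      = ∑ D, structConst E β F D A B •
          localLie g e E β S X 𝒜 D (localLie g e E β S X 𝒜 C s) y
        + ∑ D, structConst E β F D A C •
          localLie g e E β S X 𝒜 B (localLie g e E β S X 𝒜 D s) y
        + (killingFlatCurv ι g e E β 𝒜 A B y *ᵥ localLie g e E β S X 𝒜 C s y
          + killingFlatCurv ι g e E β 𝒜 A C y *ᵥ localLie g e E β S X 𝒜 B s y) := by
  have hU := H.frame.isOpen
  have sL := fun (A : Fin n ⊕ Fin p) => H.smooth_localLie A hs
  have h1 := H.localLie_commutator hF hy (sL C) A B
  have sT : ContDiffOn ℝ ∞ (fun z => ∑ D, structConst E β F D A C •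
      localLie g e E β S X 𝒜 D s z) U :=
    ContDiffOn.sum fun D _ => (sL D).const_smul _
  have sB : ContDiffOn ℝ ∞ (fun z => killingFlatCurv ι g e E β 𝒜 A C z *ᵥ s z) U :=
    contDiffOn_mulVec (H.smooth_killingFlatCurv A C) hs
  have sCA := H.smooth_localLie C (sL A)
  have h2 : localLie g e E β S X 𝒜 B (localLie g e E β S X 𝒜 A (localLie g e E β S X 𝒜 C s)) y
      = localLie g e E β S X 𝒜 B (localLie g e E β S X 𝒜 C (localLie g e E β S X 𝒜 A s)) y
        + (∑ D, structConst E β F D A C • localLie g e E β S X 𝒜 B (localLie g e E β S X 𝒜 D s) y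
          + killingFlatCurv ι g e E β 𝒜 A C y *ᵥ localLie g e E β S X 𝒜 B s y) := by
    have h3 := H.localLie_sum_smul hy (A := B) (fun _ : Fin 3 => (1 : ℝ))
      (f := ![localLie g e E β S X 𝒜 C (localLie g e E β S X 𝒜 A s),
        fun z => ∑ D, structConst E β F D A C • localLie g e E β S X 𝒜 D s z,
        fun z => killingFlatCurv ι g e E β 𝒜 A C z *ᵥ s z])
      (fun i => by fin_cases i <;> [exact sCA; exact sT; exact sB])
    simp only [Fin.sum_univ_three, one_smul, Matrix.cons_val] at h3
    rw [H.localLie_congr hy (t := _) (fun z hz => ?_) B]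
    · rw [h3, H.localLie_sum_smul hy _ sL, H.localLie_killingFlatCurv hy hs, add_assoc]
    · rw [add_assoc, ← H.localLie_commutator hF hz hs A C]
      abel
  rw [h2] at h1
  linear_combination (norm := abel) h1

/-- The commutator with the quadratic operator `𝓛² = γ^{BC} 𝓛_B 𝓛_C`, in coordinates. -/
theorem localLie_commutator_sq (H : IsTwistedSymmetric U g e E β S X 𝒜)
    {F : Fin p → Fin p → Fin p → ℝ}
    (hF : ∀ i k, holonomyGen E β i * holonomyGen E β k - holonomyGen E β k * holonomyGen E β i =
      ∑ j, F j i k • holonomyGen E β j) (hy : y ∈ U) (hs : ContDiffOn ℝ ∞ s U)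
    (A : Fin n ⊕ Fin p) :
    localLie g e E β S X 𝒜 A (fun z => ∑ B, ∑ C, (gammaMat n β)⁻¹ B C •
        localLie g e E β S X 𝒜 B (localLie g e E β S X 𝒜 C s) z) y
      - ∑ B, ∑ C, (gammaMat n β)⁻¹ B C •
        localLie g e E β S X 𝒜 B (localLie g e E β S X 𝒜 C (localLie g e E β S X 𝒜 A s)) y
      = (2 : ℝ) • ∑ B, ∑ C, (gammaMat n β)⁻¹ B C •
        (killingFlatCurv ι g e E β 𝒜 A B y *ᵥ localLie g e E β S X 𝒜 C s y) := by
  set γ := (gammaMat n β)⁻¹ with hγ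
  have hsymm : ∀ B C, γ B C = γ C B := by
    have h1 : γᵀ = γ := by
      rw [hγ, Matrix.transpose_nonsing_inv, gammaMat, Matrix.fromBlocks_transpose]
      rw [H.decomp.symm.eq]
      simp
    exact fun B C => congrFun (congrFun h1 C) B
  have sL := fun (B C : Fin n ⊕ Fin p) => H.smooth_localLie B (H.smooth_localLie C hs)
  have h1 : localLie g e E β S X 𝒜 A (fun z => ∑ B, ∑ C, γ B C •
        localLie g e E β S X 𝒜 B (localLie g e E β S X 𝒜 C s) z) y
      = ∑ B, ∑ C, γ B C • localLie g e E β S X 𝒜 A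
        (localLie g e E β S X 𝒜 B (localLie g e E β S X 𝒜 C s)) y := by
    have h2 := H.localLie_sum_smul hy (A := A)
      (fun P : (Fin n ⊕ Fin p) × (Fin n ⊕ Fin p) => γ P.1 P.2)
      (f := fun P => localLie g e E β S X 𝒜 P.1 (localLie g e E β S X 𝒜 P.2 s))
      (fun P => sL P.1 P.2)
    simpa only [Fintype.sum_prod_type] using h2
  rw [h1, ← Finset.sum_sub_distrib]
  simp only [← Finset.sum_sub_distrib, ← smul_sub, H.localLie_comp_commutator hF hy hs, smul_add,
    Finset.sum_add_distrib]
  have h3 : ∑ B, ∑ C, γ B C • (killingFlatCurv ι g e E β 𝒜 A C y *ᵥ localLie g e E β S X 𝒜 B s y)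
      = ∑ B, ∑ C, γ B C •
        (killingFlatCurv ι g e E β 𝒜 A B y *ᵥ localLie g e E β S X 𝒜 C s y) := by
    rw [Finset.sum_comm]
    simp only [hsymm]
  have h4 : ∑ B, ∑ C, γ B C • ∑ D, structConst E β F D A B •
        localLie g e E β S X 𝒜 D (localLie g e E β S X 𝒜 C s) y
      + ∑ B, ∑ C, γ B C • ∑ D, structConst E β F D A C •
        localLie g e E β S X 𝒜 B (localLie g e E β S X 𝒜 D s) y = 0 := by
    have h5 : ∀ B D, (∑ C, structConst E β F B A C * γ C D
        + ∑ C, γ B C * structConst E β F D A C) •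
        localLie g e E β S X 𝒜 B (localLie g e E β S X 𝒜 D s) y = 0 := fun B D => by
      rw [hγ, H.frame.gammaMat_inv_invariant H.decomp hF, zero_smul]
    have h6 : ∑ B, ∑ D, (∑ C, structConst E β F B A C * γ C D
        + ∑ C, γ B C * structConst E β F D A C) •
        localLie g e E β S X 𝒜 B (localLie g e E β S X 𝒜 D s) y = 0 :=
      Finset.sum_eq_zero fun B _ => Finset.sum_eq_zero fun D _ => h5 B D
    rw [← h6]
    simp only [add_smul, Finset.sum_add_distrib, Finset.sum_smul, Finset.smul_sum, smul_smul]
    congr 1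
    · rw [Finset.sum_comm, Finset.sum_congr rfl fun C _ => Finset.sum_comm, Finset.sum_comm]
      simp only [mul_comm]
    · exact Finset.sum_congr rfl fun B _ => Finset.sum_comm
  rw [h4, h3, zero_add, two_smul]

end IsTwistedSymmetric

end FlatPart

/-! ### Sections of the bundle in coordinates and a local frame -/

theorem localRep_chart {n : ℕ} {M ι κ 𝕜 : Type*} [TopologicalSpace M] [RCLike 𝕜]
    {𝒱 : M → Type*} [TopologicalSpace (Bundle.TotalSpace (ι × κ → 𝕜) 𝒱)]
    [∀ x, AddCommGroup (𝒱 x)] {φ : OpenPartialHomeomorph M (Coord n)}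
    {τ : Bundle.Trivialization (ι × κ → 𝕜) (Bundle.TotalSpace.proj (F := ι × κ → 𝕜) (E := 𝒱))}
    {σ : ∀ x, 𝒱 x} {x : M} (hx : x ∈ φ.source) :
    localRep φ τ σ (φ x) = (τ ⟨x, σ x⟩).2 := by
  rw [localRep, φ.left_inv hx]

section Transfer

variable {n p : ℕ} {M : Type*} [TopologicalSpace M] [ChartedSpace (Coord n) M]
  {φ : OpenPartialHomeomorph M (Coord n)}

theorem vectorInChart_eq_sum (v : Coord n → Fin n → ℝ) (x : M) :
    vectorInChart φ v x = ∑ μ, v (φ x) μ • coordVec φ μ x := by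
  have h : (WithLp.toLp 2 (v (φ x)) : Coord n)
      = ∑ μ, v (φ x) μ • WithLp.toLp 2 (Pi.single μ 1) := by
    ext a
    simp [Pi.single_apply]
  let L : Coord n →L[ℝ] Coord n := (mfderiv (𝓡 n) (𝓡 n) φ x).inverse
  have h' := congrArg L h
  rw [map_sum] at h'
  simp only [map_smul] at h'
  exact h'

variable {ι κ 𝕜 : Type*} [Fintype ι] [Fintype κ] [RCLike 𝕜]
  {𝒱 : M → Type*} [TopologicalSpace (Bundle.TotalSpace (ι × κ → 𝕜) 𝒱)]
  [∀ x, AddCommGroup (𝒱 x)] [∀ x, Module ℝ (𝒱 x)] [∀ x, TopologicalSpace (𝒱 x)]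
  [FiberBundle (ι × κ → 𝕜) 𝒱]
  {τ : Bundle.Trivialization (ι × κ → 𝕜) (Bundle.TotalSpace.proj (F := ι × κ → 𝕜) (E := 𝒱))}
  {σ : ∀ x, 𝒱 x}

theorem contDiffOn_localRep [IsManifold (𝓡 n) ∞ M]
    (hφ : φ ∈ IsManifold.maximalAtlas (𝓡 n) ∞ M) (hτ : IsSmoothLocalFrame (n := n) τ φ.source)
    (hσ : ContMDiffOn (𝓡 n) ((𝓡 n).prod 𝓘(ℝ, ι × κ → 𝕜)) ∞
      (fun x => Bundle.TotalSpace.mk' (ι × κ → 𝕜) x (σ x)) φ.source) :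
    ContDiffOn ℝ ∞ (localRep φ τ σ) φ.target := by
  rw [← contMDiffOn_iff_contDiffOn]
  have h1 := contMDiffOn_symm_of_mem_maximalAtlas hφ
  have h2 := hσ.comp h1 φ.mapsTo_symm
  have h3 := hτ.smooth.comp h2 fun y hy =>
    τ.mem_source.2 (hτ.subset (φ.map_target hy))
  exact contMDiff_snd.comp_contMDiffOn h3

theorem contMDiffOn_of_localRep [IsManifold (𝓡 n) ∞ M]
    (hφ : φ ∈ IsManifold.maximalAtlas (𝓡 n) ∞ M) (hτ : IsSmoothLocalFrame (n := n) τ φ.source)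
    (hσ : ContDiffOn ℝ ∞ (localRep φ τ σ) φ.target) :
    ContMDiffOn (𝓡 n) ((𝓡 n).prod 𝓘(ℝ, ι × κ → 𝕜)) ∞
      (fun x => Bundle.TotalSpace.mk' (ι × κ → 𝕜) x (σ x)) φ.source := by
  rw [← contMDiffOn_iff_contDiffOn] at hσ
  have h1 := hσ.comp (contMDiffOn_of_mem_maximalAtlas hφ) φ.mapsTo
  have h2 := hτ.smooth_symm.comp (contMDiffOn_id.prodMk h1) fun x hx =>
    τ.mem_target.2 (hτ.subset hx)
  refine h2.congr fun x hx => ?_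
  have h3 : (⟨x, σ x⟩ : Bundle.TotalSpace (ι × κ → 𝕜) 𝒱) ∈ τ.source :=
    τ.mem_source.2 (hτ.subset hx)
  have h4 : τ ⟨x, σ x⟩ = (x, localRep φ τ σ (φ x)) :=
    Prod.ext (τ.coe_fst h3) (localRep_chart hx).symm
  change _ = τ.toOpenPartialHomeomorph.symm (x, localRep φ τ σ (φ x))
  rw [← h4]
  exact (τ.toOpenPartialHomeomorph.left_inv h3).symm

/-- A local frame separates the vectors of a fibre. -/
theorem eq_of_localFrame (hτ : IsSmoothLocalFrame (n := n) τ φ.source) {x : M} (hx : x ∈ φ.source)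
    {a b : 𝒱 x} (h : (τ ⟨x, a⟩).2 = (τ ⟨x, b⟩).2) : a = b := by
  have := hτ.isLinear
  have hb := hτ.subset hx
  have h1 := congrArg (τ.symm x) h
  have h2 : ∀ c : 𝒱 x, τ.symm x (τ ⟨x, c⟩).2 = c := fun c => by
    have h3 := τ.symm_linearMapAt (R := ℝ) hb c
    rwa [τ.coe_linearMapAt_of_mem hb] at h3
  rwa [h2, h2] at h1

theorem endoAct_apply (hτ : IsSmoothLocalFrame (n := n) τ φ.source)
    (T : Coord n → Matrix (ι × κ) (ι × κ) 𝕜) {x : M} (hx : x ∈ φ.source) :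
    (τ ⟨x, endoAct φ τ T σ x⟩).2 = T (φ x) *ᵥ (τ ⟨x, σ x⟩).2 := by
  rw [endoAct, τ.apply_mk_symm (hτ.subset hx)]

variable [DecidableEq ι] [DecidableEq κ]
  [∀ x, IsTopologicalAddGroup (𝒱 x)] [∀ x, ContinuousSMul ℝ (𝒱 x)]
  {g e : Coord n → Matrix (Fin n) (Fin n) ℝ}
  {E : Fin p → Matrix (Fin n) (Fin n) ℝ} {β : Matrix (Fin p) (Fin p) ℝ}
  {S : Fin n → Fin n → Matrix ι ι 𝕜} {X : Fin n → Fin n → Matrix κ κ 𝕜}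
  {𝒜 : Coord n → Fin n → Matrix κ κ 𝕜} {cov : CovariantDerivative (𝓡 n) (ι × κ → 𝕜) 𝒱}

/-- The twisted Lie derivatives in coordinates. -/
theorem localRep_twistedLie (hτ : IsSmoothLocalFrame (n := n) τ φ.source)
    (hcov : IsTwistedSpinConnection φ τ g e S 𝒜 cov)
    (hσ : ContMDiffOn (𝓡 n) ((𝓡 n).prod 𝓘(ℝ, ι × κ → 𝕜)) ∞
      (fun x => Bundle.TotalSpace.mk' (ι × κ → 𝕜) x (σ x)) φ.source)
    (A : Fin n ⊕ Fin p) {y : Coord n} (hy : y ∈ φ.target) :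
    localRep φ τ (twistedLie φ τ cov g e E β S X A σ) y
      = localLie g e E β S X 𝒜 A (localRep φ τ σ) y := by
  have := hτ.isLinear
  have hx := φ.map_target hy
  have hb := hτ.subset hx
  have hd : MDifferentiableAt (𝓡 n) ((𝓡 n).prod 𝓘(ℝ, ι × κ → 𝕜))
      (fun x => Bundle.TotalSpace.mk' (ι × κ → 𝕜) x (σ x)) (φ.symm y) :=
    (hσ.contMDiffAt (φ.open_source.mem_nhds hx)).mdifferentiableAt (by simp)
  have hl : ∀ c : 𝒱 (φ.symm y), (τ ⟨φ.symm y, c⟩).2 = τ.linearMapAt ℝ (φ.symm y) c := fun c => by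
    rw [τ.coe_linearMapAt_of_mem hb]
  have hμ := hcov y hy σ hd
  have he := endoAct_apply (σ := σ) hτ (lieEndo g e E β S X A) hx
  rw [φ.right_inv hy] at he
  simp only [hl] at hμ he
  rw [localRep, twistedLie, hl, map_add, he, vectorInChart_eq_sum, map_sum, map_sum,
    φ.right_inv hy]
  simp only [map_smul, hμ]
  rw [localLie, covOp, dirDeriv, Matrix.add_mulVec, Matrix.sum_mulVec]
  simp only [smul_add, Finset.sum_add_distrib, Matrix.smul_mulVec, add_assoc]
  rw [← hl]
  rfl

theorem contMDiffOn_twistedLie [IsManifold (𝓡 n) ∞ M]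
    (hφ : φ ∈ IsManifold.maximalAtlas (𝓡 n) ∞ M) (hτ : IsSmoothLocalFrame (n := n) τ φ.source)
    (hcov : IsTwistedSpinConnection φ τ g e S 𝒜 cov)
    (H : IsTwistedSymmetric φ.target g e E β S X 𝒜)
    (hσ : ContMDiffOn (𝓡 n) ((𝓡 n).prod 𝓘(ℝ, ι × κ → 𝕜)) ∞
      (fun x => Bundle.TotalSpace.mk' (ι × κ → 𝕜) x (σ x)) φ.source) (A : Fin n ⊕ Fin p) :
    ContMDiffOn (𝓡 n) ((𝓡 n).prod 𝓘(ℝ, ι × κ → 𝕜)) ∞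
      (fun x => Bundle.TotalSpace.mk' (ι × κ → 𝕜) x (twistedLie φ τ cov g e E β S X A σ x))
      φ.source :=
  contMDiffOn_of_localRep hφ hτ ((H.smooth_localLie A (contDiffOn_localRep hφ hτ hσ)).congr
    fun _ hy => localRep_twistedLie hτ hcov hσ A hy)

theorem localRep_twistedLie_twistedLie [IsManifold (𝓡 n) ∞ M]
    (hφ : φ ∈ IsManifold.maximalAtlas (𝓡 n) ∞ M) (hτ : IsSmoothLocalFrame (n := n) τ φ.source)
    (hcov : IsTwistedSpinConnection φ τ g e S 𝒜 cov)
    (H : IsTwistedSymmetric φ.target g e E β S X 𝒜)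
    (hσ : ContMDiffOn (𝓡 n) ((𝓡 n).prod 𝓘(ℝ, ι × κ → 𝕜)) ∞
      (fun x => Bundle.TotalSpace.mk' (ι × κ → 𝕜) x (σ x)) φ.source) (A B : Fin n ⊕ Fin p)
    {y : Coord n} (hy : y ∈ φ.target) :
    localRep φ τ (twistedLie φ τ cov g e E β S X A (twistedLie φ τ cov g e E β S X B σ)) y
      = localLie g e E β S X 𝒜 A (localLie g e E β S X 𝒜 B (localRep φ τ σ)) y := by
  rw [localRep_twistedLie hτ hcov (contMDiffOn_twistedLie hφ hτ hcov H hσ B) A hy,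
    H.localLie_congr hy (fun z hz => localRep_twistedLie hτ hcov hσ B hz)]

theorem localRep_twistedLieSq [IsManifold (𝓡 n) ∞ M]
    (hφ : φ ∈ IsManifold.maximalAtlas (𝓡 n) ∞ M) (hτ : IsSmoothLocalFrame (n := n) τ φ.source)
    (hcov : IsTwistedSpinConnection φ τ g e S 𝒜 cov)
    (H : IsTwistedSymmetric φ.target g e E β S X 𝒜)
    (hσ : ContMDiffOn (𝓡 n) ((𝓡 n).prod 𝓘(ℝ, ι × κ → 𝕜)) ∞
      (fun x => Bundle.TotalSpace.mk' (ι × κ → 𝕜) x (σ x)) φ.source)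
    {y : Coord n} (hy : y ∈ φ.target) :
    localRep φ τ (twistedLieSq φ τ cov g e E β S X σ) y
      = ∑ A, ∑ B, (gammaMat n β)⁻¹ A B •
        localLie g e E β S X 𝒜 A (localLie g e E β S X 𝒜 B (localRep φ τ σ)) y := by
  have := hτ.isLinear
  have hb := hτ.subset (φ.map_target hy)
  have hl : ∀ c : 𝒱 (φ.symm y), (τ ⟨φ.symm y, c⟩).2 = τ.linearMapAt ℝ (φ.symm y) c := fun c => by
    rw [τ.coe_linearMapAt_of_mem hb]
  rw [localRep, twistedLieSq, hl, map_sum]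
  simp only [map_sum, map_smul]
  simp only [← hl]
  exact Finset.sum_congr rfl fun A _ => Finset.sum_congr rfl fun B _ =>
    congrArg _ (localRep_twistedLie_twistedLie hφ hτ hcov H hσ A B hy)

theorem contMDiffOn_twistedLieSq [IsManifold (𝓡 n) ∞ M]
    (hφ : φ ∈ IsManifold.maximalAtlas (𝓡 n) ∞ M) (hτ : IsSmoothLocalFrame (n := n) τ φ.source)
    (hcov : IsTwistedSpinConnection φ τ g e S 𝒜 cov)
    (H : IsTwistedSymmetric φ.target g e E β S X 𝒜)
    (hσ : ContMDiffOn (𝓡 n) ((𝓡 n).prod 𝓘(ℝ, ι × κ → 𝕜)) ∞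
      (fun x => Bundle.TotalSpace.mk' (ι × κ → 𝕜) x (σ x)) φ.source) :
    ContMDiffOn (𝓡 n) ((𝓡 n).prod 𝓘(ℝ, ι × κ → 𝕜)) ∞
      (fun x => Bundle.TotalSpace.mk' (ι × κ → 𝕜) x (twistedLieSq φ τ cov g e E β S X σ x))
      φ.source := by
  have hs := contDiffOn_localRep hφ hτ hσ
  exact contMDiffOn_of_localRep hφ hτ ((ContDiffOn.sum fun A _ => ContDiffOn.sum fun B _ =>
    (H.smooth_localLie A (H.smooth_localLie B hs)).const_smul ((gammaMat n β)⁻¹ A B)).congr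
      fun _ hy => localRep_twistedLieSq hφ hτ hcov H hσ hy)

end Transfer

end SymmetricBundle

end

theorem mainTheorem6
    {n p : ℕ}
    -- the Riemannian manifold, normal coordinates on a patch, and the radially parallel frame
    {M : Type*} [TopologicalSpace M] [ChartedSpace (Coord n) M] [IsManifold (𝓡 n) ∞ M]
    [Bundle.RiemannianBundle (fun x : M => TangentSpace (𝓡 n) x)]
    [IsContMDiffRiemannianBundle (𝓡 n) ∞ (Coord n) (fun x : M => TangentSpace (𝓡 n) x)]
    (x' : M) (φ : OpenPartialHomeomorph M (Coord n)) (hφ : IsNormalChart φ x')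
    (g : Coord n → Matrix (Fin n) (Fin n) ℝ) (hg : g = metricInChart φ)
    (e : Coord n → Matrix (Fin n) (Fin n) ℝ) (he : IsRadialFrame g e φ.target)
    -- the Riemann tensor is parallel, and its decomposition at the centre of the patch
    (hR : ∀ y ∈ φ.target, ∀ μ a b c d, covRiemann g e y μ a b c d = 0)
    (E : Fin p → Matrix (Fin n) (Fin n) ℝ) (β : Matrix (Fin p) (Fin p) ℝ)
    (hE : IsCurvDecomp (riemann g e 0) E β)
    -- the representations `Σ` and `X`, and the Yang-Mills connection with parallel curvature
    {ι κ 𝕜 : Type*} [Fintype ι] [DecidableEq ι] [Fintype κ] [DecidableEq κ] [RCLike 𝕜]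
    (S : Fin n → Fin n → Matrix ι ι 𝕜) (hS : IsSOGenerators S)
    (X : Fin n → Fin n → Matrix κ κ 𝕜) (hX : IsSOGenerators X)
    (𝒜 : Coord n → Fin n → Matrix κ κ 𝕜)
    (h𝒜 : ∀ μ i j, ContDiffOn ℝ ∞ (fun y => 𝒜 y μ i j) φ.target)
    (hF : ∀ y ∈ φ.target, ∀ μ a b, covGaugeCurv g e 𝒜 y μ a b = 0)
    (hFX : ∀ y ∈ φ.target, ∀ a b, semisimpleCurv g e 𝒜 y a b =
      (1 / 2 : ℝ) • ∑ c, ∑ d, riemann g e y c d a b • X c d)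
    -- the twisted spin-tensor bundle, a local frame over the patch, and the total connection
    {𝒱 : M → Type*} [TopologicalSpace (Bundle.TotalSpace (ι × κ → 𝕜) 𝒱)]
    [∀ x, AddCommGroup (𝒱 x)] [∀ x, Module ℝ (𝒱 x)] [∀ x, TopologicalSpace (𝒱 x)]
    [∀ x, IsTopologicalAddGroup (𝒱 x)] [∀ x, ContinuousSMul ℝ (𝒱 x)]
    [FiberBundle (ι × κ → 𝕜) 𝒱] [VectorBundle ℝ (ι × κ → 𝕜) 𝒱]
    [ContMDiffVectorBundle ∞ (ι × κ → 𝕜) 𝒱 (𝓡 n)]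
    (τ : Bundle.Trivialization (ι × κ → 𝕜) (Bundle.TotalSpace.proj (F := ι × κ → 𝕜) (E := 𝒱)))
    (hτ : IsSmoothLocalFrame (n := n) τ φ.source)
    (cov : CovariantDerivative (𝓡 n) (ι × κ → 𝕜) 𝒱)
    (hcov : IsTwistedSpinConnection φ τ g e S 𝒜 cov) :
    -- the structure constants `F^j_{ik}` of the holonomy algebra (unique, since the `D_i` are
    -- linearly independent)
    ∃ F : Fin p → Fin p → Fin p → ℝ,
      (∀ i k, holonomyGen E β i * holonomyGen E β k - holonomyGen E β k * holonomyGen E β i =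
        ∑ j, F j i k • holonomyGen E β j) ∧
      ∀ σ : (∀ x, 𝒱 x),
        ContMDiffOn (𝓡 n) ((𝓡 n).prod 𝓘(ℝ, ι × κ → 𝕜)) ∞
          (fun x => Bundle.TotalSpace.mk' (ι × κ → 𝕜) x (σ x)) φ.source →
        ∀ x ∈ φ.source,
          let 𝓛 := twistedLie φ τ cov g e E β S X
          let 𝓛sq := twistedLieSq φ τ cov g e E β S X
          let 𝓑 := fun A B => endoAct (𝒱 := 𝒱) φ τ (killingFlatCurv ι g e E β 𝒜 A B)
          (∀ A B, 𝓛 A (𝓛 B σ) x - 𝓛 B (𝓛 A σ) x =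
            ∑ C, structConst E β F C A B • 𝓛 C σ x + 𝓑 A B σ x) ∧
          (∀ A, 𝓛 A (𝓛sq σ) x - 𝓛sq (𝓛 A σ) x =
            (2 : ℝ) • ∑ B, ∑ C, (gammaMat n β)⁻¹ B C • 𝓑 A B (𝓛 C σ) x) := by
  have h0 : (0 : Coord n) ∈ φ.target := hφ.map_center ▸ φ.map_source hφ.mem_source
  have hframe := he.symmetricFrame φ.open_target hφ.starConvex h0
    (fun y hy ν => by rw [hg]; exact hφ.geodesic y hy ν) hR
  have H : IsTwistedSymmetric φ.target g e E β S X 𝒜 :=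
    ⟨he, hframe, hE, fun y hy => he.riemann_const φ.open_target hφ.starConvex hR hy,
      he.parallelGauge φ.open_target hφ.starConvex hR h𝒜 hF hFX, hS, hX⟩
  obtain ⟨F, hFc⟩ := hframe.exists_structConst hE
  refine ⟨F, hFc, fun σ hσ x hx => ?_⟩
  have hlin := hτ.isLinear
  have hy := φ.map_source hx
  have hs := contDiffOn_localRep hφ.mem_atlas hτ hσ
  have hL := fun A => contMDiffOn_twistedLie hφ.mem_atlas hτ hcov H hσ A
  have hl : ∀ c : 𝒱 x, (τ ⟨x, c⟩).2 = τ.linearMapAt ℝ x c := fun c => by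
    rw [τ.coe_linearMapAt_of_mem (hτ.subset hx)]
  have hrep : ∀ ρ : (∀ x, 𝒱 x), τ.linearMapAt ℝ x (ρ x) = localRep φ τ ρ (φ x) := fun ρ => by
    rw [← hl, localRep_chart hx]
  have hB : ∀ (T : Coord n → Matrix (ι × κ) (ι × κ) 𝕜) (ρ : ∀ x, 𝒱 x),
      τ.linearMapAt ℝ x (endoAct φ τ T ρ x) = (T (φ x)).mulVec (localRep φ τ ρ (φ x)) :=
    fun T ρ => by rw [← hl, endoAct_apply hτ T hx, localRep_chart hx]
  refine ⟨fun A B => eq_of_localFrame hτ hx ?_, fun A => eq_of_localFrame hτ hx ?_⟩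
  · rw [hl, hl, map_sub, map_add, map_sum, hB, hrep, hrep,
      localRep_twistedLie_twistedLie hφ.mem_atlas hτ hcov H hσ A B hy,
      localRep_twistedLie_twistedLie hφ.mem_atlas hτ hcov H hσ B A hy,
      H.localLie_commutator hFc hy hs]
    simp only [map_smul, hrep, localRep_twistedLie hτ hcov hσ _ hy]
  · have hsq : ∀ y ∈ φ.target, localRep φ τ (twistedLieSq φ τ cov g e E β S X
        (twistedLie φ τ cov g e E β S X A σ)) y = ∑ B, ∑ C, (gammaMat n β)⁻¹ B C •
          localLie g e E β S X 𝒜 B (localLie g e E β S X 𝒜 C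
            (localLie g e E β S X 𝒜 A (localRep φ τ σ))) y := fun y hy => by
      rw [localRep_twistedLieSq hφ.mem_atlas hτ hcov H (hL A) hy]
      refine Finset.sum_congr rfl fun B _ => Finset.sum_congr rfl fun C _ => ?_
      rw [H.localLie_congr hy fun z hz => H.localLie_congr hz
        (fun w hw => localRep_twistedLie hτ hcov hσ A hw) C]
    rw [hl, hl, map_sub, map_smul, map_sum, hrep, hrep, hsq _ hy,
      localRep_twistedLie hτ hcov (contMDiffOn_twistedLieSq hφ.mem_atlas hτ hcov H hσ) A hy,
      H.localLie_congr hy (fun z hz => localRep_twistedLieSq hφ.mem_atlas hτ hcov H hσ hz),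
      H.localLie_commutator_sq hFc hy hs]
    simp only [map_sum, map_smul, hB, localRep_twistedLie hτ hcov hσ _ hy]
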